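/- Corollary 2.8 (Lipschitzness of discrete harmonic functions). Let $\Gamma$ be an isoradial graph of mesh $\delta>0$: a locally finite planar graph embedded in $\mathbb C$ with straight edges, whose faces cover the plane and are all inscribed into circles of the common radius $\delta$, the circle centers lying inside the corresponding faces. For an edge $uv$ let $\theta_{uv}$ be the half-angle at $u$ of the rhombus $uwvw'$ with side $\delta$, where $w,w'$ are the centers of the two faces adjacent to $uv$; thus $|u-v|=2\delta\cos\theta_{uv}$. Assume that all angles $2\theta_{uv}$, $\pi-2\theta_{uv}$ of all these rhombi belong to $[\eta,\pi-\eta]$ for some fixed $\eta>0$. For a disc $B(u_0,R)=\{z:|z-u_0|<R\}$, let $\mathrm{Int}\,B^\delta_\Gamma(u_0,R)$ be the vertex set of the largest connected component of the part of $\Gamma$ lying inside $B(u_0,R)$, let $\partial B^\delta_\Gamma(u_0,R)$ be the set of pairs $(a;a_{\mathrm{int}})$ such that $a_{\mathrm{int}}\in \mathrm{Int}\,B^\delta_\Gamma(u_0,R)$, $a\notin \mathrm{Int}\,B^\delta_\Gamma(u_0,R)$ and $a_{\mathrm{int}}a$ is an edge of $\Gamma$ (such a pair is regarded as a boundary vertex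 located at $a$), and let $B^\delta_\Gamma(u_0,R)=\mathrm{Int}\,B^\delta_\Gamma(u_0,R)\cup\partial B^\delta_\Gamma(u_0,R)$. A function $H:B^\delta_\Gamma(u_0,R)\to\mathbb R$ is discrete harmonic if at every $u\in\mathrm{Int}\,B^\delta_\Gamma(u_0,R)$ its discrete Laplacian vanishes: $$[\Delta^\delta H](u)=\frac1{\mu^\delta_\Gamma(u)}\sum_{u_s\sim u}\tan\theta_{uu_s}\,\bigl(H(u_s)-H(u)\bigr)=0,\qquad \mu^\delta_\Gamma(u)=\frac{\delta^2}{2}\sum_{u_s\sim u}\sin2\theta_{uu_s},$$ where $H(u_s)$ means $H((u_s;u))$ if $u_s\notin\mathrm{Int}\,B^\delta_\Gamma(u_0,R)$. Then there is a constant $C>0$ depending only on $\eta$ (not on $\delta$, $\Gamma$, $u_0$, $R$, $r$, $H$) such that the following holds. Let $H$ be discrete harmonic in $B^\delta_\Gamma(u_0,R)$ and let $u_1,u_2\in B^\delta_\Gamma(u_0,r)\subset\mathrm{Int}\,B^\delta_\Gamma(u_0,R)$ (the inclusion being that of the points at which the vertices are located). Then $$|H(u_2)-H(u_1)|\le C\cdot\frac{M\,|u_2-u_1|}{R-r},\qquad\text{where}\quad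 M=\max_{B^\delta_\Gamma(u_0,R)}|H(u)|.$$ -/

import Mathlib

/-- An isoradial graph `Γ` of mesh `δ`: a (locally finite) planar graph embedded in `ℂ` with
straight edges, all of whose faces are inscribed into circles of the common radius `δ`, the circle
centers being inside the corresponding faces. The graph is given by its faces: a face is recorded
as the finite set of its vertices, and as a region of the plane it is the (convex, inscribed)
polygon spanned by these vertices. The faces tile the plane edge-to-edge. -/
structure IsoradialGraph (δ : ℝ) where
  /-- the vertex sets of the faces -/
  faces : Set (Finset ℂ)
  /-- each face is inscribed into a circle of radius `δ` whose center is inside the face -/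
  inscribed : ∀ F ∈ faces,
    ∃ w ∈ interior (convexHull ℝ (F : Set ℂ)), ∀ u ∈ F, dist u w = δ
  /-- the (closed) faces cover the plane -/
  cover : ⋃ F ∈ faces, convexHull ℝ (F : Set ℂ) = Set.univ
  /-- distinct (open) faces do not overlap -/
  disjoint_interior : ∀ F ∈ faces, ∀ G ∈ faces, F ≠ G →
    Disjoint (interior (convexHull ℝ (F : Set ℂ))) (interior (convexHull ℝ (G : Set ℂ)))
  /-- distinct closed faces meet exactly along the vertices and sides that they share -/
  edge_to_edge : ∀ F ∈ faces, ∀ G ∈ faces, F ≠ G →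
    convexHull ℝ (F : Set ℂ) ∩ convexHull ℝ (G : Set ℂ) =
      convexHull ℝ ((F : Set ℂ) ∩ (G : Set ℂ))
  /-- only finitely many faces come near any given point -/
  locallyFinite : LocallyFinite fun F : faces => convexHull ℝ ((F : Finset ℂ) : Set ℂ)

namespace IsoradialGraph

variable {δ : ℝ} (Γ : IsoradialGraph δ)

/-- The vertices of `Γ`. -/
def vertices : Set ℂ := {u | ∃ F ∈ Γ.faces, u ∈ F}

/-- The edges of `Γ` are the sides of its faces; every side separates two faces, so `u ∼ v` iff
`u ≠ v` are both vertices of two different faces. (Two different faces having `u` and `v` in common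
meet exactly along the segment `[u, v]`, which is a side of both.) -/
def graph : SimpleGraph ℂ where
  Adj u v := u ≠ v ∧ ∃ F ∈ Γ.faces, ∃ G ∈ Γ.faces, F ≠ G ∧ u ∈ F ∧ v ∈ F ∧ u ∈ G ∧ v ∈ G
  symm := ⟨by
    rintro u v ⟨h, F, hF, G, hG, hFG, h1, h2, h3, h4⟩
    exact ⟨h.symm, F, hF, G, hG, hFG, h2, h1, h4, h3⟩⟩
  loopless := ⟨fun _ h => h.1 rfl⟩

theorem finite_neighborSet (u : ℂ) : (Γ.graph.neighborSet u).Finite := by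
  have h : {F : Γ.faces | u ∈ convexHull ℝ ((F : Finset ℂ) : Set ℂ)}.Finite :=
    Γ.locallyFinite.point_finite u
  refine (h.biUnion fun F _ => (F : Finset ℂ).finite_toSet).subset ?_
  rintro v ⟨-, F, hF, -, -, -, hu, hv, -⟩
  exact Set.mem_biUnion (x := (⟨F, hF⟩ : Γ.faces))
    (subset_convexHull ℝ _ (Finset.mem_coe.2 hu)) (Finset.mem_coe.2 hv)

noncomputable instance fintypeNeighborSet (u : ℂ) : Fintype (Γ.graph.neighborSet u) :=
  (Γ.finite_neighborSet u).fintype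

/-- The half-angle `θ` at `u` (equivalently, at `v`) of the rhombus `u w v w'` having the edge `uv`
as a diagonal, where `w`, `w'` are the centers of the two faces adjacent to `uv`. All sides of this
rhombus have length `δ`, so `|u - v| = 2 δ cos θ`. -/
noncomputable def halfAngle (_Γ : IsoradialGraph δ) (u v : ℂ) : ℝ :=
  Real.arccos (dist u v / (2 * δ))

/-- All angles of all rhombi belong to `[η, π - η]` (the angles of the rhombus of an edge `uv` with
half-angle `θ` are `2θ` and `π - 2θ`). -/
def AnglesBounded (η : ℝ) : Prop :=
  ∀ u v, Γ.graph.Adj u v → 2 * Γ.halfAngle u v ∈ Set.Icc η (Real.pi - η)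

/-- The part of `Γ` lying inside `Ω`: the vertices of `Γ` in `Ω`, joined by the edges of `Γ` that
are contained in `Ω`. -/
def inside (Ω : Set ℂ) : SimpleGraph ↥(Γ.vertices ∩ Ω) where
  Adj u v := Γ.graph.Adj u v ∧ segment ℝ (u : ℂ) v ⊆ Ω
  symm := ⟨fun u v h => ⟨h.1.symm, by rw [segment_symm]; exact h.2⟩⟩
  loopless := ⟨fun _ h => Γ.graph.loopless.irrefl _ h.1⟩

/-- `V` is the set of interior vertices of the discretization of `Ω`: the largest connected
component of the part of `Γ` lying inside `Ω`. -/
def IsDiscretization (Ω V : Set ℂ) : Prop :=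
  ∃ K : (Γ.inside Ω).ConnectedComponent,
    V = Subtype.val '' K.supp ∧
      ∀ K' : (Γ.inside Ω).ConnectedComponent, K'.supp.encard ≤ K.supp.encard

/-- The boundary vertices of the discrete domain with the set `V` of interior vertices: the pairs
`(a, a_int)` where `a_int ∈ V`, `a ∉ V` and `a_int a` is an edge. -/
def boundary (V : Set ℂ) : Set (ℂ × ℂ) :=
  {p | p.2 ∈ V ∧ p.1 ∉ V ∧ Γ.graph.Adj p.2 p.1}

/-- The discrete domain with the set `V` of interior vertices: its elements are the interior
vertices and the boundary vertices. -/
abbrev Domain (V : Set ℂ) : Type := ↥V ⊕ ↥(Γ.boundary V)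

/-- The points of the plane at which the (interior and boundary) vertices of the discrete domain
are located. -/
def locations (V : Set ℂ) : Set ℂ := V ∪ Prod.fst '' Γ.boundary V

open Classical in
/-- The neighbor `v` of an interior vertex `u`, as an element of the discrete domain. -/
noncomputable def nbr (V : Set ℂ) (u : V) (v : Γ.graph.neighborSet (u : ℂ)) : Γ.Domain V :=
  if h : (v : ℂ) ∈ V then Sum.inl ⟨v, h⟩ else Sum.inr ⟨((v : ℂ), (u : ℂ)), u.2, h, v.2⟩

/-- The weight `(δ² / 2) ∑ sin 2θₛ` of a vertex `u`. -/
noncomputable def weight (u : ℂ) : ℝ :=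
  δ ^ 2 / 2 * ∑ v : Γ.graph.neighborSet u, Real.sin (2 * Γ.halfAngle u v)

/-- The discrete Laplacian of `H` at an interior vertex `u`. -/
noncomputable def laplacian (V : Set ℂ) (H : Γ.Domain V → ℝ) (u : V) : ℝ :=
  1 / Γ.weight u *
    ∑ v : Γ.graph.neighborSet (u : ℂ),
      Real.tan (Γ.halfAngle u v) * (H (Γ.nbr V u v) - H (Sum.inl u))

/-- `H` is discrete harmonic in the discrete domain with the set `V` of interior vertices. -/
def IsDiscreteHarmonic (V : Set ℂ) (H : Γ.Domain V → ℝ) : Prop :=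
  ∀ u : V, Γ.laplacian V H u = 0

end IsoradialGraph

/-! The theorem is a regularity estimate for an isotropic discrete Laplacian, and no asymptotics of
a Green's function are used. Write `b = sin (η / 2)`; every constant depends on `b` only.

The one exact input is algebraic. The center of a face at `u` can be computed from either of the two
sides of the face at `u`, as `u + (v - u)(1 ± i tan θ)/2`. Summing the centers, or their squares,
over the faces at `u` in both ways gives `∑ tan θ (v - u) = 0` and `∑ tan θ (v - u)² = 0`. So affine
functions are discrete harmonic, and the discrete Laplacian agrees with the continuous one up to
third-order errors.

Apply this to a logarithm smoothed at scale `s`: its discrete Laplacian is a bump kernel of width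
`s`, with relative error `O(δ / s)`. Two such potentials agree far away, so Green's formula shows
that the bump averages of a harmonic `H` at scales `s` and `2s` differ by `O(M δ / s)`
(`Regular.smooth_two_mul`). This is a geometric series: all dyadic averages from scale `L δ` upwards
agree up to `O(M / L)`. The averages are also smooth in their center, since differences fall on the
kernel.

It remains to compare `H` with its averages (`exists_sub_average_le`). Where `H` minus its average
almost attains an upper bound, Harnack's inequality along edges makes `H` nearly as large on the
whole disc of radius `L δ`. Hence its average there is large too, which contradicts the agreement of
scales unless the bound was already small.

Thus on a small concentric disc `H` is close to an affine function, with a gain over linear scaling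
(`exists_affine_approx`). The remainder is again harmonic, so the approximation can be iterated down
to the mesh (`exists_lipschitz`). Below that scale the uniform separation of vertices
(`Fat.separated`) makes the trivial bound `2M` sufficient. -/

namespace IsoradialGraph

/-! ### Plane geometry: orientation and circles seen from one of their points. -/

/-- The cross product of two plane vectors. -/
noncomputable def cross (a b : ℂ) : ℝ := ((starRingEnd ℂ) a * b).im

theorem cross_eq (a b : ℂ) : cross a b = a.re * b.im - a.im * b.re := by
  simp [cross, Complex.mul_im]; ring

theorem cross_swap (u v z : ℂ) : cross (u - v) (z - v) = -cross (v - u) (z - u) := by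
  simp only [cross_eq, Complex.sub_re, Complex.sub_im]; ring

theorem convex_cross_nonneg (u v : ℂ) : Convex ℝ {z : ℂ | 0 ≤ cross (v - u) (z - u)} := by
  intro x hx y hy a b ha hb hab
  simp only [Set.mem_ofPred_eq, cross_eq] at *
  have hb' : b = 1 - a := by linarith
  subst hb'
  simp only [Complex.sub_re, Complex.sub_im, Complex.add_re, Complex.add_im, Complex.real_smul,
    Complex.mul_re, Complex.mul_im, Complex.ofReal_re, Complex.ofReal_im] at *
  nlinarith [mul_nonneg ha hx, mul_nonneg hb hy]

/-- An open half-plane together with one boundary point is convex. -/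
theorem convex_insert_cross_pos (u v : ℂ) :
    Convex ℝ {z : ℂ | z = v ∨ 0 < cross (v - u) (z - u)} := by
  have hvv : cross (v - u) (v - u) = 0 := by rw [cross_eq]; ring
  intro x hx y hy a b ha hb hab
  have key : ∀ x y : ℂ, cross (v - u) (a • x + b • y - u) =
      a * cross (v - u) (x - u) + b * cross (v - u) (y - u) := by
    intro x y
    have hb' : b = 1 - a := by linarith
    subst hb'
    simp only [cross_eq, Complex.sub_re, Complex.sub_im, Complex.add_re, Complex.add_im,
      Complex.real_smul, Complex.mul_re, Complex.mul_im, Complex.ofReal_re, Complex.ofReal_im]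
    ring
  rcases hx with rfl | hx <;> rcases hy with rfl | hy
  · left; rw [← add_smul, hab, one_smul]
  · rcases eq_or_lt_of_le hb with h | h
    · left; subst h; rw [zero_smul, add_zero, show a = 1 by linarith, one_smul]
    · right; rw [key, hvv]; nlinarith [mul_pos h hy]
  · rcases eq_or_lt_of_le ha with h | h
    · left; subst h; rw [zero_smul, zero_add, show b = 1 by linarith, one_smul]
    · right; rw [key, hvv]; nlinarith [mul_pos h hx]
  · right
    rw [key]
    rcases eq_or_lt_of_le ha with h | h
    · subst h; rw [zero_mul, zero_add, show b = 1 by linarith, one_mul]; exact hy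
    · nlinarith [mul_pos h hx, mul_nonneg hb hy.le]

/-- Inverting a circle in one of its points gives a straight line. -/
theorem re_div_of_circle {u w z : ℂ} {δ : ℝ} (hu : dist u w = δ) (hz : dist z w = δ)
    (hne : z ≠ u) : ((w - u) / (z - u)).re = 1 / 2 := by
  have h0 : z - u ≠ 0 := sub_ne_zero.2 hne
  have h1 : Complex.normSq (z - u) ≠ 0 := by simpa using h0
  have h2 : Complex.normSq (z - w) = Complex.normSq (u - w) := by
    rw [Complex.normSq_eq_norm_sq, Complex.normSq_eq_norm_sq, ← dist_eq_norm, ← dist_eq_norm,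
      hu, hz]
  have h3 : ((w - u).re * (z - u).re + (w - u).im * (z - u).im) * 2 = Complex.normSq (z - u) := by
    simp only [Complex.normSq_apply, Complex.sub_re, Complex.sub_im] at h2 ⊢
    linarith
  rw [Complex.div_re, ← add_div, div_eq_div_iff h1 two_ne_zero, h3, one_mul]

/-- Both quotients `p` and `q` have real part `1/2`, and `conj (v - u) * (z - u)` is a positive
multiple of `p * conj q`, whose imaginary part is `(p.im - q.im) / 2`. So the points of the circle,
seen from `u`, are ordered by one real coordinate. -/
theorem cross_eq_of_circle {u w v z : ℂ} {δ : ℝ} (hu : dist u w = δ) (hv : dist v w = δ)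
    (hz : dist z w = δ) (hvu : v ≠ u) (hzu : z ≠ u) :
    cross (v - u) (z - u) * δ ^ 2 * 2 = ‖v - u‖ ^ 2 * ‖z - u‖ ^ 2 *
      (((w - u) / (v - u)).im - ((w - u) / (z - u)).im) := by
  have hd : δ ^ 2 = Complex.normSq (w - u) := by
    rw [Complex.normSq_eq_norm_sq, ← dist_eq_norm, dist_comm, hu]
  have hp := re_div_of_circle hu hv hvu
  have hq := re_div_of_circle hu hz hzu
  set p := (w - u) / (v - u) with hpd
  set q := (w - u) / (z - u) with hqd
  have h1 : w - u = p * (v - u) := by rw [hpd, div_mul_cancel₀]; exact sub_ne_zero.2 hvu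
  have h2 : w - u = q * (z - u) := by rw [hqd, div_mul_cancel₀]; exact sub_ne_zero.2 hzu
  have e : (starRingEnd ℂ) (v - u) * (z - u) * (Complex.normSq (w - u) : ℂ) =
      (Complex.normSq (v - u) * Complex.normSq (z - u) : ℝ) * (p * (starRingEnd ℂ) q) := by
    push_cast
    rw [Complex.normSq_eq_conj_mul_self, Complex.normSq_eq_conj_mul_self,
      Complex.normSq_eq_conj_mul_self]
    nth_rewrite 1 [h2]
    rw [h1, map_mul]
    ring
  have e2 := congrArg Complex.im e
  have hpq : (p * (starRingEnd ℂ) q).im = (p.im - q.im) / 2 := by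
    rw [Complex.mul_im, Complex.conj_re, Complex.conj_im, hp, hq]; ring
  rw [mul_comm, Complex.im_ofReal_mul, Complex.im_ofReal_mul, hpq] at e2
  simp only [Complex.normSq_eq_norm_sq] at e2 hd
  rw [cross, hd]
  linarith

/-! ### Sides of a face, and the two faces adjacent to an edge. -/

/-- All points of `F` are to the left of the line from `u` to `v` (or on it). -/
def OnLeft (F : Finset ℂ) (u v : ℂ) : Prop := ∀ z ∈ F, 0 ≤ cross (v - u) (z - u)

variable {δ : ℝ} (Γ : IsoradialGraph δ)

open Classical in
/-- The center of the circumscribed circle of a face. -/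
noncomputable def center (F : Finset ℂ) : ℂ :=
  if h : F ∈ Γ.faces then (Γ.inscribed F h).choose else 0

variable {Γ}
variable {F G : Finset ℂ} {u v z : ℂ}

theorem center_mem (hF : F ∈ Γ.faces) : Γ.center F ∈ interior (convexHull ℝ (F : Set ℂ)) := by
  rw [center, dif_pos hF]; exact (Γ.inscribed F hF).choose_spec.1

theorem dist_center (hF : F ∈ Γ.faces) (hu : u ∈ F) : dist u (Γ.center F) = δ := by
  rw [center, dif_pos hF]; exact (Γ.inscribed F hF).choose_spec.2 u hu

theorem center_ne (hδ : 0 < δ) (hF : F ∈ Γ.faces) (hu : u ∈ F) : Γ.center F - u ≠ 0 := by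
  intro h
  have := dist_center hF hu
  rw [dist_comm, dist_eq_norm, h, norm_zero] at this
  exact hδ.ne this

theorem OnLeft.cross_nonneg (h : OnLeft F u v) (hz : z ∈ convexHull ℝ (F : Set ℂ)) :
    0 ≤ cross (v - u) (z - u) :=
  convexHull_min (fun _ hx => h _ (Finset.mem_coe.1 hx)) (convex_cross_nonneg u v) hz

/-- The center is interior, so a small move to the right, in the direction `-i (v - u)`, stays in
the face and hence in the closed half-plane. This leaves strict positivity for the center itself. -/
theorem OnLeft.cross_center_pos (hF : F ∈ Γ.faces) (hne : u ≠ v) (h : OnLeft F u v) :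
    0 < cross (v - u) (Γ.center F - u) := by
  set w := Γ.center F
  have hopen : ∀ᶠ t : ℝ in nhds 0,
      w - (t : ℂ) * (Complex.I * (v - u)) ∈ convexHull ℝ (F : Set ℂ) := by
    have hc : Continuous fun t : ℝ => w - (t : ℂ) * (Complex.I * (v - u)) := by fun_prop
    have h0 : interior (convexHull ℝ (F : Set ℂ)) ∈
        nhds (w - ((0 : ℝ) : ℂ) * (Complex.I * (v - u))) := by
      simpa using isOpen_interior.mem_nhds (center_mem hF)
    filter_upwards [hc.continuousAt.preimage_mem_nhds h0] with t ht using interior_subset ht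
  obtain ⟨ε, hε, hball⟩ := Metric.eventually_nhds_iff.1 hopen
  have hmem := hball (y := ε / 2) (by
    rw [Real.dist_eq, sub_zero, abs_of_pos (by linarith)]; linarith)
  have h1 := h.cross_nonneg hmem
  have h2 : 0 < Complex.normSq (v - u) := Complex.normSq_pos.2 (sub_ne_zero.2 hne.symm)
  have h3 : cross (v - u) (w - ((ε / 2 : ℝ) : ℂ) * (Complex.I * (v - u)) - u) =
      cross (v - u) (w - u) - ε / 2 * Complex.normSq (v - u) := by
    simp [cross_eq, Complex.normSq_apply]
    ring
  rw [h3] at h1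
  nlinarith

theorem not_onLeft_both (hF : F ∈ Γ.faces) (hne : u ≠ v) (h : OnLeft F u v) :
    ¬ OnLeft F v u := by
  intro h'
  have h1 := h.cross_center_pos hF hne
  have h2 := h'.cross_center_pos hF hne.symm
  rw [cross_swap] at h2
  linarith

theorem eq_of_im_div_eq {w : ℂ} (hw : dist u w = δ) (hw0 : w - u ≠ 0) (hv : dist v w = δ)
    (hz : dist z w = δ) (hvu : v ≠ u) (hzu : z ≠ u)
    (h : ((w - u) / (v - u)).im = ((w - u) / (z - u)).im) : v = z := by
  have e : (w - u) / (v - u) = (w - u) / (z - u) :=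
    Complex.ext (by rw [re_div_of_circle hw hv hvu, re_div_of_circle hw hz hzu]) h
  rw [div_eq_div_iff (sub_ne_zero.2 hvu) (sub_ne_zero.2 hzu)] at e
  have := mul_left_cancel₀ hw0 e
  exact (sub_left_injective this).symm

theorem cross_nonneg_iff (hδ : 0 < δ) (hF : F ∈ Γ.faces) (hu : u ∈ F) (hv : v ∈ F) (hz : z ∈ F)
    (hvu : v ≠ u) (hzu : z ≠ u) :
    0 ≤ cross (v - u) (z - u) ↔
      ((Γ.center F - u) / (z - u)).im ≤ ((Γ.center F - u) / (v - u)).im := by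
  have h := cross_eq_of_circle (dist_center hF hu) (dist_center hF hv) (dist_center hF hz) hvu hzu
  have h1 : 0 < ‖v - u‖ ^ 2 * ‖z - u‖ ^ 2 := by
    have := norm_pos_iff.2 (sub_ne_zero.2 hvu)
    have := norm_pos_iff.2 (sub_ne_zero.2 hzu)
    positivity
  have h2 : 0 < δ ^ 2 * 2 := by positivity
  constructor
  · intro h3
    have : 0 ≤ cross (v - u) (z - u) * δ ^ 2 * 2 := by positivity
    rw [h] at this
    linarith [nonneg_of_mul_nonneg_right this h1]
  · intro h3
    have : 0 ≤ cross (v - u) (z - u) * (δ ^ 2 * 2) := by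
      rw [← mul_assoc, h]; exact mul_nonneg h1.le (by linarith)
    exact nonneg_of_mul_nonneg_left this h2

theorem cross_nonpos_iff (hδ : 0 < δ) (hF : F ∈ Γ.faces) (hu : u ∈ F) (hv : v ∈ F) (hz : z ∈ F)
    (hvu : v ≠ u) (hzu : z ≠ u) :
    cross (v - u) (z - u) ≤ 0 ↔
      ((Γ.center F - u) / (v - u)).im ≤ ((Γ.center F - u) / (z - u)).im := by
  rw [← cross_nonneg_iff hδ hF hu hz hv hzu hvu]
  have : cross (z - u) (v - u) = - cross (v - u) (z - u) := by simp only [cross_eq]; ring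
  rw [this]; simp

theorem eq_of_cross_eq_zero (hδ : 0 < δ) (hF : F ∈ Γ.faces) (hu : u ∈ F) (hv : v ∈ F) (hz : z ∈ F)
    (hvu : v ≠ u) (hzu : z ≠ u) (h : cross (v - u) (z - u) = 0) : v = z := by
  refine eq_of_im_div_eq (dist_center hF hu) (center_ne hδ hF hu) (dist_center hF hv)
    (dist_center hF hz) hvu hzu (le_antisymm ?_ ?_)
  · exact (cross_nonpos_iff hδ hF hu hv hz hvu hzu).1 h.le
  · exact (cross_nonneg_iff hδ hF hu hv hz hvu hzu).1 h.ge

theorem onLeft_iff (hδ : 0 < δ) (hF : F ∈ Γ.faces) (hu : u ∈ F) (hv : v ∈ F) (hvu : v ≠ u) :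
    OnLeft F u v ↔ ∀ z ∈ F.erase u,
      ((Γ.center F - u) / (z - u)).im ≤ ((Γ.center F - u) / (v - u)).im := by
  constructor
  · intro h z hz
    have hz' := Finset.mem_erase.1 hz
    exact (cross_nonneg_iff hδ hF hu hv hz'.2 hvu hz'.1).1 (h z hz'.2)
  · intro h z hz
    by_cases hzu : z = u
    · subst hzu; simp [cross_eq]
    · exact (cross_nonneg_iff hδ hF hu hv hz hvu hzu).2 (h z (Finset.mem_erase.2 ⟨hzu, hz⟩))

theorem onLeft_swap_iff (hδ : 0 < δ) (hF : F ∈ Γ.faces) (hu : u ∈ F) (hv : v ∈ F) (hvu : v ≠ u) :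
    OnLeft F v u ↔ ∀ z ∈ F.erase u,
      ((Γ.center F - u) / (v - u)).im ≤ ((Γ.center F - u) / (z - u)).im := by
  constructor
  · intro h z hz
    have hz' := Finset.mem_erase.1 hz
    have := h z hz'.2
    rw [cross_swap] at this
    exact (cross_nonpos_iff hδ hF hu hv hz'.2 hvu hz'.1).1 (by linarith)
  · intro h z hz
    rw [cross_swap]
    by_cases hzu : z = u
    · subst hzu; simp [cross_eq]
    · linarith [(cross_nonpos_iff hδ hF hu hv hz hvu hzu).2 (h z (Finset.mem_erase.2 ⟨hzu, hz⟩))]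

theorem erase_nonempty (hF : F ∈ Γ.faces) (u : ℂ) : (F.erase u).Nonempty := by
  by_contra h
  rw [Finset.not_nonempty_iff_eq_empty, Finset.erase_eq_empty_iff] at h
  have hw := center_mem hF
  rcases h with h | h <;> simp [h] at hw

/-- The two sides of a face at `u` lead to the vertices with the largest and the smallest inverted
coordinate `((w - u) / (z - u)).im`; the maximum has the face on its left. -/
theorem exists_onLeft (hδ : 0 < δ) (hF : F ∈ Γ.faces) (hu : u ∈ F) :
    ∃ v ∈ F, v ≠ u ∧ OnLeft F u v := by
  obtain ⟨v, hv, hmax⟩ := Finset.exists_max_image (F.erase u)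
    (fun z => ((Γ.center F - u) / (z - u)).im) (erase_nonempty hF u)
  have hv' := Finset.mem_erase.1 hv
  exact ⟨v, hv'.2, hv'.1, (onLeft_iff hδ hF hu hv'.2 hv'.1).2 hmax⟩

theorem exists_onLeft_swap (hδ : 0 < δ) (hF : F ∈ Γ.faces) (hu : u ∈ F) :
    ∃ v ∈ F, v ≠ u ∧ OnLeft F v u := by
  obtain ⟨v, hv, hmin⟩ := Finset.exists_min_image (F.erase u)
    (fun z => ((Γ.center F - u) / (z - u)).im) (erase_nonempty hF u)
  have hv' := Finset.mem_erase.1 hv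
  exact ⟨v, hv'.2, hv'.1, (onLeft_swap_iff hδ hF hu hv'.2 hv'.1).2 hmin⟩

theorem OnLeft.eq (hδ : 0 < δ) (hF : F ∈ Γ.faces) (hu : u ∈ F) (hv : v ∈ F) (hz : z ∈ F)
    (hvu : v ≠ u) (hzu : z ≠ u) (h1 : OnLeft F u v) (h2 : OnLeft F u z) : v = z :=
  eq_of_im_div_eq (dist_center hF hu) (center_ne hδ hF hu) (dist_center hF hv)
    (dist_center hF hz) hvu hzu
    (le_antisymm ((onLeft_iff hδ hF hu hz hzu).1 h2 v (Finset.mem_erase.2 ⟨hvu, hv⟩))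
      ((onLeft_iff hδ hF hu hv hvu).1 h1 z (Finset.mem_erase.2 ⟨hzu, hz⟩)))

theorem OnLeft.eq_swap (hδ : 0 < δ) (hF : F ∈ Γ.faces) (hu : u ∈ F) (hv : v ∈ F) (hz : z ∈ F)
    (hvu : v ≠ u) (hzu : z ≠ u) (h1 : OnLeft F v u) (h2 : OnLeft F z u) : v = z :=
  eq_of_im_div_eq (dist_center hF hu) (center_ne hδ hF hu) (dist_center hF hv)
    (dist_center hF hz) hvu hzu
    (le_antisymm ((onLeft_swap_iff hδ hF hu hv hvu).1 h1 z (Finset.mem_erase.2 ⟨hzu, hz⟩))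
      ((onLeft_swap_iff hδ hF hu hz hzu).1 h2 v (Finset.mem_erase.2 ⟨hvu, hv⟩)))

/-- Two distinct faces have at most two common vertices. -/
theorem eq_or_eq_of_common (hδ : 0 < δ) (hF : F ∈ Γ.faces) (hG : G ∈ Γ.faces) (hFG : F ≠ G)
    (huF : u ∈ F) (huG : u ∈ G) (hvF : v ∈ F) (hvG : v ∈ G) (huv : u ≠ v)
    (hzF : z ∈ F) (hzG : z ∈ G) : z = u ∨ z = v := by
  by_contra hcon
  push Not at hcon
  obtain ⟨hzu, hzv⟩ := hcon
  have hcross : cross (v - u) (z - u) ≠ 0 := fun h =>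
    hzv (eq_of_cross_eq_zero hδ hF huF hvF hzF huv.symm hzu h).symm
  have h1 := re_div_of_circle (dist_center hF huF) (dist_center hF hvF) huv.symm
  have h2 := re_div_of_circle (dist_center hF huF) (dist_center hF hzF) hzu
  have h3 := re_div_of_circle (dist_center hG huG) (dist_center hG hvG) huv.symm
  have h4 := re_div_of_circle (dist_center hG huG) (dist_center hG hzG) hzu
  -- Three noncollinear common vertices determine the circle, so the centers coincide and would lie
  -- in both open faces.
  have hw : Γ.center F = Γ.center G := by
    have n1 : Complex.normSq (v - u) ≠ 0 := by simpa [sub_eq_zero] using huv.symm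
    have n2 : Complex.normSq (z - u) ≠ 0 := by simpa [sub_eq_zero] using hzu
    set d := Γ.center F - Γ.center G with hd
    have e1 : d.re * (v - u).re + d.im * (v - u).im = 0 := by
      rw [Complex.div_re, ← add_div, div_eq_iff n1] at h1 h3
      simp only [hd, Complex.sub_re, Complex.sub_im] at h1 h3 ⊢
      linarith
    have e2 : d.re * (z - u).re + d.im * (z - u).im = 0 := by
      rw [Complex.div_re, ← add_div, div_eq_iff n2] at h2 h4
      simp only [hd, Complex.sub_re, Complex.sub_im] at h2 h4 ⊢
      linarith
    rw [cross_eq] at hcross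
    have d1 : d.re = 0 := by
      have : d.re * ((v - u).re * (z - u).im - (v - u).im * (z - u).re) = 0 := by
        linear_combination (z - u).im * e1 - (v - u).im * e2
      exact (mul_eq_zero.1 this).resolve_right hcross
    have d2 : d.im = 0 := by
      have : d.im * ((v - u).re * (z - u).im - (v - u).im * (z - u).re) = 0 := by
        linear_combination (v - u).re * e2 - (z - u).re * e1
      exact (mul_eq_zero.1 this).resolve_right hcross
    exact sub_eq_zero.1 (Complex.ext d1 d2)
  have := center_mem hG
  rw [← hw] at this
  exact Set.disjoint_left.1 (Γ.disjoint_interior F hF G hG hFG) (center_mem hF) this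

/-- The triangle `u v z` contains a short segment leaving the midpoint of `uv` perpendicularly, on
the side of `z`. -/
theorem mem_convexHull_of_small {S : Set ℂ} (hu : u ∈ S) (hv : v ∈ S) (hz : z ∈ S)
    (huv : u ≠ v) (h : 0 < cross (v - u) (z - u)) :
    ∃ ε₀ > 0, ∀ ε : ℝ, 0 < ε → ε ≤ ε₀ →
      u + (v - u) * (1 / 2 + ε * Complex.I) ∈ convexHull ℝ S := by
  have hvu : v - u ≠ 0 := sub_ne_zero.2 huv.symm
  set ζ := (z - u) / (v - u) with hζ
  have hz' : z = u + (v - u) * ζ := by rw [hζ, mul_div_cancel₀ _ hvu]; ring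
  have hn : 0 < Complex.normSq (v - u) := Complex.normSq_pos.2 hvu
  have hy : 0 < ζ.im := by
    have : cross (v - u) (z - u) = Complex.normSq (v - u) * ζ.im := by
      have e : z - u = (v - u) * ζ := by rw [hz']; ring
      rw [e, cross, ← mul_assoc, ← Complex.normSq_eq_conj_mul_self, Complex.im_ofReal_mul]
    rw [this] at h
    exact pos_of_mul_pos_right h hn.le
  refine ⟨ζ.im / (2 * (|ζ.re| + 1)), by positivity, fun ε hε hle => ?_⟩
  rw [le_div_iff₀ (by positivity)] at hle
  have hb : 0 ≤ ε / ζ.im := by positivity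
  have hb2 : ε / ζ.im * (|ζ.re| + 1) ≤ 1 / 2 := by
    rw [div_mul_eq_mul_div, div_le_iff₀ hy]; linarith
  -- Barycentric weight of `z`, fixed by the height `ε`; the weights of `u` and `v` then restore the
  -- abscissa `1/2`.
  set β := ε / ζ.im with hβ
  have hβy : β * ζ.im = ε := by rw [hβ]; field_simp
  have hx := abs_le.1 (le_refl |ζ.re|)
  have hα : 0 ≤ 1 / 2 - β * ζ.re := by nlinarith [mul_le_mul_of_nonneg_left hx.2 hb]
  have hγ : 0 ≤ 1 / 2 + β * ζ.re - β := by nlinarith [mul_le_mul_of_nonneg_left hx.1 hb]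
  have hcomb : u + (v - u) * (1 / 2 + ε * Complex.I) =
      (1 / 2 + β * ζ.re - β) • u + (1 / 2 - β * ζ.re) • v + β • z := by
    rw [hz', ← hβy]
    have e := Complex.re_add_im ζ
    simp only [Complex.real_smul]
    push_cast
    linear_combination ((v - u) * β) * e
  rw [hcomb]
  have hconv := convex_convexHull ℝ S
  have hs := subset_convexHull ℝ S
  have := hconv.sum_mem (t := Finset.univ) (w := ![1 / 2 + β * ζ.re - β, 1 / 2 - β * ζ.re, β])
    (z := ![u, v, z]) (by intro i _; fin_cases i <;> simp <;> linarith)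
    (by simp [Fin.sum_univ_three]; ring) (by intro i _; fin_cases i <;> simp <;> exact hs ‹_›)
  simpa [Fin.sum_univ_three] using this

/-- If both faces had vertices strictly to the left of `uv`, both would contain the same points just
left of the midpoint. Edge-to-edge contact confines common points to the segment `uv`. -/
theorem not_both_left (hδ : 0 < δ) (hF : F ∈ Γ.faces) (hG : G ∈ Γ.faces) (hFG : F ≠ G)
    (huF : u ∈ F) (huG : u ∈ G) (hvF : v ∈ F) (hvG : v ∈ G) (huv : u ≠ v) :
    OnLeft F v u ∨ OnLeft G v u := by
  by_contra hcon
  simp only [OnLeft, not_or, not_forall, not_le] at hcon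
  obtain ⟨⟨z, hz, h1⟩, ⟨z', hz', h2⟩⟩ := hcon
  rw [cross_swap, neg_lt_zero] at h1 h2
  obtain ⟨ε₁, hε₁, H1⟩ := mem_convexHull_of_small (S := (F : Set ℂ)) huF hvF hz huv h1
  obtain ⟨ε₂, hε₂, H2⟩ := mem_convexHull_of_small (S := (G : Set ℂ)) huG hvG hz' huv h2
  have hε : 0 < min ε₁ ε₂ := lt_min hε₁ hε₂
  have m1 := H1 _ hε (min_le_left _ _)
  have m2 := H2 _ hε (min_le_right _ _)
  have m := Set.mem_inter m1 m2
  rw [Γ.edge_to_edge F hF G hG hFG] at m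
  have hsub : (F : Set ℂ) ∩ (G : Set ℂ) ⊆ {z : ℂ | 0 ≤ cross (u - v) (z - v)} := by
    rintro x ⟨hxF, hxG⟩
    rcases eq_or_eq_of_common hδ hF hG hFG huF huG hvF hvG huv hxF hxG with rfl | rfl <;>
      simp [cross_eq, mul_comm]
  have := convexHull_min hsub (convex_cross_nonneg v u) m
  have hn : 0 < Complex.normSq (v - u) := Complex.normSq_pos.2 (sub_ne_zero.2 huv.symm)
  rw [Set.mem_ofPred_eq, cross_swap, add_sub_cancel_left, cross, ← mul_assoc,
    ← Complex.normSq_eq_conj_mul_self, Complex.im_ofReal_mul] at this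
  simp at this
  rcases le_or_gt ε₁ ε₂ with h | h
  · rw [min_eq_left h] at this; nlinarith [mul_pos hn hε₁]
  · rw [min_eq_right h.le] at this; nlinarith [mul_pos hn hε₂]

/-- The two faces adjacent to an edge lie on different sides of it. -/
theorem onLeft_or (hδ : 0 < δ) (hF : F ∈ Γ.faces) (hG : G ∈ Γ.faces) (hFG : F ≠ G)
    (huF : u ∈ F) (huG : u ∈ G) (hvF : v ∈ F) (hvG : v ∈ G) (huv : u ≠ v) :
    (OnLeft F u v ∧ OnLeft G v u) ∨ (OnLeft G u v ∧ OnLeft F v u) := by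
  have h1 := not_both_left hδ hF hG hFG huF huG hvF hvG huv
  have h2 := not_both_left hδ hF hG hFG hvF hvG huF huG huv.symm
  rcases h1 with h1 | h1 <;> rcases h2 with h2 | h2
  · exact (not_onLeft_both hF huv h2 h1).elim
  · exact Or.inr ⟨h2, h1⟩
  · exact Or.inl ⟨h2, h1⟩
  · exact (not_onLeft_both hG huv h2 h1).elim

theorem face_eq_of_onLeft (hδ : 0 < δ) (hF : F ∈ Γ.faces) (hG : G ∈ Γ.faces)
    (huF : u ∈ F) (huG : u ∈ G) (hvF : v ∈ F) (hvG : v ∈ G) (huv : u ≠ v)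
    (h1 : OnLeft F u v) (h2 : OnLeft G u v) : F = G := by
  by_contra hFG
  rcases onLeft_or hδ hF hG hFG huF huG hvF hvG huv with h | h
  · exact not_onLeft_both hG huv h2 h.2
  · exact not_onLeft_both hF huv h1 h.2

theorem isClosed_hull (F : Finset ℂ) : IsClosed (convexHull ℝ (F : Set ℂ)) :=
  F.finite_toSet.isClosed_convexHull ℝ

/-- Every side of a face is an edge of the graph. -/
theorem OnLeft.exists_face (hδ : 0 < δ) (hF : F ∈ Γ.faces) (hu : u ∈ F) (hv : v ∈ F) (huv : u ≠ v)
    (h : OnLeft F u v) : ∃ G ∈ Γ.faces, F ≠ G ∧ u ∈ G ∧ v ∈ G := by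
  have hvu : v - u ≠ 0 := sub_ne_zero.2 huv.symm
  have hn : 0 < Complex.normSq (v - u) := Complex.normSq_pos.2 hvu
  set m : ℂ := u + (v - u) * (1 / 2) with hm
  have hmF : m ∈ convexHull ℝ (F : Set ℂ) := by
    have := (convex_convexHull ℝ (F : Set ℂ)) (subset_convexHull ℝ _ (Finset.mem_coe.2 hu))
      (subset_convexHull ℝ _ (Finset.mem_coe.2 hv)) (a := 1 / 2) (b := 1 / 2) (by norm_num)
      (by norm_num) (by norm_num)
    convert this using 1
    simp only [Complex.real_smul, hm]; push_cast; ring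
  have hclosed : IsClosed (⋃ G : {G : Γ.faces // (G : Finset ℂ) ≠ F},
      convexHull ℝ (((G : Γ.faces) : Finset ℂ) : Set ℂ)) := by
    have hlf : LocallyFinite fun G : {G : Γ.faces // (G : Finset ℂ) ≠ F} =>
        convexHull ℝ (((G : Γ.faces) : Finset ℂ) : Set ℂ) :=
      Γ.locallyFinite.comp_injective Subtype.val_injective
    exact hlf.isClosed_iUnion fun G => isClosed_hull _
  -- Points just to the right of the midpoint `m` are covered, but not by `F`. By local finiteness
  -- the union of the other faces is closed, so it contains `m`.
  have hmem : m ∈ ⋃ G : {G : Γ.faces // (G : Finset ℂ) ≠ F},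
      convexHull ℝ (((G : Γ.faces) : Finset ℂ) : Set ℂ) := by
    by_contra hcon
    have hc : Continuous fun t : ℝ => m - (t : ℂ) * (Complex.I * (v - u)) := by fun_prop
    have h0 : (⋃ G : {G : Γ.faces // (G : Finset ℂ) ≠ F},
        convexHull ℝ (((G : Γ.faces) : Finset ℂ) : Set ℂ))ᶜ ∈
        nhds (m - ((0 : ℝ) : ℂ) * (Complex.I * (v - u))) := by
      simpa using hclosed.isOpen_compl.mem_nhds hcon
    obtain ⟨ε, hε, hball⟩ := Metric.eventually_nhds_iff.1 (hc.continuousAt.preimage_mem_nhds h0)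
    have hx := hball (y := ε / 2) (by
      rw [Real.dist_eq, sub_zero, abs_of_pos (by linarith)]; linarith)
    set x := m - ((ε / 2 : ℝ) : ℂ) * (Complex.I * (v - u)) with hxd
    have hxu : x ∈ ⋃ G ∈ Γ.faces, convexHull ℝ (G : Set ℂ) := by rw [Γ.cover]; trivial
    obtain ⟨G, hG, hxG⟩ := Set.mem_iUnion₂.1 hxu
    by_cases hGF : G = F
    · subst hGF
      have := h.cross_nonneg hxG
      have e : cross (v - u) (x - u) = - (ε / 2 * Complex.normSq (v - u)) := by
        simp [hxd, hm, cross_eq, Complex.normSq_apply]; ring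
      rw [e] at this
      nlinarith
    · exact hx (Set.mem_iUnion.2 ⟨⟨⟨G, hG⟩, hGF⟩, hxG⟩)
  obtain ⟨⟨⟨G, hG⟩, hGF⟩, hmG⟩ := Set.mem_iUnion.1 hmem
  refine ⟨G, hG, Ne.symm hGF, ?_⟩
  have hmFG := Set.mem_inter hmF hmG
  rw [Γ.edge_to_edge F hF G hG (Ne.symm hGF)] at hmFG
  have hcr : cross (v - u) (m - u) = 0 := by
    simp [hm, cross_eq]; ring
  have hstrict : ∀ z ∈ F, z ≠ u → z ≠ v → 0 < cross (v - u) (z - u) := fun z hz hzu hzv =>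
    lt_of_le_of_ne (h z hz) fun h0 =>
      hzv (eq_of_cross_eq_zero hδ hF hu hv hz huv.symm hzu h0.symm).symm
  constructor
  -- Were `u` not shared, all shared vertices would lie in the open left half-plane or at `v`. That
  -- set is convex and misses `m`, although `m` is in the hull of the shared vertices.
  · by_contra hcon
    have hsub : (F : Set ℂ) ∩ (G : Set ℂ) ⊆ {z : ℂ | z = v ∨ 0 < cross (v - u) (z - u)} := by
      rintro z ⟨hzF, hzG⟩
      by_cases hzv : z = v
      · exact Or.inl hzv
      · exact Or.inr (hstrict z hzF (fun h => hcon (h ▸ hzG)) hzv)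
    rcases convexHull_min hsub (convex_insert_cross_pos u v) hmFG with h1 | h1
    · have : (v - u) * (1 / 2) = 0 := by
        have := hm.symm.trans h1; linear_combination -this
      simp [hvu] at this
    · rw [hcr] at h1; exact lt_irrefl _ h1
  · by_contra hcon
    have hsub : (F : Set ℂ) ∩ (G : Set ℂ) ⊆
        -- The same half-plane, based at `2u - v` on the same line so that its exceptional boundary
        -- point is `u`.
        {z : ℂ | z = u ∨ 0 < cross (u - (u + u - v)) (z - (u + u - v))} := by
      rintro z ⟨hzF, hzG⟩
      by_cases hzv : z = u
      · exact Or.inl hzv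
      · refine Or.inr ?_
        have := hstrict z hzF hzv (fun h => hcon (h ▸ hzG))
        simp only [cross_eq, Complex.sub_re, Complex.sub_im, Complex.add_re, Complex.add_im]
          at this ⊢
        linarith
    rcases convexHull_min hsub (convex_insert_cross_pos (u + u - v) u) hmFG with h1 | h1
    · have : (v - u) * (1 / 2) = 0 := by
        have := hm.symm.trans h1; linear_combination this
      simp [hvu] at this
    · simp only [cross_eq, Complex.sub_re, Complex.sub_im, Complex.add_re, Complex.add_im]
          at h1 hcr
      linarith

theorem OnLeft.adj (hδ : 0 < δ) (hF : F ∈ Γ.faces) (hu : u ∈ F) (hv : v ∈ F) (huv : u ≠ v)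
    (h : OnLeft F u v) : Γ.graph.Adj u v := by
  obtain ⟨G, hG, hFG, h1, h2⟩ := h.exists_face hδ hF hu hv huv
  exact ⟨huv, F, hF, G, hG, hFG, hu, hv, h1, h2⟩

theorem halfAngle_comm (u v : ℂ) : Γ.halfAngle u v = Γ.halfAngle v u := by
  rw [halfAngle, halfAngle, dist_comm]

/-- The quotient by `v - u` has real part `1/2` and modulus `δ / |v - u|`, which determines its
imaginary part up to sign; the side on which the face lies fixes the sign. -/
theorem OnLeft.center_eq (hδ : 0 < δ) (hF : F ∈ Γ.faces) (hu : u ∈ F) (hv : v ∈ F) (huv : u ≠ v)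
    (h : OnLeft F u v) :
    Γ.center F - u = (v - u) * ((1 + Real.tan (Γ.halfAngle u v) * Complex.I) / 2) := by
  have hvu : v - u ≠ 0 := sub_ne_zero.2 huv.symm
  have hd : 0 < ‖v - u‖ := norm_pos_iff.2 hvu
  have hp := re_div_of_circle (dist_center hF hu) (dist_center hF hv) huv.symm
  set p := (Γ.center F - u) / (v - u) with hpd
  have hwp : Γ.center F - u = (v - u) * p := by rw [hpd, mul_div_cancel₀ _ hvu]
  have hpos := h.cross_center_pos hF huv
  rw [hwp, cross, ← mul_assoc, ← Complex.normSq_eq_conj_mul_self, Complex.im_ofReal_mul] at hpos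
  have him : 0 < p.im := pos_of_mul_pos_right hpos (Complex.normSq_nonneg _)
  have hnorm : ‖v - u‖ ^ 2 * (1 / 4 + p.im ^ 2) = δ ^ 2 := by
    have : ‖v - u‖ * ‖p‖ = δ := by
      rw [← norm_mul, ← hwp, ← dist_eq_norm, dist_comm, dist_center hF hu]
    rw [← this, mul_pow, ← Complex.normSq_eq_norm_sq p, Complex.normSq_apply, hp]; ring
  have htan : Real.tan (Γ.halfAngle u v) = 2 * p.im := by
    rw [halfAngle, Real.tan_arccos, dist_comm, dist_eq_norm]
    rw [div_eq_iff (by positivity)]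
    have : 1 - (‖v - u‖ / (2 * δ)) ^ 2 = (2 * p.im * (‖v - u‖ / (2 * δ))) ^ 2 := by
      field_simp
      linarith
    rw [this, Real.sqrt_sq (by positivity)]
  rw [hwp, htan]
  congr 1
  apply Complex.ext
  · simp [hp]
  · simp

theorem OnLeft.center_eq_swap (hδ : 0 < δ) (hF : F ∈ Γ.faces) (hu : u ∈ F) (hv : v ∈ F)
    (huv : u ≠ v) (h : OnLeft F v u) :
    Γ.center F - u = (v - u) * ((1 - Real.tan (Γ.halfAngle u v) * Complex.I) / 2) := by
  have := h.center_eq hδ hF hv hu huv.symm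
  rw [halfAngle_comm] at this
  linear_combination this

/-! ### Exact harmonicity of affine and of holomorphic quadratic functions. -/

theorem finite_facesAt (Γ : IsoradialGraph δ) (u : ℂ) : {F | F ∈ Γ.faces ∧ u ∈ F}.Finite := by
  have h : {F : Γ.faces | u ∈ convexHull ℝ ((F : Finset ℂ) : Set ℂ)}.Finite :=
    Γ.locallyFinite.point_finite u
  refine (h.image Subtype.val).subset ?_
  rintro F ⟨hF, hu⟩
  exact ⟨⟨F, hF⟩, subset_convexHull ℝ _ (Finset.mem_coe.2 hu), rfl⟩

/-- The neighbors of `u`, as a finset. -/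
noncomputable def nbrs (Γ : IsoradialGraph δ) (u : ℂ) : Finset ℂ := (Γ.finite_neighborSet u).toFinset

theorem mem_nbrs : v ∈ Γ.nbrs u ↔ Γ.graph.Adj u v := by simp [nbrs]

/-- Sending a face at `u` to its side with the face on the left is a bijection onto the edges at
`u`. The version with right sides conjugates the factor `1 + i tan θ`; for `g x = x` and `g x = x ^
2` the difference of the two sums is `i ∑ tan θ (v - u)` and `i ∑ tan θ (v - u)²`. -/
theorem sum_facesAt_left (hδ : 0 < δ) (g : ℂ → ℂ) :
    ∑ F ∈ (Γ.finite_facesAt u).toFinset, g (Γ.center F - u) =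
      ∑ v ∈ Γ.nbrs u, g ((v - u) * ((1 + Real.tan (Γ.halfAngle u v) * Complex.I) / 2)) := by
  have hex : ∀ F ∈ (Γ.finite_facesAt u).toFinset, ∃ v ∈ F, v ≠ u ∧ OnLeft F u v := by
    intro F hF
    have hF' : F ∈ Γ.faces ∧ u ∈ F := by simpa using hF
    exact exists_onLeft hδ hF'.1 hF'.2
  choose f hf1 hf2 hf3 using hex
  refine Finset.sum_bij f ?_ ?_ ?_ ?_
  · intro F hF
    have hF' : F ∈ Γ.faces ∧ u ∈ F := by simpa using hF
    exact mem_nbrs.2 ((hf3 F hF).adj hδ hF'.1 hF'.2 (hf1 F hF) (hf2 F hF).symm)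
  · intro F hF G hG hFG
    have hF' : F ∈ Γ.faces ∧ u ∈ F := by simpa using hF
    have hG' : G ∈ Γ.faces ∧ u ∈ G := by simpa using hG
    exact face_eq_of_onLeft hδ hF'.1 hG'.1 hF'.2 hG'.2 (hf1 F hF) (hFG ▸ hf1 G hG)
      (hf2 F hF).symm (hf3 F hF) (hFG ▸ hf3 G hG)
  · intro v hv
    obtain ⟨huv, F, hF, G, hG, hFG, huF, hvF, huG, hvG⟩ := mem_nbrs.1 hv
    rcases onLeft_or hδ hF hG hFG huF huG hvF hvG huv with h | h
    · have hm : F ∈ (Γ.finite_facesAt u).toFinset := by simpa using ⟨hF, huF⟩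
      exact ⟨F, hm, (hf3 F hm).eq hδ hF huF (hf1 F hm) hvF (hf2 F hm) huv.symm h.1⟩
    · have hm : G ∈ (Γ.finite_facesAt u).toFinset := by simpa using ⟨hG, huG⟩
      exact ⟨G, hm, (hf3 G hm).eq hδ hG huG (hf1 G hm) hvG (hf2 G hm) huv.symm h.1⟩
  · intro F hF
    have hF' : F ∈ Γ.faces ∧ u ∈ F := by simpa using hF
    rw [← (hf3 F hF).center_eq hδ hF'.1 hF'.2 (hf1 F hF) (hf2 F hF).symm]

theorem sum_facesAt_right (hδ : 0 < δ) (g : ℂ → ℂ) :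
    ∑ F ∈ (Γ.finite_facesAt u).toFinset, g (Γ.center F - u) =
      ∑ v ∈ Γ.nbrs u, g ((v - u) * ((1 - Real.tan (Γ.halfAngle u v) * Complex.I) / 2)) := by
  have hex : ∀ F ∈ (Γ.finite_facesAt u).toFinset, ∃ v ∈ F, v ≠ u ∧ OnLeft F v u := by
    intro F hF
    have hF' : F ∈ Γ.faces ∧ u ∈ F := by simpa using hF
    exact exists_onLeft_swap hδ hF'.1 hF'.2
  choose f hf1 hf2 hf3 using hex
  refine Finset.sum_bij f ?_ ?_ ?_ ?_
  · intro F hF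
    have hF' : F ∈ Γ.faces ∧ u ∈ F := by simpa using hF
    exact mem_nbrs.2 ((hf3 F hF).adj hδ hF'.1 (hf1 F hF) hF'.2 (hf2 F hF)).symm
  · intro F hF G hG hFG
    have hF' : F ∈ Γ.faces ∧ u ∈ F := by simpa using hF
    have hG' : G ∈ Γ.faces ∧ u ∈ G := by simpa using hG
    exact face_eq_of_onLeft hδ hF'.1 hG'.1 (hf1 F hF) (hFG ▸ hf1 G hG) hF'.2 hG'.2
      (hf2 F hF) (hf3 F hF) (hFG ▸ hf3 G hG)
  · intro v hv
    obtain ⟨huv, F, hF, G, hG, hFG, huF, hvF, huG, hvG⟩ := mem_nbrs.1 hv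
    rcases onLeft_or hδ hF hG hFG huF huG hvF hvG huv with h | h
    · have hm : G ∈ (Γ.finite_facesAt u).toFinset := by simpa using ⟨hG, huG⟩
      exact ⟨G, hm, (hf3 G hm).eq_swap hδ hG huG (hf1 G hm) hvG (hf2 G hm) huv.symm h.2⟩
    · have hm : F ∈ (Γ.finite_facesAt u).toFinset := by simpa using ⟨hF, huF⟩
      exact ⟨F, hm, (hf3 F hm).eq_swap hδ hF huF (hf1 F hm) hvF (hf2 F hm) huv.symm h.2⟩
  · intro F hF
    have hF' : F ∈ Γ.faces ∧ u ∈ F := by simpa using hF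
    rw [← (hf3 F hF).center_eq_swap hδ hF'.1 hF'.2 (hf1 F hF) (hf2 F hF).symm]

/-- Affine functions are discrete harmonic. -/
theorem sum_tan_mul_sub (hδ : 0 < δ) (u : ℂ) :
    ∑ v ∈ Γ.nbrs u, (Real.tan (Γ.halfAngle u v) : ℂ) * (v - u) = 0 := by
  have h := (sum_facesAt_left (Γ := Γ) (u := u) hδ fun x => x).symm.trans
    (sum_facesAt_right (Γ := Γ) (u := u) hδ fun x => x)
  rw [← sub_eq_zero, ← Finset.sum_sub_distrib] at h
  have h2 : Complex.I * ∑ v ∈ Γ.nbrs u, (Real.tan (Γ.halfAngle u v) : ℂ) * (v - u) = 0 := by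
    rw [Finset.mul_sum, ← h]
    exact Finset.sum_congr rfl fun v _ => by ring
  simpa using h2

/-- Holomorphic quadratic functions are discrete harmonic. -/
theorem sum_tan_mul_sub_sq (hδ : 0 < δ) (u : ℂ) :
    ∑ v ∈ Γ.nbrs u, (Real.tan (Γ.halfAngle u v) : ℂ) * (v - u) ^ 2 = 0 := by
  have h := (sum_facesAt_left (Γ := Γ) (u := u) hδ fun x => x ^ 2).symm.trans
    (sum_facesAt_right (Γ := Γ) (u := u) hδ fun x => x ^ 2)
  rw [← sub_eq_zero, ← Finset.sum_sub_distrib] at h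
  have h2 : Complex.I * ∑ v ∈ Γ.nbrs u, (Real.tan (Γ.halfAngle u v) : ℂ) * (v - u) ^ 2 = 0 := by
    rw [Finset.mul_sum, ← h]
    exact Finset.sum_congr rfl fun v _ => by ring
  simpa using h2

end IsoradialGraph

/-! ### Uniform geometry under the angle bound. -/

namespace IsoradialGraph

variable {δ : ℝ} {Γ : IsoradialGraph δ} {F G : Finset ℂ} {u v z : ℂ} {b : ℝ}

/-- Uniform nondegeneracy of the edges and of their weights. -/
def Fat (Γ : IsoradialGraph δ) (b : ℝ) : Prop :=
  ∀ u v, Γ.graph.Adj u v → 2 * δ * b ≤ dist u v ∧ b ≤ Real.tan (Γ.halfAngle u v)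

theorem AnglesBounded.mono {η η' : ℝ} (h : Γ.AnglesBounded η) (hle : η' ≤ η) :
    Γ.AnglesBounded η' := fun u v huv =>
  ⟨hle.trans (h u v huv).1, (h u v huv).2.trans (by linarith)⟩

/-- Since `η / 2 ≤ θ ≤ π / 2 - η / 2`, both `cos θ` and `sin θ ≤ tan θ` are at least `sin (η / 2)`.
-/
theorem AnglesBounded.fat {η : ℝ} (hδ : 0 < δ) (hη : 0 < η) (hη2 : η ≤ Real.pi / 2)
    (h : Γ.AnglesBounded η) : Γ.Fat (Real.sin (η / 2)) := by
  intro u v huv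
  obtain ⟨h1, h2⟩ := h u v huv
  set θ := Γ.halfAngle u v with hθ
  have hpi := Real.pi_pos
  -- `arccos` takes the value `0` at and beyond `1`, which the lower angle bound excludes.
  have hx : dist u v / (2 * δ) < 1 := by
    by_contra hcon
    have : θ = 0 := Real.arccos_of_one_le (not_lt.1 hcon)
    linarith
  have hcos : Real.cos θ = dist u v / (2 * δ) :=
    Real.cos_arccos (by linarith [show 0 ≤ dist u v / (2 * δ) by positivity]) hx.le
  constructor
  · have : Real.sin (η / 2) ≤ Real.cos θ := by
      rw [← Real.cos_pi_div_two_sub]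
      exact Real.cos_le_cos_of_nonneg_of_le_pi (by linarith) (by linarith) (by linarith)
    rw [hcos, le_div_iff₀ (by positivity)] at this
    linarith
  · have hs : Real.sin (η / 2) ≤ Real.sin θ :=
      Real.sin_le_sin_of_le_of_le_pi_div_two (by linarith) (by linarith) (by linarith)
    have hc : 0 < Real.cos θ := Real.cos_pos_of_mem_Ioo ⟨by linarith, by linarith⟩
    have hs0 : 0 ≤ Real.sin θ := Real.sin_nonneg_of_nonneg_of_le_pi (by linarith) (by linarith)
    refine hs.trans ?_
    rw [Real.tan_eq_sin_div_cos, le_div_iff₀ hc]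
    nlinarith [Real.cos_le_one θ]

theorem Adj.exists_faces (h : Γ.graph.Adj u v) : ∃ F ∈ Γ.faces, u ∈ F ∧ v ∈ F := by
  obtain ⟨_, F, hF, _, _, _, h1, h2, _, _⟩ := h
  exact ⟨F, hF, h1, h2⟩

theorem Adj.dist_le (h : Γ.graph.Adj u v) : dist u v ≤ 2 * δ := by
  obtain ⟨F, hF, h1, h2⟩ := Adj.exists_faces h
  have := dist_triangle_right u v (Γ.center F)
  rw [dist_center hF h1, dist_center hF h2] at this
  linarith

theorem Adj.mem_vertices (h : Γ.graph.Adj u v) : v ∈ Γ.vertices := by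
  obtain ⟨F, hF, h1, h2⟩ := Adj.exists_faces h
  exact ⟨F, hF, h2⟩

theorem tan_mul_dist_sq (hδ : 0 < δ) (h : Γ.graph.Adj u v) :
    Real.tan (Γ.halfAngle u v) * dist u v ^ 2 = 2 * δ ^ 2 * Real.sin (2 * Γ.halfAngle u v) := by
  have hd : 0 < dist u v := dist_pos.2 h.1
  have hx : dist u v / (2 * δ) ≤ 1 := by
    rw [div_le_one (by positivity)]; exact Adj.dist_le h
  have hx0 : 0 < dist u v / (2 * δ) := by positivity
  have hcos : Real.cos (Γ.halfAngle u v) = dist u v / (2 * δ) :=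
    Real.cos_arccos (by linarith) hx
  have hdist : dist u v = 2 * δ * Real.cos (Γ.halfAngle u v) := by rw [hcos]; field_simp
  rw [Real.sin_two_mul, hdist, Real.tan_eq_sin_div_cos]
  have : Real.cos (Γ.halfAngle u v) ≠ 0 := by rw [hcos]; exact hx0.ne'
  field_simp

theorem sum_neighborSet (g : ℂ → ℝ) (u : ℂ) :
    ∑ v : Γ.graph.neighborSet u, g v = ∑ v ∈ Γ.nbrs u, g v := by
  rw [← Finset.sum_subtype (Γ.nbrs u) (fun v => by simp [mem_nbrs])]

/-- By `|u - v| = 2 δ cos θ`. It says that the normalized Laplacian of `|z|²` is `4`, as in the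
continuum. -/
theorem weight_eq (hδ : 0 < δ) (u : ℂ) :
    4 * Γ.weight u = ∑ v ∈ Γ.nbrs u, Real.tan (Γ.halfAngle u v) * dist u v ^ 2 := by
  rw [weight, sum_neighborSet (fun v => Real.sin (2 * Γ.halfAngle u v)),
    Finset.sum_congr rfl fun v hv => tan_mul_dist_sq hδ (mem_nbrs.1 hv), ← Finset.mul_sum]
  ring

/-! ### Connectedness and separation inside a face -/

theorem norm_sq_mul_of_circle (hF : F ∈ Γ.faces) (hu : u ∈ F) (hz : z ∈ F)
    (hzu : z ≠ u) :
    ‖z - u‖ ^ 2 * (1 / 4 + ((Γ.center F - u) / (z - u)).im ^ 2) = δ ^ 2 := by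
  have hp := re_div_of_circle (dist_center hF hu) (dist_center hF hz) hzu
  have h0 : z - u ≠ 0 := sub_ne_zero.2 hzu
  have h1 : ‖z - u‖ * ‖(Γ.center F - u) / (z - u)‖ = δ := by
    rw [← norm_mul, mul_div_cancel₀ _ h0, ← dist_eq_norm, dist_comm, dist_center hF hu]
  have h2 := congrArg (· ^ 2) h1
  simp only [mul_pow, ← Complex.normSq_eq_norm_sq (_ / _), Complex.normSq_apply, hp] at h2
  linarith

theorem cross_center (hzu : z ≠ u) :
    cross (z - u) (Γ.center F - u) = ‖z - u‖ ^ 2 * ((Γ.center F - u) / (z - u)).im := by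
  have h0 : z - u ≠ 0 := sub_ne_zero.2 hzu
  have e : Γ.center F - u = (z - u) * ((Γ.center F - u) / (z - u)) := by
    rw [mul_div_cancel₀ _ h0]
  nth_rewrite 1 [e]
  rw [cross, ← mul_assoc, ← Complex.normSq_eq_conj_mul_self, Complex.im_ofReal_mul,
    Complex.normSq_eq_norm_sq]

/-- A vertex of a face beyond a chord, on the side not containing the center, is closer to an
endpoint of the chord than the other endpoint. -/
theorem dist_lt_of_cross (hδ : 0 < δ) (hF : F ∈ Γ.faces) {q : ℂ} (hu : u ∈ F) (hz : z ∈ F)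
    (hq : q ∈ F) (hzu : z ≠ u)
    (h : cross (z - u) (Γ.center F - u) * cross (z - u) (q - u) ≤ 0)
    (h0 : cross (z - u) (q - u) ≠ 0) : dist q u < dist z u := by
  have hqu : q ≠ u := by rintro rfl; simp [cross_eq] at h0
  have e1 := norm_sq_mul_of_circle hF hu hz hzu
  have e2 := norm_sq_mul_of_circle hF hu hq hqu
  have e3 := cross_eq_of_circle (dist_center hF hu) (dist_center hF hz) (dist_center hF hq) hzu hqu
  rw [cross_center hzu] at h
  set a := ((Γ.center F - u) / (z - u)).im
  set c := ((Γ.center F - u) / (q - u)).im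
  have nz : 0 < ‖z - u‖ := norm_pos_iff.2 (sub_ne_zero.2 hzu)
  have nq : 0 < ‖q - u‖ := norm_pos_iff.2 (sub_ne_zero.2 hqu)
  have hac : a ≠ c := by
    intro hac
    rw [hac, sub_self, mul_zero] at e3
    have : cross (z - u) (q - u) = 0 := by
      have hδ2 : δ ^ 2 ≠ 0 := by positivity
      simpa [hδ2, hδ.ne'] using e3
    exact h0 this
  -- The two cross products have the signs of `a` and of `a - c`. With `a ≠ c` this gives `a² < c²`,
  -- and `|z - u|² (1/4 + a²) = δ²` turns larger coordinates into shorter chords.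
  have hle : a * (a - c) ≤ 0 := by
    have : (a * (a - c)) * (‖z - u‖ ^ 2 * (‖z - u‖ ^ 2 * ‖q - u‖ ^ 2)) ≤ 0 := by
      have : (a * (a - c)) * (‖z - u‖ ^ 2 * (‖z - u‖ ^ 2 * ‖q - u‖ ^ 2)) =
        (‖z - u‖ ^ 2 * a * cross (z - u) (q - u)) * (δ ^ 2 * 2) := by
        linear_combination (-‖z - u‖ ^ 2 * a) * e3
      rw [this]
      exact mul_nonpos_of_nonpos_of_nonneg h (by positivity)
    by_contra hcon
    push Not at hcon
    have := mul_pos hcon (show 0 < ‖z - u‖ ^ 2 * (‖z - u‖ ^ 2 * ‖q - u‖ ^ 2) by positivity)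
    linarith
  have hsq : a ^ 2 < c ^ 2 := by nlinarith [sq_pos_of_ne_zero (sub_ne_zero.2 hac)]
  rw [dist_eq_norm, dist_eq_norm]
  refine lt_of_pow_lt_pow_left₀ 2 nz.le ?_
  by_contra hcon
  push Not at hcon
  have h1 : ‖z - u‖ ^ 2 * (1 / 4 + a ^ 2) < ‖z - u‖ ^ 2 * (1 / 4 + c ^ 2) :=
    mul_lt_mul_of_pos_left (by linarith) (by positivity)
  have h2 : ‖z - u‖ ^ 2 * (1 / 4 + c ^ 2) ≤ ‖q - u‖ ^ 2 * (1 / 4 + c ^ 2) :=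
    mul_le_mul_of_nonneg_right hcon (by positivity)
  linarith

/-- A chord that is not a side has vertices of the face on both sides. One on the side away from the
center lies on an arc of at most half the circle, hence is closer to both endpoints. -/
theorem exists_closer (hδ : 0 < δ) (hF : F ∈ Γ.faces) (hu : u ∈ F) (hz : z ∈ F) (hzu : z ≠ u)
    (hadj : ¬ Γ.graph.Adj u z) : ∃ q ∈ F, dist q u < dist z u ∧ dist q z < dist z u := by
  have h1 : ¬ OnLeft F u z := fun h => hadj (h.adj hδ hF hu hz hzu.symm)
  have h2 : ¬ OnLeft F z u := fun h => hadj (h.adj hδ hF hz hu hzu).symm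
  simp only [OnLeft, not_forall, not_le] at h1 h2
  obtain ⟨q₁, hq₁, h1⟩ := h1
  obtain ⟨q₂, hq₂, h2⟩ := h2
  rw [cross_swap, neg_lt_zero] at h2
  have key : ∀ q ∈ F, cross (z - u) (Γ.center F - u) * cross (z - u) (q - u) ≤ 0 →
      cross (z - u) (q - u) ≠ 0 → ∃ q ∈ F, dist q u < dist z u ∧ dist q z < dist z u := by
    intro q hq h h0
    refine ⟨q, hq, dist_lt_of_cross hδ hF hu hz hq hzu h h0, ?_⟩
    rw [dist_comm z u]
    refine dist_lt_of_cross hδ hF hz hu hq hzu.symm ?_ ?_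
    · rw [cross_swap, cross_swap u z q]; linarith
    · rw [cross_swap]; exact neg_ne_zero.2 h0
  rcases le_total 0 (cross (z - u) (Γ.center F - u)) with h | h
  · exact key q₁ hq₁ (mul_nonpos_of_nonneg_of_nonpos h h1.le) h1.ne
  · exact key q₂ hq₂ (mul_nonpos_of_nonpos_of_nonneg h h2.le) h2.ne'

/-- The vertices of a face are connected by its sides. -/
theorem face_induction (hδ : 0 < δ) (hF : F ∈ Γ.faces) (p : ℂ → Prop)
    (hp : ∀ u ∈ F, ∀ v ∈ F, Γ.graph.Adj u v → p u → p v) (hu : u ∈ F) (hpu : p u)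
    (hv : v ∈ F) : p v := by
  classical
  by_contra hcon
  -- Take a closest pair with `p` at one point only. It is not an edge, and the closer vertex `q`
  -- replaces one of the two points, whichever the truth of `p q`.
  obtain ⟨⟨x, y⟩, hxy, hmin⟩ := Finset.exists_min_image
    ((F.filter p) ×ˢ (F.filter fun z => ¬ p z)) (fun q => dist q.2 q.1)
    ⟨(u, v), by simp [hu, hv, hpu, hcon]⟩
  simp only [Finset.mem_product, Finset.mem_filter] at hxy
  obtain ⟨⟨hx, hpx⟩, hy, hpy⟩ := hxy
  have hne : y ≠ x := by rintro rfl; exact hpy hpx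
  have hna : ¬ Γ.graph.Adj x y := fun h => hpy (hp x hx y hy h hpx)
  obtain ⟨q, hq, h1, h2⟩ := exists_closer hδ hF hx hy hne hna
  by_cases hpq : p q
  · have := hmin (q, y) (by simp [hq, hpq, hy, hpy])
    simp only at this
    rw [dist_comm y q] at this
    linarith
  · have := hmin (x, q) (by simp [hq, hpq, hx, hpx])
    simp only at this
    linarith

/-- A closest pair of vertices of a face is an edge, by `exists_closer`. -/
theorem Fat.face_dist (hb : Γ.Fat b) (hδ : 0 < δ) (hF : F ∈ Γ.faces) (hu : u ∈ F) (hv : v ∈ F)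
    (huv : u ≠ v) : 2 * δ * b ≤ dist u v := by
  obtain ⟨⟨x, y⟩, hxy, hmin⟩ := Finset.exists_min_image F.offDiag (fun q => dist q.1 q.2)
    ⟨(u, v), by simp [hu, hv, huv]⟩
  simp only [Finset.mem_offDiag] at hxy
  obtain ⟨hx, hy, hne⟩ := hxy
  refine le_trans ?_ (hmin (u, v) (by simp [hu, hv, huv]))
  by_cases ha : Γ.graph.Adj x y
  · exact (hb x y ha).1
  · obtain ⟨q, hq, h1, h2⟩ := exists_closer hδ hF hx hy hne.symm ha
    exfalso
    by_cases hqx : q = x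
    · subst hqx; rw [dist_comm] at h2; exact lt_irrefl _ h2
    · have := hmin (q, x) (by simp [hq, hx, hqx])
      simp only at this
      rw [dist_comm x y] at this
      linarith

theorem mem_of_mem_hull (hF : F ∈ Γ.faces) (hv : v ∈ Γ.vertices)
    (h : v ∈ convexHull ℝ (F : Set ℂ)) : v ∈ F := by
  obtain ⟨G, hG, hvG⟩ := hv
  by_cases hFG : F = G
  · rw [hFG]; exact hvG
  by_contra hcon
  have hm := Set.mem_inter h (subset_convexHull ℝ _ (Finset.mem_coe.2 hvG))
  rw [Γ.edge_to_edge F hF G hG hFG] at hm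
  set w := Γ.center G
  -- On the circle of `G` this functional has its strict maximum at `v`, so `v` is not in the hull
  -- of the other vertices of `G`.
  let f : ℂ →ₗ[ℝ] ℝ := (v - w).re • Complex.reLm + (v - w).im • Complex.imLm
  have hf : ∀ x, f x = (v - w).re * x.re + (v - w).im * x.im := fun x => rfl
  have hconv : Convex ℝ {x : ℂ | f x < f v} := convex_halfSpace_lt f.isLinear (f v)
  have hsub : (F : Set ℂ) ∩ (G : Set ℂ) ⊆ {x : ℂ | f x < f v} := by
    rintro x ⟨hxF, hxG⟩
    have hxv : x ≠ v := by rintro rfl; exact hcon hxF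
    have e1 : Complex.normSq (x - w) = δ ^ 2 := by
      rw [Complex.normSq_eq_norm_sq, ← dist_eq_norm, dist_center hG hxG]
    have e2 : Complex.normSq (v - w) = δ ^ 2 := by
      rw [Complex.normSq_eq_norm_sq, ← dist_eq_norm, dist_center hG hvG]
    have e3 : 0 < Complex.normSq (x - v) := Complex.normSq_pos.2 (sub_ne_zero.2 hxv)
    rw [Set.mem_ofPred_eq, hf, hf]
    simp only [Complex.normSq_apply, Complex.sub_re, Complex.sub_im] at e1 e2 e3 ⊢
    nlinarith
  exact lt_irrefl (f v) (convexHull_min hsub hconv hm)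

theorem isClosed_iUnion_hull (p : Finset ℂ → Prop) :
    IsClosed (⋃ G : {G : Γ.faces // p (G : Finset ℂ)},
      convexHull ℝ (((G : Γ.faces) : Finset ℂ) : Set ℂ)) :=
  (Γ.locallyFinite.comp_injective
    (g := fun G : {G : Γ.faces // p (G : Finset ℂ)} => (G : Γ.faces))
    Subtype.val_injective).isClosed_iUnion fun _ => isClosed_hull _

theorem exists_face (Γ : IsoradialGraph δ) (x : ℂ) : ∃ F ∈ Γ.faces, x ∈ convexHull ℝ (F : Set ℂ) := by
  have hxu : x ∈ ⋃ G ∈ Γ.faces, convexHull ℝ (G : Set ℂ) := by rw [Γ.cover]; trivial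
  obtain ⟨G, hG, hxG⟩ := Set.mem_iUnion₂.1 hxu
  exact ⟨G, hG, hxG⟩

/-- The faces not having `u` as a vertex form a closed set that misses `u`, so a short step from `u`
stays within the faces at `u`. -/
theorem exists_face_toward (hu : u ∈ Γ.vertices) (y : ℂ) :
    ∃ F ∈ Γ.faces, u ∈ F ∧ ∃ t : ℝ, 0 < t ∧ u + t * (y - u) ∈ convexHull ℝ (F : Set ℂ) := by
  have hclosed := isClosed_iUnion_hull (Γ := Γ) fun G => u ∉ G
  have hmem : u ∉ ⋃ G : {G : Γ.faces // u ∉ (G : Finset ℂ)},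
      convexHull ℝ (((G : Γ.faces) : Finset ℂ) : Set ℂ) := by
    intro hcon
    obtain ⟨⟨⟨G, hG⟩, huG⟩, h⟩ := Set.mem_iUnion.1 hcon
    exact huG (mem_of_mem_hull hG hu h)
  have hc : Continuous fun t : ℝ => u + (t : ℂ) * (y - u) := by fun_prop
  have h0 : (⋃ G : {G : Γ.faces // u ∉ (G : Finset ℂ)},
      convexHull ℝ (((G : Γ.faces) : Finset ℂ) : Set ℂ))ᶜ ∈
      nhds (u + ((0 : ℝ) : ℂ) * (y - u)) := by
    simpa using hclosed.isOpen_compl.mem_nhds hmem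
  obtain ⟨ε, hε, hball⟩ := Metric.eventually_nhds_iff.1 (hc.continuousAt.preimage_mem_nhds h0)
  have hx := hball (y := ε / 2) (by
    rw [Real.dist_eq, sub_zero, abs_of_pos (by linarith)]; linarith)
  obtain ⟨G, hG, hxG⟩ := Γ.exists_face (u + ((ε / 2 : ℝ) : ℂ) * (y - u))
  refine ⟨G, hG, ?_, ε / 2, by linarith, hxG⟩
  by_contra huG
  exact hx (Set.mem_iUnion.2 ⟨⟨⟨G, hG⟩, huG⟩, hxG⟩)

/-- The vertices are uniformly separated. -/
theorem Fat.separated (hb : Γ.Fat b) (hδ : 0 < δ) (hb0 : 0 < b) (hb1 : b ≤ 1)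
    (hu : u ∈ Γ.vertices) {y : ℂ} (hy : y ∈ Γ.vertices) (huy : u ≠ y) :
    2 * δ * b ^ 2 ≤ dist u y := by
  by_contra hcon
  push Not at hcon
  obtain ⟨F, hF, huF, t, ht, htF⟩ := exists_face_toward hu y
  obtain ⟨v, hv, hvu, hL⟩ := exists_onLeft hδ hF huF
  obtain ⟨z, hz, hzu, hR⟩ := exists_onLeft_swap hδ hF huF
  have hvz : v ≠ z := by rintro rfl; exact not_onLeft_both hF hvu hR hL
  have c1 := hL.cross_nonneg htF
  have c2 := hR.cross_nonneg htF
  rw [cross_swap] at c2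
  have hlin : ∀ a : ℂ, cross a (u + t * (y - u) - u) = t * cross a (y - u) := by
    intro a; simp [cross_eq]; ring
  rw [hlin] at c1 c2
  have c1' : 0 ≤ cross (v - u) (y - u) := nonneg_of_mul_nonneg_right c1 ht
  have c2' : 0 ≤ -cross (z - u) (y - u) := by
    have : 0 ≤ t * (-cross (z - u) (y - u)) := by linarith
    exact nonneg_of_mul_nonneg_right this ht
  have hD : 0 < cross (v - u) (z - u) := lt_of_le_of_ne (hL z hz) fun h =>
    hvz (eq_of_cross_eq_zero hδ hF huF hv hz hvu hzu h.symm)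
  set D := cross (v - u) (z - u) with hDdef
  -- Coordinates of `y - u` in the cone spanned by the two sides of `F` at `u`.
  set α := -cross (z - u) (y - u) / D with hα
  set β := cross (v - u) (y - u) / D with hβ
  have hα0 : 0 ≤ α := by positivity
  have hβ0 : 0 ≤ β := by positivity
  have hαD : α * D = -cross (z - u) (y - u) := by rw [hα]; field_simp
  have hβD : β * D = cross (v - u) (y - u) := by rw [hβ]; field_simp
  have hdec : y - u = α * (v - u) + β * (z - u) := by
    have hD' : (D : ℝ) ≠ 0 := hD.ne'
    simp only [hDdef, cross_eq] at hαD hβD hD'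
    simp only [Complex.sub_re, Complex.sub_im] at hαD hβD hD'
    apply Complex.ext
    · simp only [Complex.add_re, Complex.sub_re, Complex.mul_re, Complex.ofReal_re,
        Complex.ofReal_im, Complex.sub_im]
      apply mul_right_cancel₀ hD'
      linear_combination (u.re - v.re) * hαD + (u.re - z.re) * hβD
    · simp only [Complex.add_im, Complex.sub_re, Complex.mul_im, Complex.ofReal_re,
        Complex.ofReal_im, Complex.sub_im]
      apply mul_right_cancel₀ hD'
      linear_combination (u.im - v.im) * hαD + (u.im - z.im) * hβD
  set w := Γ.center F
  have ip : ∀ x ∈ F, 2 * ((w - u).re * (x - u).re + (w - u).im * (x - u).im) = dist u x ^ 2 := by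
    intro x hx
    have e1 : Complex.normSq (x - w) = δ ^ 2 := by
      rw [Complex.normSq_eq_norm_sq, ← dist_eq_norm, dist_center hF hx]
    have e2 : Complex.normSq (u - w) = δ ^ 2 := by
      rw [Complex.normSq_eq_norm_sq, ← dist_eq_norm, dist_center hF huF]
    rw [dist_comm, dist_eq_norm, ← Complex.normSq_eq_norm_sq]
    simp only [Complex.normSq_apply, Complex.sub_re, Complex.sub_im] at e1 e2 ⊢
    linarith
  have iv := ip v hv
  have iz := ip z hz
  have sqv : (2 * δ * b) ^ 2 ≤ dist u v ^ 2 :=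
    pow_le_pow_left₀ (by positivity) (hb.face_dist hδ hF huF hv hvu.symm) 2
  have sqz : (2 * δ * b) ^ 2 ≤ dist u z ^ 2 :=
    pow_le_pow_left₀ (by positivity) (hb.face_dist hδ hF huF hz hzu.symm) 2
  have iy : (w - u).re * (y - u).re + (w - u).im * (y - u).im ≤ δ * dist u y := by
    have h1 : ‖(starRingEnd ℂ) (w - u) * (y - u)‖ = δ * dist u y := by
      rw [norm_mul, Complex.norm_conj, ← dist_eq_norm, dist_comm, dist_center hF huF,
        ← dist_eq_norm, dist_comm]
    rw [← h1]
    refine le_trans (le_of_eq ?_) (Complex.re_le_norm _)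
    simp [Complex.mul_re]; ring
  -- Pairing with `w - u` gives `|x - u|² / 2` for each vertex `x` of `F`, at least `2 δ² b²` if `x
  -- ≠ u`, but less than `2 δ² b²` for `y`. Hence `y` lies in the triangle `u v z`, so it is a
  -- vertex of `F`, contrary to `Fat.face_dist`.
  have hsum : α + β < 1 := by
    rw [hdec] at iy
    simp only [Complex.add_re, Complex.add_im, Complex.re_ofReal_mul, Complex.im_ofReal_mul] at iy
    have h1 : (α + β) * (2 * δ ^ 2 * b ^ 2) ≤ δ * dist u y := by
      nlinarith [mul_le_mul_of_nonneg_left sqv hα0, mul_le_mul_of_nonneg_left sqz hβ0]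
    have h2 : δ * dist u y < δ * (2 * δ * b ^ 2) := mul_lt_mul_of_pos_left hcon hδ
    by_contra h3
    push Not at h3
    nlinarith [mul_le_mul_of_nonneg_right h3 (show 0 ≤ 2 * δ ^ 2 * b ^ 2 by positivity)]
  have hyF : y ∈ convexHull ℝ (F : Set ℂ) := by
    have hs := subset_convexHull ℝ (F : Set ℂ)
    have := (convex_convexHull ℝ (F : Set ℂ)).sum_mem (t := Finset.univ)
      (w := ![1 - α - β, α, β])
      (z := ![u, v, z]) (by intro i _; fin_cases i <;> simp <;> linarith)
      (by simp [Fin.sum_univ_three]; ring)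
      (by intro i _; fin_cases i <;> simp <;> exact hs (Finset.mem_coe.2 ‹_›))
    have e : y = (1 - α - β) • u + α • v + β • z := by
      simp only [Complex.real_smul]; push_cast; linear_combination hdec
    rw [e]
    simpa [Fin.sum_univ_three] using this
  have := hb.face_dist hδ hF huF (mem_of_mem_hull hF hy hyF) huy
  nlinarith [mul_pos hδ hb0]

/-! ### Connectedness of the graph -/

theorem hull_subset_closedBall (hF : F ∈ Γ.faces) :
    convexHull ℝ (F : Set ℂ) ⊆ Metric.closedBall (Γ.center F) δ :=
  convexHull_min (fun _ hx => (dist_center hF (Finset.mem_coe.1 hx)).le) (convex_closedBall _ _)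

theorem dist_le_of_mem_hull (hF : F ∈ Γ.faces) (hu : u ∈ F) {p : ℂ}
    (hp : p ∈ convexHull ℝ (F : Set ℂ)) : dist u p ≤ 2 * δ := by
  have h1 := hull_subset_closedBall hF hp
  rw [Metric.mem_closedBall] at h1
  have := dist_triangle_right u p (Γ.center F)
  rw [dist_center hF hu] at this
  linarith

theorem face_nonempty (hF : F ∈ Γ.faces) : F.Nonempty :=
  (erase_nonempty hF 0).mono (Finset.erase_subset _ _)

theorem exists_vertex_near (Γ : IsoradialGraph δ) (x : ℂ) : ∃ u ∈ Γ.vertices, dist u x ≤ 2 * δ := by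
  obtain ⟨F, hF, hx⟩ := Γ.exists_face x
  obtain ⟨u, hu⟩ := face_nonempty hF
  exact ⟨u, ⟨F, hF, hu⟩, dist_le_of_mem_hull hF hu hx⟩

/-- A face met by the segment has all its vertices in `Ω`, so either all or none of them are
reachable from `x`. The two kinds of faces give two closed sets covering the connected segment; at a
common point the two faces share a vertex. -/
theorem inside_reachable (hδ : 0 < δ) {Ω : Set ℂ} (hΩ : Convex ℝ Ω)
    (x y : ↥(Γ.vertices ∩ Ω))
    (h : ∀ p ∈ segment ℝ (x : ℂ) y, ∀ z, dist z p ≤ 2 * δ → z ∈ Ω) :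
    (Γ.inside Ω).Reachable x y := by
  set S : ℂ → Prop := fun z => ∃ h : z ∈ Γ.vertices ∩ Ω, (Γ.inside Ω).Reachable x ⟨z, h⟩ with hS
  have hface : ∀ F ∈ Γ.faces, ∀ p ∈ segment ℝ (x : ℂ) y, p ∈ convexHull ℝ (F : Set ℂ) →
      ∀ u ∈ F, S u → ∀ v ∈ F, S v := by
    intro F hF p hp hpF u hu hSu v hv
    refine face_induction hδ hF S ?_ hu hSu hv
    rintro a ha c hc hac ⟨h1, h2⟩
    have hcΩ : c ∈ Γ.vertices ∩ Ω := ⟨⟨F, hF, hc⟩, h p hp c (dist_le_of_mem_hull hF hc hpF)⟩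
    refine ⟨hcΩ, h2.trans (SimpleGraph.Adj.reachable ?_)⟩
    exact ⟨hac, hΩ.segment_subset h1.2 hcΩ.2⟩
  have hSx : S x := ⟨x.2, SimpleGraph.Reachable.refl _⟩
  suffices hSy : S y from hSy.choose_spec
  by_contra hcon
  obtain ⟨Fx, hFx, hxF⟩ := x.2.1
  obtain ⟨Fy, hFy, hyF⟩ := y.2.1
  have hconn : IsPreconnected (segment ℝ (x : ℂ) y) := (convex_segment _ _).isPreconnected
  rw [isPreconnected_closed_iff] at hconn
  obtain ⟨p, hp, hpA, hpB⟩ := hconn _ _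
    (isClosed_iUnion_hull (Γ := Γ) fun G => ∀ v ∈ G, S v)
    (isClosed_iUnion_hull (Γ := Γ) fun G => ∀ v ∈ G, ¬ S v) (by
      intro p hp
      obtain ⟨F, hF, hpF⟩ := Γ.exists_face p
      by_cases hex : ∃ u ∈ F, S u
      · obtain ⟨u, hu, hSu⟩ := hex
        exact Or.inl (Set.mem_iUnion.2 ⟨⟨⟨F, hF⟩, hface F hF p hp hpF u hu hSu⟩, hpF⟩)
      · push Not at hex
        exact Or.inr (Set.mem_iUnion.2 ⟨⟨⟨F, hF⟩, hex⟩, hpF⟩))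
    (by
      have hx' := subset_convexHull ℝ _ (Finset.mem_coe.2 hxF)
      exact ⟨x, left_mem_segment ℝ _ _, Set.mem_iUnion.2
        ⟨⟨⟨Fx, hFx⟩, hface Fx hFx x (left_mem_segment ℝ _ _) hx' x hxF hSx⟩, hx'⟩⟩)
    (by
      have hy' := subset_convexHull ℝ _ (Finset.mem_coe.2 hyF)
      exact ⟨y, right_mem_segment ℝ _ _, Set.mem_iUnion.2 ⟨⟨⟨Fy, hFy⟩, fun v hv hSv =>
        hcon (hface Fy hFy y (right_mem_segment ℝ _ _) hy' v hv hSv y hyF)⟩, hy'⟩⟩)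
  obtain ⟨⟨⟨F, hF⟩, hFS⟩, hpF⟩ := Set.mem_iUnion.1 hpA
  obtain ⟨⟨⟨G, hG⟩, hGS⟩, hpG⟩ := Set.mem_iUnion.1 hpB
  simp only at hpF hpG hFS hGS
  by_cases hFG : F = G
  · subst hFG
    obtain ⟨a, ha⟩ := face_nonempty hF
    exact hGS a ha (hFS a ha)
  · have hm := Set.mem_inter hpF hpG
    rw [Γ.edge_to_edge F hF G hG hFG] at hm
    obtain ⟨a, haF, haG⟩ := convexHull_nonempty_iff.1 ⟨p, hm⟩
    exact hGS a haG (hFS a haF)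

theorem inside_reachable_ball (hδ : 0 < δ) {c : ℂ} {s s' : ℝ} (hs : s + 2 * δ ≤ s')
    {x y : ℂ}
    (hxs : x ∈ Metric.ball c s) (hys : y ∈ Metric.ball c s)
    (hx' : x ∈ Γ.vertices ∩ Metric.ball c s') (hy' : y ∈ Γ.vertices ∩ Metric.ball c s') :
    (Γ.inside (Metric.ball c s')).Reachable ⟨x, hx'⟩ ⟨y, hy'⟩ := by
  refine inside_reachable hδ (convex_ball _ _) _ _ fun p hp z hz => ?_
  have hp' := (convex_ball c s).segment_subset hxs hys hp
  rw [Metric.mem_ball] at hp' ⊢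
  linarith [dist_triangle z p c]

end IsoradialGraph

namespace IsoradialGraph

variable {δ : ℝ} {Γ : IsoradialGraph δ} {u v z : ℂ} {b : ℝ}

/-! ### Counting vertices -/

theorem finite_vertices_ball (Γ : IsoradialGraph δ) (x : ℂ) (s : ℝ) :
    (Γ.vertices ∩ Metric.ball x s).Finite := by
  have h := Γ.locallyFinite.finite_nonempty_inter_compact (isCompact_closedBall x s)
  refine (h.biUnion fun F _ => (F : Finset ℂ).finite_toSet).subset ?_
  rintro v ⟨⟨F, hF, hv⟩, hvs⟩
  exact Set.mem_biUnion (x := (⟨F, hF⟩ : Γ.faces))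
    ⟨v, subset_convexHull ℝ _ (Finset.mem_coe.2 hv), Metric.ball_subset_closedBall hvs⟩
    (Finset.mem_coe.2 hv)

/-- The vertices in a disc. -/
noncomputable def vball (Γ : IsoradialGraph δ) (x : ℂ) (s : ℝ) : Finset ℂ :=
  (Γ.finite_vertices_ball x s).toFinset

theorem mem_vball {x : ℂ} {s : ℝ} : u ∈ Γ.vball x s ↔ u ∈ Γ.vertices ∧ dist u x < s := by
  simp [vball]

theorem vball_subset {x y : ℂ} {s t : ℝ} (h : s + dist x y ≤ t) : Γ.vball x s ⊆ Γ.vball y t := by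
  intro u hu
  rw [mem_vball] at hu ⊢
  exact ⟨hu.1, by linarith [dist_triangle u x y]⟩

open MeasureTheory in
/-- A separated set in a disc cannot have too many points. -/
theorem packing {S : Finset ℂ} {x : ℂ} {s ρ : ℝ} (hs : 0 ≤ s) (hρ : 0 ≤ ρ)
    (hS : ∀ u ∈ S, dist u x < s)
    (hsep : ∀ u ∈ S, ∀ v ∈ S, u ≠ v → 2 * ρ ≤ dist u v) : S.card * ρ ^ 2 ≤ (s + ρ) ^ 2 := by
  have hdisj : (S : Set ℂ).PairwiseDisjoint fun u => Metric.ball u ρ := by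
    intro u hu v hv huv
    exact Metric.ball_disjoint_ball (by linarith [hsep u hu v hv huv])
  have h1 := measure_biUnion_finset (μ := (volume : Measure ℂ)) hdisj
    (fun _ _ => Metric.isOpen_ball.measurableSet)
  have h2 : (⋃ u ∈ S, Metric.ball u ρ) ⊆ Metric.ball x (s + ρ) := by
    refine Set.iUnion₂_subset fun u hu z hz => ?_
    rw [Metric.mem_ball] at hz ⊢
    linarith [dist_triangle z u x, hS u hu]
  have h3 := measure_mono (μ := (volume : Measure ℂ)) h2
  rw [h1] at h3
  simp only [Complex.volume_ball, Finset.sum_const, nsmul_eq_mul] at h3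
  rw [← mul_assoc] at h3
  have h4 := (ENNReal.mul_le_mul_iff_left (by simp [NNReal.pi_ne_zero]) (by simp)).1 h3
  rw [← ENNReal.ofReal_pow hρ, ← ENNReal.ofReal_pow (by positivity), ← ENNReal.ofReal_natCast,
    ← ENNReal.ofReal_mul (by positivity)] at h4
  exact (ENNReal.ofReal_le_ofReal_iff (by positivity)).1 h4

open MeasureTheory in
/-- A family of discs of equal radius covering a disc cannot have too few members. -/
theorem covering {S : Finset ℂ} {x : ℂ} {s ρ : ℝ} (hs : 0 ≤ s) (hρ : 0 ≤ ρ)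
    (hS : ∀ y, dist y x < s → ∃ u ∈ S, dist y u ≤ ρ) : s ^ 2 ≤ S.card * ρ ^ 2 := by
  have h2 : Metric.ball x s ⊆ ⋃ u ∈ S, Metric.closedBall u ρ := by
    intro y hy
    obtain ⟨u, hu, h⟩ := hS y hy
    exact Set.mem_biUnion (Finset.mem_coe.2 hu) h
  have h3 := (measure_mono (μ := (volume : Measure ℂ)) h2).trans (measure_biUnion_finset_le _ _)
  simp only [Complex.volume_ball, Complex.volume_closedBall, Finset.sum_const, nsmul_eq_mul] at h3
  rw [← mul_assoc] at h3
  have h4 := (ENNReal.mul_le_mul_iff_left (by simp [NNReal.pi_ne_zero]) (by simp)).1 h3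
  rw [← ENNReal.ofReal_pow hρ, ← ENNReal.ofReal_pow (by positivity), ← ENNReal.ofReal_natCast,
    ← ENNReal.ofReal_mul (by positivity)] at h4
  exact (ENNReal.ofReal_le_ofReal_iff (by positivity)).1 h4

/-- The standing assumptions. -/
structure Regular (Γ : IsoradialGraph δ) (b : ℝ) : Prop where
  fat : Γ.Fat b
  mesh_pos : 0 < δ
  pos : 0 < b
  le_one : b ≤ 1

namespace Regular

variable (h : Γ.Regular b)
include h

theorem card_vball_le {x : ℂ} {s : ℝ} (hs : 0 ≤ s) :
    (Γ.vball x s).card * (δ * b ^ 2) ^ 2 ≤ (s + δ * b ^ 2) ^ 2 := by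
  have hδ := h.mesh_pos
  have hb := h.pos
  refine packing (x := x) hs (by positivity) (fun u hu => (mem_vball.1 hu).2) ?_
  intro u hu v hv huv
  have := h.fat.separated hδ hb h.le_one (mem_vball.1 hu).1 (mem_vball.1 hv).1 huv
  linarith

theorem card_vball_ge {x : ℂ} {s : ℝ} (hs : 4 * δ ≤ s) :
    s ^ 2 ≤ (Γ.vball x s).card * (16 * δ ^ 2) := by
  have hδ := h.mesh_pos
  have := covering (S := Γ.vball x s) (x := x) (s := s / 2) (ρ := 2 * δ) (by linarith)
    (by linarith) (by
      intro y hy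
      obtain ⟨u, hu, hd⟩ := Γ.exists_vertex_near y
      exact ⟨u, mem_vball.2 ⟨hu, by linarith [dist_triangle u y x]⟩, by rwa [dist_comm]⟩)
  nlinarith

theorem card_nbrs_le (u : ℂ) : (Γ.nbrs u).card * b ^ 4 ≤ 16 := by
  have hδ := h.mesh_pos
  have hb := h.pos
  have h1 : (Γ.nbrs u).card ≤ (Γ.vball u (3 * δ)).card := Finset.card_le_card fun v hv => by
    have hv := mem_nbrs.1 hv
    rw [mem_vball, dist_comm]
    exact ⟨Adj.mem_vertices hv, by linarith [Adj.dist_le hv]⟩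
  have h2 := h.card_vball_le (x := u) (s := 3 * δ) (by positivity)
  have h1' : ((Γ.nbrs u).card : ℝ) ≤ (Γ.vball u (3 * δ)).card := by exact_mod_cast h1
  have h3 : b ^ 2 ≤ 1 := pow_le_one₀ hb.le h.le_one
  have h4 : (3 * δ + δ * b ^ 2) ^ 2 ≤ (4 * δ) ^ 2 :=
    pow_le_pow_left₀ (by positivity) (by nlinarith) 2
  have h5 : ((Γ.nbrs u).card * b ^ 4) * δ ^ 2 ≤ 16 * δ ^ 2 := by
    calc ((Γ.nbrs u).card * b ^ 4) * δ ^ 2 = (Γ.nbrs u).card * (δ * b ^ 2) ^ 2 := by ring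
      _ ≤ (Γ.vball u (3 * δ)).card * (δ * b ^ 2) ^ 2 := by gcongr
      _ ≤ _ := h2
      _ ≤ _ := h4
      _ = _ := by ring
  exact le_of_mul_le_mul_right h5 (by positivity)

theorem tan_pos (huv : Γ.graph.Adj u v) : 0 < Real.tan (Γ.halfAngle u v) :=
  h.pos.trans_le (h.fat u v huv).2

theorem dist_ge (huv : Γ.graph.Adj u v) : 2 * δ * b ≤ dist u v := (h.fat u v huv).1

/-- Turns a per-neighbor error in the unnormalized Laplacian into a multiple of the weight, which
can be summed over discs by `mass_le`. -/
theorem sum_tan_le (u : ℂ) :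
    (∑ v ∈ Γ.nbrs u, Real.tan (Γ.halfAngle u v)) * (δ ^ 2 * b ^ 2) ≤ Γ.weight u := by
  have hδ := h.mesh_pos
  have hb := h.pos
  have h1 := weight_eq (Γ := Γ) hδ u
  have h2 : ∑ v ∈ Γ.nbrs u, Real.tan (Γ.halfAngle u v) * (2 * δ * b) ^ 2 ≤ 4 * Γ.weight u := by
    rw [h1]
    refine Finset.sum_le_sum fun v hv => ?_
    have hv := mem_nbrs.1 hv
    exact mul_le_mul_of_nonneg_left (pow_le_pow_left₀ (by positivity) (h.dist_ge hv) 2)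
      (h.tan_pos hv).le
  rw [← Finset.sum_mul] at h2
  linarith

theorem weight_nonneg (u : ℂ) : 0 ≤ Γ.weight u := by
  have h1 := weight_eq (Γ := Γ) h.mesh_pos u
  have : 0 ≤ ∑ v ∈ Γ.nbrs u, Real.tan (Γ.halfAngle u v) * dist u v ^ 2 :=
    Finset.sum_nonneg fun v hv => mul_nonneg (h.tan_pos (mem_nbrs.1 hv)).le (by positivity)
  linarith

theorem exists_adj (hu : u ∈ Γ.vertices) : ∃ v, Γ.graph.Adj u v := by
  obtain ⟨F, hF, huF⟩ := hu
  obtain ⟨v, hv, hne, hL⟩ := exists_onLeft h.mesh_pos hF huF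
  exact ⟨v, hL.adj h.mesh_pos hF huF hv hne.symm⟩

theorem weight_ge (hu : u ∈ Γ.vertices) : δ ^ 2 * b ^ 3 ≤ Γ.weight u := by
  have hb := h.pos
  obtain ⟨v, hv⟩ := h.exists_adj hu
  have h1 := h.sum_tan_le u
  have h2 : b ≤ ∑ v ∈ Γ.nbrs u, Real.tan (Γ.halfAngle u v) :=
    (h.fat u v hv).2.trans (Finset.single_le_sum
      (f := fun v => Real.tan (Γ.halfAngle u v))
      (fun v hv => (h.tan_pos (mem_nbrs.1 hv)).le) (mem_nbrs.2 hv))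
  have h3 := mul_le_mul_of_nonneg_right h2 (show 0 ≤ δ ^ 2 * b ^ 2 by positivity)
  nlinarith

theorem weight_pos (hu : u ∈ Γ.vertices) : 0 < Γ.weight u := by
  have := h.pos
  have := h.mesh_pos
  exact lt_of_lt_of_le (by positivity) (h.weight_ge hu)

theorem weight_le (u : ℂ) : Γ.weight u * b ^ 4 ≤ 8 * δ ^ 2 := by
  have hb := h.pos
  have h1 : Γ.weight u ≤ δ ^ 2 / 2 * (Γ.nbrs u).card := by
    rw [weight, sum_neighborSet (fun v => Real.sin (2 * Γ.halfAngle u v))]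
    refine mul_le_mul_of_nonneg_left ?_ (by positivity)
    refine (Finset.sum_le_sum fun v _ => Real.sin_le_one (2 * Γ.halfAngle u v)).trans ?_
    simp
  have h2 := mul_le_mul_of_nonneg_right h1 (show 0 ≤ b ^ 4 by positivity)
  nlinarith [h.card_nbrs_le u, sq_nonneg δ]

theorem mass_le {x : ℂ} {s : ℝ} (hs : δ ≤ s) :
    ∑ u ∈ Γ.vball x s, Γ.weight u ≤ 32 / b ^ 8 * s ^ 2 := by
  have hδ := h.mesh_pos
  have hb := h.pos
  have h1 := h.card_vball_le (x := x) (s := s) (by linarith)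
  have h3 : b ^ 2 ≤ 1 := pow_le_one₀ hb.le h.le_one
  have h4 : (s + δ * b ^ 2) ^ 2 ≤ (2 * s) ^ 2 :=
    pow_le_pow_left₀ (by have : 0 ≤ s := hδ.le.trans hs; positivity) (by nlinarith) 2
  have h5 : (∑ u ∈ Γ.vball x s, Γ.weight u) * b ^ 4 ≤ (Γ.vball x s).card * (8 * δ ^ 2) := by
    rw [Finset.sum_mul]
    refine (Finset.sum_le_sum fun u _ => h.weight_le u).trans ?_
    simp
  rw [div_mul_eq_mul_div, le_div_iff₀ (by positivity)]
  calc (∑ u ∈ Γ.vball x s, Γ.weight u) * b ^ 8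
      = ((∑ u ∈ Γ.vball x s, Γ.weight u) * b ^ 4) * b ^ 4 := by ring
    _ ≤ ((Γ.vball x s).card * (8 * δ ^ 2)) * b ^ 4 := by gcongr
    _ = 8 * ((Γ.vball x s).card * (δ * b ^ 2) ^ 2) := by ring
    _ ≤ 8 * (2 * s) ^ 2 := by linarith
    _ = _ := by ring

theorem mass_ge {x : ℂ} {s : ℝ} (hs : 4 * δ ≤ s) :
    b ^ 3 / 16 * s ^ 2 ≤ ∑ u ∈ Γ.vball x s, Γ.weight u := by
  have hb := h.pos
  have h1 := h.card_vball_ge (x := x) hs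
  have h2 : (Γ.vball x s).card * (δ ^ 2 * b ^ 3) ≤ ∑ u ∈ Γ.vball x s, Γ.weight u := by
    refine le_trans ?_ (Finset.sum_le_sum fun u hu => h.weight_ge (mem_vball.1 hu).1)
    simp
  have h3 := mul_le_mul_of_nonneg_right h1 (show 0 ≤ b ^ 3 by positivity)
  linarith

end Regular

/-! ### The Laplacian -/

/-- The unnormalized discrete Laplacian of a function on the plane. -/
noncomputable def lap (Γ : IsoradialGraph δ) (H : ℂ → ℝ) (u : ℂ) : ℝ :=
  ∑ v ∈ Γ.nbrs u, Real.tan (Γ.halfAngle u v) * (H v - H u)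

theorem lap_sub (H K : ℂ → ℝ) (u : ℂ) :
    Γ.lap (fun z => H z - K z) u = Γ.lap H u - Γ.lap K u := by
  rw [lap, lap, lap, ← Finset.sum_sub_distrib]
  exact Finset.sum_congr rfl fun v _ => by ring

theorem lap_neg (H : ℂ → ℝ) (u : ℂ) : Γ.lap (fun z => -H z) u = -Γ.lap H u := by
  rw [lap, lap, ← Finset.sum_neg_distrib]
  exact Finset.sum_congr rfl fun v _ => by ring

/-- Green's formula for a compactly supported test function. -/
theorem sum_mul_lap {H ψ : ℂ → ℝ} {x : ℂ} {s t : ℝ} (hst : s + 2 * δ ≤ t)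
    (hψ : ∀ z, s ≤ dist z x → ψ z = 0) :
    ∑ u ∈ Γ.vball x t, H u * Γ.lap ψ u = ∑ u ∈ Γ.vball x t, ψ u * Γ.lap H u := by
  classical
  set T := Γ.vball x t
  -- The edge terms of the difference of both sides; they are antisymmetric and cancel in pairs.
  set k : ℂ → ℂ → ℝ := fun u v => if v ∈ Γ.nbrs u then
    Real.tan (Γ.halfAngle u v) * (H u * ψ v - ψ u * H v) else 0 with hk
  have hanti : ∀ u v, k v u = -k u v := by
    intro u v
    have hsymm : u ∈ Γ.nbrs v ↔ v ∈ Γ.nbrs u := by rw [mem_nbrs, mem_nbrs, Γ.graph.adj_comm]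
    simp only [hk, hsymm]
    split_ifs
    · rw [halfAngle_comm]; ring
    · simp
  have h0 : ∑ u ∈ T, ∑ v ∈ T, k u v = 0 := by
    have : ∑ u ∈ T, ∑ v ∈ T, k u v = -∑ u ∈ T, ∑ v ∈ T, k u v := by
      conv_lhs => rw [Finset.sum_comm]
      simp only [← Finset.sum_neg_distrib]
      exact Finset.sum_congr rfl fun u _ => Finset.sum_congr rfl fun v _ => hanti u v
    linarith
  rw [← sub_eq_zero, ← Finset.sum_sub_distrib, ← h0]
  refine Finset.sum_congr rfl fun u hu => ?_
  rw [lap, lap, Finset.mul_sum, Finset.mul_sum, ← Finset.sum_sub_distrib]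
  have e1 : ∑ v ∈ T, k u v = ∑ v ∈ T ∩ Γ.nbrs u,
      Real.tan (Γ.halfAngle u v) * (H u * ψ v - ψ u * H v) := by
    rw [← Finset.sum_ite_mem]
  rw [e1, Finset.inter_comm]
  symm
  refine Finset.sum_subset_zero_on_sdiff Finset.inter_subset_left ?_ ?_
  · intro v hv
    simp only [Finset.mem_sdiff, Finset.mem_inter, not_and] at hv
    have hadj := mem_nbrs.1 hv.1
    -- An edge leaving the disc of radius `t` has both ends at distance at least `t - 2 δ ≥ s`,
    -- where `ψ` vanishes.
    have hv2 : ¬ dist v x < t := fun hlt => hv.2 hv.1 (mem_vball.2 ⟨Adj.mem_vertices hadj, hlt⟩)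
    have hd := Adj.dist_le hadj
    have huv : t - 2 * δ ≤ dist u x := by linarith [dist_triangle_left v x u]
    have hu0 : ψ u = 0 := hψ u (by linarith)
    have hv0 : ψ v = 0 := hψ v (by linarith [dist_nonneg (x := u) (y := v)])
    rw [hu0, hv0]; ring
  · intro v _
    ring

/-- The scalar product of two plane vectors. -/
noncomputable def ip (a e : ℂ) : ℝ := a.re * e.re + a.im * e.im

theorem abs_ip_le (a e : ℂ) : |ip a e| ≤ ‖a‖ * ‖e‖ := by
  have h : ip a e = ((starRingEnd ℂ) a * e).re := by simp [ip, Complex.mul_re]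
  rw [h, ← Complex.norm_conj a, ← norm_mul]
  exact Complex.abs_re_le_norm _

theorem sum_tan_mul_ip (hδ : 0 < δ) (u a : ℂ) :
    ∑ v ∈ Γ.nbrs u, Real.tan (Γ.halfAngle u v) * ip a (v - u) = 0 := by
  have h := sum_tan_mul_sub (Γ := Γ) hδ u
  have h1 := congrArg Complex.re h
  have h2 := congrArg Complex.im h
  simp only [Complex.re_sum, Complex.im_sum, Complex.re_ofReal_mul, Complex.im_ofReal_mul,
    Complex.zero_re, Complex.zero_im] at h1 h2
  calc _ = a.re * ∑ v ∈ Γ.nbrs u, Real.tan (Γ.halfAngle u v) * (v - u).re +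
        a.im * ∑ v ∈ Γ.nbrs u, Real.tan (Γ.halfAngle u v) * (v - u).im := by
        rw [Finset.mul_sum, Finset.mul_sum, ← Finset.sum_add_distrib]
        exact Finset.sum_congr rfl fun v _ => by rw [ip]; ring
    _ = 0 := by rw [h1, h2]; ring

/-- Isotropy: `ip a z ^ 2` is `‖a‖² |z|² / 2` plus a combination of `Re z²` and `Im z²`, whose sums
vanish. -/
theorem sum_tan_mul_ip_sq (hδ : 0 < δ) (u a : ℂ) :
    ∑ v ∈ Γ.nbrs u, Real.tan (Γ.halfAngle u v) * ip a (v - u) ^ 2 =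
      2 * Γ.weight u * ‖a‖ ^ 2 := by
  have h := sum_tan_mul_sub_sq (Γ := Γ) hδ u
  have h1 := congrArg Complex.re h
  have h2 := congrArg Complex.im h
  have h3 := weight_eq (Γ := Γ) hδ u
  simp only [Complex.re_sum, Complex.im_sum, Complex.re_ofReal_mul, Complex.im_ofReal_mul,
    Complex.zero_re, Complex.zero_im] at h1 h2
  have key : ∑ v ∈ Γ.nbrs u, Real.tan (Γ.halfAngle u v) * ip a (v - u) ^ 2 =
      (a.re ^ 2 + a.im ^ 2) / 2 *
        ∑ v ∈ Γ.nbrs u, Real.tan (Γ.halfAngle u v) * dist u v ^ 2 +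
      (a.re ^ 2 - a.im ^ 2) / 2 *
        ∑ v ∈ Γ.nbrs u, Real.tan (Γ.halfAngle u v) * ((v - u) ^ 2).re +
      a.re * a.im * ∑ v ∈ Γ.nbrs u, Real.tan (Γ.halfAngle u v) * ((v - u) ^ 2).im := by
    rw [Finset.mul_sum, Finset.mul_sum, Finset.mul_sum, ← Finset.sum_add_distrib,
      ← Finset.sum_add_distrib]
    refine Finset.sum_congr rfl fun v _ => ?_
    rw [dist_comm, dist_eq_norm, ← Complex.normSq_eq_norm_sq, Complex.normSq_apply, ip, sq (v - u),
      Complex.mul_re, Complex.mul_im]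
    ring
  rw [key, h1, h2, ← h3, ← Complex.normSq_eq_norm_sq, Complex.normSq_apply]
  ring

theorem lap_affine (hδ : 0 < δ) (c : ℝ) (a y u : ℂ) :
    Γ.lap (fun z => c + ip a (z - y)) u = 0 := by
  rw [← sum_tan_mul_ip (Γ := Γ) hδ u a, lap]
  refine Finset.sum_congr rfl fun v _ => ?_
  simp only [ip, Complex.sub_re, Complex.sub_im]
  ring

end IsoradialGraph

namespace IsoradialGraph

/-! ### A smoothed logarithm -/

/-- `(1/2) log t`, replaced by its third Taylor polynomial at `1` for `t ≤ 1`. -/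
noncomputable def slog (t : ℝ) : ℝ :=
  if t ≤ 1 then ((t - 1) - (t - 1) ^ 2 / 2 + (t - 1) ^ 3 / 3) / 2 else Real.log t / 2

/-- The first derivative of `slog`. -/
noncomputable def slog₁ (t : ℝ) : ℝ :=
  if t ≤ 1 then (1 - (t - 1) + (t - 1) ^ 2) / 2 else t⁻¹ / 2

/-- The second derivative of `slog`. -/
noncomputable def slog₂ (t : ℝ) : ℝ :=
  if t ≤ 1 then (-1 + 2 * (t - 1)) / 2 else -(t ^ 2)⁻¹ / 2

theorem hasDerivAt_ite {f g : ℝ → ℝ} {f' g' : ℝ → ℝ}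
    (hf : ∀ t ≤ 1, HasDerivAt f (f' t) t) (hg : ∀ t ≥ 1, HasDerivAt g (g' t) t)
    (h0 : f 1 = g 1) (h1 : f' 1 = g' 1) (t : ℝ) :
    HasDerivAt (fun t => if t ≤ 1 then f t else g t) (if t ≤ 1 then f' t else g' t) t := by
  rcases lt_trichotomy t 1 with ht | rfl | ht
  · rw [if_pos ht.le]
    refine (hf t ht.le).congr_of_eventuallyEq ?_
    filter_upwards [Iio_mem_nhds ht] with x hx using if_pos (Set.mem_Iio.1 hx).le
  · rw [if_pos le_rfl, ← hasDerivWithinAt_univ, ← Set.Iic_union_Ici (a := (1 : ℝ))]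
    refine HasDerivWithinAt.union ?_ ?_
    · exact (hf 1 le_rfl).hasDerivWithinAt.congr (fun x hx => if_pos hx) (if_pos le_rfl)
    · rw [h1]
      refine (hg 1 le_rfl).hasDerivWithinAt.congr (fun x hx => ?_) ?_
      · rcases eq_or_lt_of_le (Set.mem_Ici.1 hx) with rfl | h
        · rw [if_pos le_rfl, h0]
        · rw [if_neg (not_le.2 h)]
      · rw [if_pos le_rfl, h0]
  · rw [if_neg (not_le.2 ht)]
    refine (hg t ht.le).congr_of_eventuallyEq ?_
    filter_upwards [Ioi_mem_nhds ht] with x hx using if_neg (not_le.2 hx)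

theorem hasDerivAt_slog (t : ℝ) : HasDerivAt slog (slog₁ t) t := by
  refine hasDerivAt_ite (f := fun t => ((t - 1) - (t - 1) ^ 2 / 2 + (t - 1) ^ 3 / 3) / 2)
    (g := fun t => Real.log t / 2) (f' := fun t => (1 - (t - 1) + (t - 1) ^ 2) / 2)
    (g' := fun t => t⁻¹ / 2) (fun t _ => ?_) (fun t ht => ?_) (by norm_num) (by norm_num) t
  · have h := (hasDerivAt_id t).sub_const 1
    have := ((h.sub ((h.pow 2).div_const 2)).add ((h.pow 3).div_const 3)).div_const 2
    exact this.congr_deriv (by simp only [id]; push_cast; ring)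
  · exact (Real.hasDerivAt_log (by linarith)).div_const 2

theorem hasDerivAt_slog₁ (t : ℝ) : HasDerivAt slog₁ (slog₂ t) t := by
  refine hasDerivAt_ite (f := fun t => (1 - (t - 1) + (t - 1) ^ 2) / 2)
    (g := fun t => t⁻¹ / 2) (f' := fun t => (-1 + 2 * (t - 1)) / 2)
    (g' := fun t => -(t ^ 2)⁻¹ / 2) (fun t _ => ?_) (fun t ht => ?_) (by norm_num)
    (by norm_num) t
  · have h := (hasDerivAt_id t).sub_const 1
    have := ((h.const_sub 1).add (h.pow 2)).div_const 2
    exact this.congr_deriv (by simp only [id]; push_cast; ring)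
  · exact (hasDerivAt_inv (by linarith : t ≠ 0)).div_const 2

theorem slog₂_sub_le {t a : ℝ} (hta : t ≤ a) : |slog₂ a - slog₂ t| ≤ a - t := by
  have hinv : ∀ x y : ℝ, 1 ≤ x → x ≤ y → 0 ≤ (x ^ 2)⁻¹ - (y ^ 2)⁻¹ ∧
      (x ^ 2)⁻¹ - (y ^ 2)⁻¹ ≤ 2 * (y - x) := by
    intro x y hx hxy
    have hx0 : 0 < x := by linarith
    have hy0 : 0 < y := by linarith
    have e : (x ^ 2)⁻¹ - (y ^ 2)⁻¹ = (y - x) * ((y + x) / (x ^ 2 * y ^ 2)) := by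
      field_simp; ring
    have h2 : (y + x) / (x ^ 2 * y ^ 2) ≤ 2 := by
      rw [div_le_iff₀ (by positivity)]
      have h3 : 1 ≤ x * y := by nlinarith
      have h4 : x + y ≤ 2 * (x * y) := by nlinarith
      nlinarith
    rw [e]
    exact ⟨mul_nonneg (by linarith) (by positivity), by nlinarith⟩
  simp only [slog₂]
  rw [abs_le]
  split_ifs with h1 h2 h2
  · constructor <;> linarith
  · linarith
  · have := hinv 1 a le_rfl (by linarith)
    rw [one_pow, inv_one] at this
    constructor <;> linarith [this.1, this.2]
  · have := hinv t a (by linarith) hta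
    constructor <;> linarith [this.1, this.2]

theorem abs_slog₂_sub_le (t a : ℝ) : |slog₂ a - slog₂ t| ≤ |a - t| := by
  rcases le_total t a with h | h
  · rw [abs_of_nonneg (sub_nonneg.2 h)]; exact slog₂_sub_le h
  · rw [abs_sub_comm, abs_sub_comm a, abs_of_nonneg (sub_nonneg.2 h)]; exact slog₂_sub_le h

theorem abs_slog₂_le {t : ℝ} (ht : 0 ≤ t) : |slog₂ t| ≤ 3 / 2 := by
  rw [slog₂, abs_le]
  split_ifs with h
  · constructor <;> linarith
  · have h1 : (t ^ 2)⁻¹ ≤ 1 := inv_le_one_of_one_le₀ (by nlinarith)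
    have h2 : 0 ≤ (t ^ 2)⁻¹ := by positivity
    constructor <;> linarith

theorem abs_le_of_deriv {f f' : ℝ → ℝ} {a : ℝ} {n : ℕ} (hf : ∀ x, HasDerivAt f (f' x) x)
    (h0 : f a = 0) (hb : ∀ x, |f' x| ≤ |x - a| ^ n) (x : ℝ) : |f x| ≤ |x - a| ^ (n + 1) := by
  have := (convex_uIcc a x).norm_image_sub_le_of_norm_hasDerivWithin_le (f := f) (f' := f')
    (C := |x - a| ^ n) (fun y _ => (hf y).hasDerivWithinAt) (fun y hy => ?_)
    Set.left_mem_uIcc Set.right_mem_uIcc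
  · rw [h0, sub_zero, Real.norm_eq_abs, Real.norm_eq_abs] at this
    rwa [pow_succ]
  · exact (hb y).trans (pow_le_pow_left₀ (abs_nonneg _) (Set.abs_sub_left_of_mem_uIcc hy) n)

/-- `slog₂` is 1-Lipschitz, because the cubic matches the logarithm to third order at `1`; two
applications of the mean value inequality give the remainder. -/
theorem slog_taylor (a x : ℝ) :
    |slog x - slog a - slog₁ a * (x - a) - slog₂ a / 2 * (x - a) ^ 2| ≤ |x - a| ^ 3 := by
  have h1 : ∀ x, |slog₁ x - slog₁ a - slog₂ a * (x - a)| ≤ |x - a| ^ 2 := by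
    refine abs_le_of_deriv (f := fun x => slog₁ x - slog₁ a - slog₂ a * (x - a))
      (f' := fun x => slog₂ x - slog₂ a) (n := 1) (fun x => ?_) (by simp) (fun x => ?_)
    · have := ((hasDerivAt_slog₁ x).sub_const (slog₁ a)).sub
        (((hasDerivAt_id x).sub_const a).const_mul (slog₂ a))
      exact this.congr_deriv (by ring)
    · rw [pow_one]; exact abs_slog₂_sub_le _ _
  refine abs_le_of_deriv
    (f := fun x => slog x - slog a - slog₁ a * (x - a) - slog₂ a / 2 * (x - a) ^ 2)
    (f' := fun x => slog₁ x - slog₁ a - slog₂ a * (x - a)) (n := 2) (fun x => ?_) (by simp) h1 x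
  have := (((hasDerivAt_slog x).sub_const (slog a)).sub
    (((hasDerivAt_id x).sub_const a).const_mul (slog₁ a))).sub
    ((((hasDerivAt_id x).sub_const a).pow 2).const_mul (slog₂ a / 2))
  exact this.congr_deriv (by simp only [id]; push_cast; ring)

/-- The profile of the averaging kernel. -/
noncomputable def bump (t : ℝ) : ℝ := max (1 - t) 0 ^ 2

/-- In the plane the Laplacian of `slog (|z|²)` is `4 (slog₁ t + t slog₂ t)` with `t = |z|²`. The
smoothed logarithm therefore spreads the point mass over `6 bump`. -/
theorem slog_radial_laplacian (t : ℝ) : slog₁ t + t * slog₂ t = 3 / 2 * bump t := by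
  rw [slog₁, slog₂, bump]
  split_ifs with h
  · rw [max_eq_left (by linarith)]; ring
  · have ht : t ≠ 0 := by linarith
    rw [max_eq_right (by linarith)]; field_simp; ring

theorem bump_nonneg (t : ℝ) : 0 ≤ bump t := sq_nonneg _

theorem bump_eq_zero {t : ℝ} (h : 1 ≤ t) : bump t = 0 := by
  rw [bump, max_eq_right (by linarith)]; norm_num

variable {δ : ℝ} {Γ : IsoradialGraph δ} {u v z : ℂ} {b : ℝ}

/-- A regularization of the logarithm at scale `s` around `x`. -/
noncomputable def pot (s : ℝ) (x z : ℂ) : ℝ := slog (dist z x ^ 2 / s ^ 2) + Real.log s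

/-- Potentials of different scales coincide outside the larger disc, so their difference is an
admissible test function in Green's formula. -/
theorem pot_eq_log {s : ℝ} (hs : 0 < s) {x z : ℂ} (h : s ≤ dist z x) :
    pot s x z = Real.log (dist z x) := by
  have hd : 0 < dist z x := by linarith
  have h1 : slog (dist z x ^ 2 / s ^ 2) = Real.log (dist z x ^ 2 / s ^ 2) / 2 := by
    rw [slog]
    split_ifs with h1
    · have : dist z x ^ 2 / s ^ 2 = 1 := by
        refine le_antisymm h1 ?_
        rw [one_le_div (by positivity)]
        exact pow_le_pow_left₀ hs.le h 2
      rw [this]; simp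
    · rfl
  rw [pot, h1, Real.log_div (by positivity) (by positivity), Real.log_pow, Real.log_pow]
  push_cast; ring

namespace Regular

variable (h : Γ.Regular b)
include h

/-- Expand `slog` to second order in the increment `d v`. The linear sum vanishes, and the sums of
`|v - u|²` and `ip²` add up to the radial Laplacian. The rest is `O((δ / s)³)` per neighbor, and
`sum_tan_le` turns it into `weight * δ / s³`. -/
theorem abs_lap_pot_sub_le {s : ℝ} (hs : δ ≤ s) {x : ℂ} (hu : dist u x ≤ 4 * s) :
    |Γ.lap (pot s x) u - 6 * Γ.weight u / s ^ 2 * bump (dist u x ^ 2 / s ^ 2)| ≤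
      8200 / b ^ 2 * Γ.weight u * δ / s ^ 3 := by
  have hδ := h.mesh_pos
  have hb := h.pos
  have hs0 : 0 < s := by linarith
  set y := u - x with hy
  set t := dist u x ^ 2 / s ^ 2 with ht
  have ht0 : 0 ≤ t := by positivity
  have hny : ‖y‖ = dist u x := by rw [hy, dist_eq_norm]
  have hts : ‖y‖ ^ 2 / s ^ 2 = t := by rw [ht, hny]
  set d : ℂ → ℝ := fun v => (2 * ip y (v - u) + dist u v ^ 2) / s ^ 2 with hd
  have hdist : ∀ v, dist v x ^ 2 / s ^ 2 - t = d v := by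
    intro v
    simp only [ht, hd]
    rw [← sub_div, dist_comm u v, dist_eq_norm, dist_eq_norm, dist_eq_norm,
      ← Complex.normSq_eq_norm_sq, ← Complex.normSq_eq_norm_sq, ← Complex.normSq_eq_norm_sq]
    congr 1
    simp only [Complex.normSq_apply, ip, hy, Complex.sub_re, Complex.sub_im]
    ring
  set err : ℂ → ℝ := fun v => (slog (dist v x ^ 2 / s ^ 2) - slog t - slog₁ t * d v -
    slog₂ t / 2 * d v ^ 2) + slog₂ t / 2 *
      ((4 * ip y (v - u) * dist u v ^ 2 + dist u v ^ 4) / s ^ 4) with herr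
  have hmain : Γ.lap (pot s x) u - 6 * Γ.weight u / s ^ 2 * bump t =
      ∑ v ∈ Γ.nbrs u, Real.tan (Γ.halfAngle u v) * err v := by
    have e1 := sum_tan_mul_ip (Γ := Γ) hδ u y
    have e2 := sum_tan_mul_ip_sq (Γ := Γ) hδ u y
    have e3 := weight_eq (Γ := Γ) hδ u
    have e4 := slog_radial_laplacian t
    have key : Γ.lap (pot s x) u = ∑ v ∈ Γ.nbrs u, Real.tan (Γ.halfAngle u v) * err v +
        slog₁ t / s ^ 2 * (2 * ∑ v ∈ Γ.nbrs u, Real.tan (Γ.halfAngle u v) * ip y (v - u) +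
          ∑ v ∈ Γ.nbrs u, Real.tan (Γ.halfAngle u v) * dist u v ^ 2) +
        slog₂ t / 2 * (4 / s ^ 4) *
          ∑ v ∈ Γ.nbrs u, Real.tan (Γ.halfAngle u v) * ip y (v - u) ^ 2 := by
      rw [Finset.mul_sum, Finset.mul_sum, mul_add, Finset.mul_sum, Finset.mul_sum, lap,
        ← Finset.sum_add_distrib, ← Finset.sum_add_distrib, ← Finset.sum_add_distrib]
      refine Finset.sum_congr rfl fun v _ => ?_
      simp only [herr, hd, pot, ← ht]
      field_simp
      ring
    have hw : 6 * Γ.weight u / s ^ 2 * bump t =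
        4 * Γ.weight u / s ^ 2 * (slog₁ t + t * slog₂ t) := by rw [e4]; ring
    rw [key, e1, e2, ← e3, hw, ← hts]
    field_simp
    ring
  -- The Taylor remainder contributes `20³ = 8000`, the dropped part of `d v ^ 2` contributes `3/4 *
  -- 144 = 108`.
  have herr_le : ∀ v ∈ Γ.nbrs u, |err v| ≤ 8200 * δ ^ 3 / s ^ 3 := by
    intro v hv
    have hv := mem_nbrs.1 hv
    have h1 : dist u v ≤ 2 * δ := Adj.dist_le hv
    have h0 : 0 ≤ dist u v := dist_nonneg
    have h2 : |ip y (v - u)| ≤ 8 * s * δ := by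
      refine (abs_ip_le _ _).trans ?_
      rw [hny, ← dist_eq_norm, dist_comm v u]
      nlinarith [dist_nonneg (x := u) (y := x)]
    have h3 : dist u v ^ 2 ≤ 4 * δ ^ 2 := by nlinarith
    have h4 : |d v| ≤ 20 * (δ / s) := by
      simp only [hd]
      rw [abs_div, abs_of_pos (by positivity : 0 < s ^ 2), div_le_iff₀ (by positivity)]
      have : 20 * (δ / s) * s ^ 2 = 20 * δ * s := by field_simp
      rw [this]
      refine (abs_add_le _ _).trans ?_
      rw [abs_mul, abs_two, abs_of_nonneg (by positivity : 0 ≤ dist u v ^ 2)]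
      nlinarith
    have h5 : |d v| ^ 3 ≤ 8000 * δ ^ 3 / s ^ 3 := by
      refine (pow_le_pow_left₀ (abs_nonneg _) h4 3).trans (le_of_eq ?_)
      rw [mul_pow, div_pow]; ring
    have h6 : |(4 * ip y (v - u) * dist u v ^ 2 + dist u v ^ 4) / s ^ 4| ≤
        144 * δ ^ 3 / s ^ 3 := by
      rw [abs_div, abs_of_pos (by positivity : 0 < s ^ 4), div_le_iff₀ (by positivity)]
      have : 144 * δ ^ 3 / s ^ 3 * s ^ 4 = 144 * δ ^ 3 * s := by field_simp
      rw [this]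
      refine (abs_add_le _ _).trans ?_
      rw [abs_mul, abs_mul, abs_of_pos (by norm_num : (0 : ℝ) < 4),
        abs_of_nonneg (by positivity : 0 ≤ dist u v ^ 2),
        abs_of_nonneg (by positivity : 0 ≤ dist u v ^ 4)]
      have k1 : 4 * |ip y (v - u)| * dist u v ^ 2 ≤ 4 * (8 * s * δ) * (4 * δ ^ 2) := by gcongr
      have k2 : dist u v ^ 4 ≤ 16 * δ ^ 3 * s := by
        calc dist u v ^ 4 = dist u v ^ 2 * dist u v ^ 2 := by ring
          _ ≤ 4 * δ ^ 2 * (4 * δ ^ 2) := by gcongr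
          _ = 16 * δ ^ 3 * δ := by ring
          _ ≤ _ := by gcongr
      nlinarith
    have h7 := slog_taylor t (dist v x ^ 2 / s ^ 2)
    rw [hdist] at h7
    have h8 := abs_slog₂_le ht0
    simp only [herr]
    refine (abs_add_le _ _).trans ?_
    rw [abs_mul (slog₂ t / 2), abs_div (slog₂ t), abs_two]
    have h9 : |slog₂ t| / 2 * |(4 * ip y (v - u) * dist u v ^ 2 + dist u v ^ 4) / s ^ 4| ≤
        3 / 2 / 2 * (144 * δ ^ 3 / s ^ 3) := by gcongr
    have h10 : 0 ≤ δ ^ 3 / s ^ 3 := by positivity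
    have e : ∀ c : ℝ, c * δ ^ 3 / s ^ 3 = c * (δ ^ 3 / s ^ 3) := fun c => by ring
    rw [e] at h5 h9 ⊢
    linarith
  rw [hmain]
  refine (Finset.abs_sum_le_sum_abs _ _).trans ?_
  have h1 : ∑ v ∈ Γ.nbrs u, |Real.tan (Γ.halfAngle u v) * err v| ≤
      (∑ v ∈ Γ.nbrs u, Real.tan (Γ.halfAngle u v)) * (8200 * δ ^ 3 / s ^ 3) := by
    rw [Finset.sum_mul]
    refine Finset.sum_le_sum fun v hv => ?_
    have hp := (h.tan_pos (mem_nbrs.1 hv)).le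
    rw [abs_mul, abs_of_nonneg hp]
    exact mul_le_mul_of_nonneg_left (herr_le v hv) hp
  refine h1.trans ?_
  have h2 := mul_le_mul_of_nonneg_right (h.sum_tan_le u)
    (show 0 ≤ 8200 * δ / (b ^ 2 * s ^ 3) by positivity)
  calc _ = (∑ v ∈ Γ.nbrs u, Real.tan (Γ.halfAngle u v)) * (δ ^ 2 * b ^ 2) *
        (8200 * δ / (b ^ 2 * s ^ 3)) := by field_simp
    _ ≤ _ := h2
    _ = _ := by field_simp

end Regular

/-! ### Averages at a given scale -/

/-- The (unnormalized) average of `H` at scale `s` around `x`. -/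
noncomputable def smooth (Γ : IsoradialGraph δ) (s : ℝ) (H : ℂ → ℝ) (x : ℂ) : ℝ :=
  ∑ u ∈ Γ.vball x s, Γ.weight u / s ^ 2 * bump (dist u x ^ 2 / s ^ 2) * H u

theorem smooth_eq {s t : ℝ} (hs : 0 < s) {x y : ℂ} (hst : s + dist x y ≤ t) (H : ℂ → ℝ) :
    Γ.smooth s H x =
      ∑ u ∈ Γ.vball y t, Γ.weight u / s ^ 2 * bump (dist u x ^ 2 / s ^ 2) * H u := by
  refine Finset.sum_subset (vball_subset hst) fun u hu hu' => ?_
  have : s ≤ dist u x := by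
    by_contra hcon
    exact hu' (mem_vball.2 ⟨(mem_vball.1 hu).1, not_le.1 hcon⟩)
  rw [bump_eq_zero, mul_zero, zero_mul]
  rw [one_le_div (by positivity)]
  exact pow_le_pow_left₀ hs.le this 2

/-- The averages of a discrete harmonic function depend little on the scale. -/
theorem Regular.smooth_two_mul (h : Γ.Regular b) {s M : ℝ} (hs : δ ≤ s) {x : ℂ} {H : ℂ → ℝ}
    (hH : ∀ u ∈ Γ.vball x (2 * s), Γ.lap H u = 0) (hM : ∀ u ∈ Γ.vball x (4 * s), |H u| ≤ M)
    (hM0 : 0 ≤ M) :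
    |Γ.smooth (2 * s) H x - Γ.smooth s H x| ≤ 10 ^ 6 / b ^ 10 * M * (δ / s) := by
  have hδ := h.mesh_pos
  have hb := h.pos
  have hs0 : 0 < s := by linarith
  set ψ : ℂ → ℝ := fun z => pot (2 * s) x z - pot s x z with hψ
  have hψ0 : ∀ z, 2 * s ≤ dist z x → ψ z = 0 := fun z hz => by
    simp only [hψ]
    rw [pot_eq_log (by linarith) hz, pot_eq_log hs0 (by linarith), sub_self]
  have hgreen := sum_mul_lap (Γ := Γ) (H := H) (ψ := ψ) (x := x) (s := 2 * s) (t := 4 * s)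
    (by linarith) hψ0
  -- `H` is harmonic where `ψ` lives, so only the approximation errors of the two potentials
  -- separate the two averages.
  have hzero : ∑ u ∈ Γ.vball x (4 * s), ψ u * Γ.lap H u = 0 := by
    refine Finset.sum_eq_zero fun u hu => ?_
    rcases lt_or_ge (dist u x) (2 * s) with h1 | h1
    · rw [hH u (mem_vball.2 ⟨(mem_vball.1 hu).1, h1⟩), mul_zero]
    · rw [hψ0 u h1, zero_mul]
  rw [hzero] at hgreen
  set e : ℝ → ℂ → ℝ := fun r u =>
    Γ.lap (pot r x) u - 6 * Γ.weight u / r ^ 2 * bump (dist u x ^ 2 / r ^ 2) with he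
  have hlap : ∀ u, Γ.lap ψ u = (6 * Γ.weight u / (2 * s) ^ 2 *
      bump (dist u x ^ 2 / (2 * s) ^ 2) -
      6 * Γ.weight u / s ^ 2 * bump (dist u x ^ 2 / s ^ 2)) + (e (2 * s) u - e s u) := by
    intro u
    simp only [hψ, lap_sub, he]
    ring
  have hdiff : 6 * (Γ.smooth (2 * s) H x - Γ.smooth s H x) =
      -∑ u ∈ Γ.vball x (4 * s), H u * (e (2 * s) u - e s u) := by
    rw [smooth_eq (s := 2 * s) (t := 4 * s) (y := x) (by linarith) (by rw [dist_self]; linarith),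
      smooth_eq (s := s) (t := 4 * s) (y := x) hs0 (by rw [dist_self]; linarith),
      ← Finset.sum_sub_distrib, Finset.mul_sum, eq_neg_iff_add_eq_zero, ← Finset.sum_add_distrib,
      ← hgreen]
    refine Finset.sum_congr rfl fun u _ => ?_
    rw [hlap]
    ring
  -- `9225 = 8200 (1 + 1/8)`, the errors at scales `s` and `2s`.
  have hest : ∀ u ∈ Γ.vball x (4 * s), |H u * (e (2 * s) u - e s u)| ≤
      M * (9225 / b ^ 2 * δ / s ^ 3) * Γ.weight u := by
    intro u hu
    have hu4 := (mem_vball.1 hu).2.le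
    have h1 := h.abs_lap_pot_sub_le (u := u) (x := x) hs hu4
    have h2 := h.abs_lap_pot_sub_le (u := u) (x := x) (s := 2 * s) (by linarith) (by linarith)
    rw [abs_mul, mul_assoc]
    refine mul_le_mul (hM u hu) ?_ (abs_nonneg _) hM0
    refine (abs_sub _ _).trans ((add_le_add h2 h1).trans (le_of_eq ?_))
    field_simp
    ring
  have hmass := h.mass_le (x := x) (s := 4 * s) (by linarith)
  have h6 : 6 * |Γ.smooth (2 * s) H x - Γ.smooth s H x| ≤
      M * (9225 / b ^ 2 * δ / s ^ 3) * (32 / b ^ 8 * (4 * s) ^ 2) := by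
    have e6 := congrArg abs hdiff
    rw [abs_mul, abs_neg, abs_of_pos (by norm_num : (0 : ℝ) < 6)] at e6
    rw [e6]
    refine (Finset.abs_sum_le_sum_abs _ _).trans ((Finset.sum_le_sum hest).trans ?_)
    rw [← Finset.mul_sum]
    exact mul_le_mul_of_nonneg_left hmass (by positivity)
  have h7 : M * (9225 / b ^ 2 * δ / s ^ 3) * (32 / b ^ 8 * (4 * s) ^ 2) =
      4723200 * (M * (δ / s) / b ^ 10) := by
    field_simp
    ring
  have h8 : 0 ≤ M * (δ / s) / b ^ 10 := by positivity
  have h9 : 10 ^ 6 / b ^ 10 * M * (δ / s) = 10 ^ 6 * (M * (δ / s) / b ^ 10) := by ring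
  rw [h7] at h6
  rw [h9]
  linarith

end IsoradialGraph

namespace IsoradialGraph

variable {δ : ℝ} {Γ : IsoradialGraph δ} {u v z : ℂ} {b : ℝ}

/-! ### Regularity of the averages -/

/-- A lower bound for the total mass of the averaging kernels. -/
noncomputable def massConst (b : ℝ) : ℝ := b ^ 3 / 128

/-- An upper bound for the averaging kernels and their derivatives. -/
noncomputable def smoothConst (b : ℝ) : ℝ := 10 ^ 6 / b ^ 10

/-- A bound for the first differences of the normalized averages. -/
noncomputable def lipConst (b : ℝ) : ℝ := 2 * smoothConst b / massConst b

/-- A bound for the second differences of the normalized averages. -/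
noncomputable def quadConst (b : ℝ) : ℝ :=
  2 * smoothConst b ^ 2 / massConst b ^ 2 + 2 * smoothConst b / massConst b

theorem massConst_pos (hb : 0 < b) : 0 < massConst b := by rw [massConst]; positivity

theorem smoothConst_pos (hb : 0 < b) : 0 < smoothConst b := by rw [smoothConst]; positivity

theorem lipConst_pos (hb : 0 < b) : 0 < lipConst b := by
  have := massConst_pos hb
  have := smoothConst_pos hb
  rw [lipConst]; positivity

theorem quadConst_pos (hb : 0 < b) : 0 < quadConst b := by
  have := massConst_pos hb
  have := smoothConst_pos hb
  rw [quadConst]; positivity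

theorem le_smoothConst (hb : 0 < b) (hb1 : b ≤ 1) {c : ℝ} (hc : c ≤ 7812) :
    c * (128 / b ^ 8) ≤ smoothConst b := by
  have h2 : b ^ 2 ≤ 1 := pow_le_one₀ hb.le hb1
  rw [smoothConst, mul_div_assoc', div_le_div_iff₀ (by positivity) (by positivity)]
  have e : c * 128 * b ^ 10 = (c * 128 * b ^ 2) * b ^ 8 := by ring
  rw [e]
  refine mul_le_mul_of_nonneg_right ?_ (by positivity)
  have : 0 ≤ b ^ 2 := by positivity
  nlinarith

theorem abs_bump_sub_le {t t' : ℝ} (ht : 0 ≤ t) (ht' : 0 ≤ t') :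
    |bump t' - bump t| ≤ 2 * |t' - t| := by
  have h1 : |max (1 - t') 0 - max (1 - t) 0| ≤ |t' - t| := by
    have := abs_max_sub_max_le_abs (1 - t') (1 - t) 0
    rwa [show 1 - t' - (1 - t) = -(t' - t) by ring, abs_neg] at this
  have e : bump t' - bump t = (max (1 - t') 0 - max (1 - t) 0) *
      (max (1 - t') 0 + max (1 - t) 0) := by rw [bump, bump]; ring
  have h2 : max (1 - t') 0 ≤ 1 := max_le (by linarith) zero_le_one
  have h3 : max (1 - t) 0 ≤ 1 := max_le (by linarith) zero_le_one
  have h4 := le_max_right (1 - t') 0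
  have h5 := le_max_right (1 - t) 0
  rw [e, abs_mul, abs_of_nonneg (add_nonneg h4 h5), mul_comm]
  exact mul_le_mul (by linarith) h1 (abs_nonneg _) (by norm_num)

theorem abs_bump_taylor (t t' : ℝ) :
    |bump t' - bump t - (-2 * max (1 - t) 0) * (t' - t)| ≤ (t' - t) ^ 2 := by
  rw [bump, bump, abs_le]
  rcases le_total t 1 with h | h <;> rcases le_total t' 1 with h' | h'
  · rw [max_eq_left (by linarith), max_eq_left (by linarith)]
    constructor <;> nlinarith [sq_nonneg (t' - t)]
  · rw [max_eq_right (by linarith), max_eq_left (by linarith)]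
    constructor <;> nlinarith [sq_nonneg (t' - t), mul_nonneg (sub_nonneg.2 h) (sub_nonneg.2 h')]
  · rw [max_eq_left (by linarith), max_eq_right (by linarith)]
    constructor <;> nlinarith [sq_nonneg (t' - t), mul_nonneg (sub_nonneg.2 h) (sub_nonneg.2 h')]
  · rw [max_eq_right (by linarith), max_eq_right (by linarith)]
    constructor <;> nlinarith [sq_nonneg (t' - t)]

namespace Regular

variable (h : Γ.Regular b)
include h

/-- The kernel of `smooth` at scale `s` near `x` has bounded mass. -/
theorem abs_sum_weight_le {s M : ℝ} (hs : δ ≤ s) {x : ℂ} {g : ℂ → ℝ}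
    (hg : ∀ u ∈ Γ.vball x (2 * s), |g u| ≤ M) (hM : 0 ≤ M) :
    |∑ u ∈ Γ.vball x (2 * s), Γ.weight u / s ^ 2 * g u| ≤ 128 / b ^ 8 * M := by
  have hs0 : 0 < s := h.mesh_pos.trans_le hs
  have h1 := h.mass_le (x := x) (s := 2 * s) (by linarith)
  calc _ ≤ ∑ u ∈ Γ.vball x (2 * s), Γ.weight u * (M / s ^ 2) := by
        refine (Finset.abs_sum_le_sum_abs _ _).trans (Finset.sum_le_sum fun u hu => ?_)
        have hw := h.weight_nonneg u
        rw [abs_mul, abs_of_nonneg (by positivity)]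
        calc _ ≤ Γ.weight u / s ^ 2 * M := mul_le_mul_of_nonneg_left (hg u hu) (by positivity)
          _ = _ := by ring
    _ ≤ (32 / b ^ 8 * (2 * s) ^ 2) * (M / s ^ 2) := by
        rw [← Finset.sum_mul]
        exact mul_le_mul_of_nonneg_right h1 (by positivity)
    _ = _ := by field_simp; ring

theorem smooth_one_ge {s : ℝ} (hs : 8 * δ ≤ s) (x : ℂ) :
    massConst b ≤ Γ.smooth s (fun _ => 1) x := by
  have hs0 : 0 < s := by linarith [h.mesh_pos]
  have hb := h.pos
  have h1 := h.mass_ge (x := x) (s := s / 2) (by linarith)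
  have hsub : Γ.vball x (s / 2) ⊆ Γ.vball x s := vball_subset (by rw [dist_self]; linarith)
  have hnn : ∀ u, 0 ≤ Γ.weight u / s ^ 2 * bump (dist u x ^ 2 / s ^ 2) * 1 := fun u => by
    have := h.weight_nonneg u
    have := bump_nonneg (dist u x ^ 2 / s ^ 2)
    positivity
  have h2 := Finset.sum_le_sum_of_subset_of_nonneg hsub (fun u _ _ => hnn u)
  have h3 : ∑ u ∈ Γ.vball x (s / 2), Γ.weight u * (9 / 16 / s ^ 2) ≤
      ∑ u ∈ Γ.vball x (s / 2), Γ.weight u / s ^ 2 * bump (dist u x ^ 2 / s ^ 2) * 1 := by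
    refine Finset.sum_le_sum fun u hu => ?_
    have hd := (mem_vball.1 hu).2
    have ht : dist u x ^ 2 / s ^ 2 ≤ 1 / 4 := by
      rw [div_le_iff₀ (by positivity)]
      nlinarith [dist_nonneg (x := u) (y := x)]
    have hbump : 9 / 16 ≤ bump (dist u x ^ 2 / s ^ 2) := by
      rw [bump, max_eq_left (by linarith)]
      nlinarith
    have hw := h.weight_nonneg u
    calc _ = Γ.weight u / s ^ 2 * (9 / 16) := by ring
      _ ≤ Γ.weight u / s ^ 2 * bump (dist u x ^ 2 / s ^ 2) :=
          mul_le_mul_of_nonneg_left hbump (by positivity)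
      _ = _ := by ring
  rw [← Finset.sum_mul] at h3
  have h4 := mul_le_mul_of_nonneg_right h1 (show 0 ≤ 9 / 16 / s ^ 2 by positivity)
  have h5 : b ^ 3 / 16 * (s / 2) ^ 2 * (9 / 16 / s ^ 2) = 9 / 1024 * b ^ 3 := by
    field_simp; ring
  rw [massConst, smooth]
  have : 0 < b ^ 3 := by positivity
  linarith

/-- The difference falls on the kernel, so only the size of `H` matters and not its harmonicity. -/
theorem smooth_translate {s M : ℝ} (hs : δ ≤ s) {x k : ℂ} {H : ℂ → ℝ}
    (hM : ∀ u ∈ Γ.vball x (2 * s), |H u| ≤ M) (hM0 : 0 ≤ M) (hk : ‖k‖ ≤ s) :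
    |Γ.smooth s H (x + k) - Γ.smooth s H x| ≤ smoothConst b * M * (‖k‖ / s) := by
  have hs0 : 0 < s := h.mesh_pos.trans_le hs
  rw [smooth_eq (s := s) (t := 2 * s) (y := x) hs0
      (by rw [dist_eq_norm, add_sub_cancel_left]; linarith),
    smooth_eq (s := s) (t := 2 * s) (y := x) hs0 (by rw [dist_self]; linarith),
    ← Finset.sum_sub_distrib]
  have e : ∀ u, Γ.weight u / s ^ 2 * bump (dist u (x + k) ^ 2 / s ^ 2) * H u -
      Γ.weight u / s ^ 2 * bump (dist u x ^ 2 / s ^ 2) * H u = Γ.weight u / s ^ 2 *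
        ((bump (dist u (x + k) ^ 2 / s ^ 2) - bump (dist u x ^ 2 / s ^ 2)) * H u) := by
    intro u; ring
  rw [Finset.sum_congr rfl fun u _ => e u]
  refine (h.abs_sum_weight_le (M := 10 * (‖k‖ / s) * M) hs (fun u hu => ?_)
    (by positivity)).trans ?_
  · rw [abs_mul]
    refine mul_le_mul ?_ (hM u hu) (abs_nonneg _) (by positivity)
    refine (abs_bump_sub_le (by positivity) (by positivity)).trans ?_
    have h1 : |dist u (x + k) - dist u x| ≤ ‖k‖ := by
      have := abs_dist_sub_le (x + k) x u
      rwa [dist_comm _ u, dist_comm x u, dist_eq_norm (x + k), add_sub_cancel_left] at this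
    have h2 := (mem_vball.1 hu).2
    have h3 : dist u (x + k) ≤ 3 * s := by linarith [(abs_le.1 h1).2]
    rw [← sub_div, abs_div, abs_of_pos (by positivity : 0 < s ^ 2), sq_sub_sq, abs_mul,
      abs_of_nonneg (by positivity)]
    have h4 : (dist u (x + k) + dist u x) * |dist u (x + k) - dist u x| ≤ 5 * s * ‖k‖ :=
      mul_le_mul (by linarith) h1 (abs_nonneg _) (by positivity)
    calc _ ≤ 2 * (5 * s * ‖k‖ / s ^ 2) := by gcongr
      _ = _ := by field_simp; ring
  · have := le_smoothConst h.pos h.le_one (c := 10) (by norm_num)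
    calc _ = 10 * (128 / b ^ 8) * (M * (‖k‖ / s)) := by ring
      _ ≤ smoothConst b * (M * (‖k‖ / s)) := by gcongr
      _ = _ := by ring

theorem smooth_taylor {s M : ℝ} (hs : δ ≤ s) {x : ℂ} {H : ℂ → ℝ}
    (hM : ∀ u ∈ Γ.vball x (2 * s), |H u| ≤ M) (hM0 : 0 ≤ M) :
    ∃ a : ℂ, ‖a‖ ≤ smoothConst b * M / s ∧ ∀ k : ℂ, ‖k‖ ≤ s →
      |Γ.smooth s H (x + k) - Γ.smooth s H x - ip a k| ≤
        smoothConst b * M * (‖k‖ ^ 2 / s ^ 2) := by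
  have hs0 : 0 < s := h.mesh_pos.trans_le hs
  set T := Γ.vball x (2 * s) with hT
  -- Differentiating the kernel in its center `x` gives `c u` times `u - x`; the weighted sum of
  -- these vectors is the gradient `a`.
  set c : ℂ → ℝ := fun u => -2 * max (1 - dist u x ^ 2 / s ^ 2) 0 * (-2 / s ^ 2) * H u with hc
  have hcle : ∀ u ∈ T, |c u| ≤ 4 / s ^ 2 * M := by
    intro u hu
    simp only [hc]
    rw [abs_mul]
    refine mul_le_mul ?_ (hM u hu) (abs_nonneg _) (by positivity)
    have h1 : max (1 - dist u x ^ 2 / s ^ 2) 0 ≤ 1 :=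
      max_le (by linarith [show 0 ≤ dist u x ^ 2 / s ^ 2 by positivity]) zero_le_one
    have h2 := le_max_right (1 - dist u x ^ 2 / s ^ 2) 0
    have e : -2 * max (1 - dist u x ^ 2 / s ^ 2) 0 * (-2 / s ^ 2) =
      max (1 - dist u x ^ 2 / s ^ 2) 0 * (4 / s ^ 2) := by ring
    rw [e, abs_of_nonneg (by positivity)]
    exact mul_le_of_le_one_left (by positivity) h1
  have hip : ∀ a : ℂ → ℂ, ∀ k, ip (∑ u ∈ T, a u) k = ∑ u ∈ T, ip (a u) k := by
    intro a k
    simp only [ip, Complex.re_sum, Complex.im_sum, Finset.sum_mul, Finset.sum_add_distrib]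
  have hips : ∀ (r : ℝ) (a k : ℂ), ip ((r : ℂ) * a) k = r * ip a k := by
    intro r a k; simp [ip]; ring
  refine ⟨∑ u ∈ T, ((Γ.weight u / s ^ 2 * c u : ℝ) : ℂ) * (u - x), ?_, fun k hk => ?_⟩
  · have h1 := h.mass_le (x := x) (s := 2 * s) (by linarith [h.mesh_pos])
    have h2 : ∀ u ∈ T, ‖((Γ.weight u / s ^ 2 * c u : ℝ) : ℂ) * (u - x)‖ ≤
        Γ.weight u * (8 * M / s ^ 3) := by
      intro u hu
      have hw := h.weight_nonneg u
      have hd := (mem_vball.1 hu).2.le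
      rw [norm_mul, Complex.norm_real, Real.norm_eq_abs, abs_mul, ← dist_eq_norm,
        abs_of_nonneg (by positivity)]
      calc _ ≤ Γ.weight u / s ^ 2 * (4 / s ^ 2 * M) * (2 * s) := by
            have := hcle u hu
            gcongr
        _ = _ := by field_simp; ring
    calc _ ≤ ∑ u ∈ T, Γ.weight u * (8 * M / s ^ 3) :=
          (norm_sum_le _ _).trans (Finset.sum_le_sum h2)
      _ ≤ 32 / b ^ 8 * (2 * s) ^ 2 * (8 * M / s ^ 3) := by
          rw [← Finset.sum_mul]; exact mul_le_mul_of_nonneg_right h1 (by positivity)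
      _ = 8 * (128 / b ^ 8) * (M / s) := by field_simp; ring
      _ ≤ smoothConst b * (M / s) := by
          have := le_smoothConst h.pos h.le_one (c := 8) (by norm_num)
          gcongr
      _ = _ := by ring
  · rw [hip, smooth_eq (s := s) (t := 2 * s) (y := x) hs0
      (by rw [dist_eq_norm, add_sub_cancel_left]; linarith),
      smooth_eq (s := s) (t := 2 * s) (y := x) hs0 (by rw [dist_self]; linarith),
      ← Finset.sum_sub_distrib, ← Finset.sum_sub_distrib]
    have e : ∀ u ∈ T, Γ.weight u / s ^ 2 * bump (dist u (x + k) ^ 2 / s ^ 2) * H u -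
        Γ.weight u / s ^ 2 * bump (dist u x ^ 2 / s ^ 2) * H u -
        ip (((Γ.weight u / s ^ 2 * c u : ℝ) : ℂ) * (u - x)) k = Γ.weight u / s ^ 2 *
        ((bump (dist u (x + k) ^ 2 / s ^ 2) - bump (dist u x ^ 2 / s ^ 2) +
          2 * max (1 - dist u x ^ 2 / s ^ 2) 0 * (-2 * ip (u - x) k / s ^ 2)) * H u) := by
      intro u _
      rw [hips]
      simp only [hc]
      ring
    rw [Finset.sum_congr rfl e]
    refine (h.abs_sum_weight_le (M := 27 * (‖k‖ ^ 2 / s ^ 2) * M) hs (fun u hu => ?_)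
      (by positivity)).trans ?_
    · rw [abs_mul]
      refine mul_le_mul ?_ (hM u hu) (abs_nonneg _) (by positivity)
      set t := dist u x ^ 2 / s ^ 2 with ht
      set t' := dist u (x + k) ^ 2 / s ^ 2 with ht'
      have ht0 : 0 ≤ t := by positivity
      have hdt : t' - t = -2 * ip (u - x) k / s ^ 2 + ‖k‖ ^ 2 / s ^ 2 := by
        rw [ht, ht', ← sub_div, ← add_div, dist_eq_norm, dist_eq_norm,
          ← Complex.normSq_eq_norm_sq, ← Complex.normSq_eq_norm_sq, ← Complex.normSq_eq_norm_sq]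
        congr 1
        simp only [Complex.normSq_apply, ip, Complex.sub_re, Complex.sub_im, Complex.add_re,
          Complex.add_im]
        ring
      have hip_le : |-2 * ip (u - x) k / s ^ 2| ≤ 4 * (‖k‖ / s) := by
        have h1 := abs_ip_le (u - x) k
        rw [← dist_eq_norm] at h1
        have h2 := (mem_vball.1 hu).2.le
        rw [abs_div, abs_of_pos (by positivity : 0 < s ^ 2), abs_mul, abs_neg, abs_two]
        calc _ ≤ 2 * (2 * s * ‖k‖) / s ^ 2 := by
              have : dist u x * ‖k‖ ≤ 2 * s * ‖k‖ := by gcongr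
              gcongr
              exact h1.trans this
          _ = _ := by field_simp; ring
      have hks : ‖k‖ / s ≤ 1 := by rw [div_le_one hs0]; exact hk
      have hks0 : 0 ≤ ‖k‖ / s := by positivity
      have hk2 : ‖k‖ ^ 2 / s ^ 2 = (‖k‖ / s) ^ 2 := by rw [div_pow]
      have hdt_le : |t' - t| ≤ 5 * (‖k‖ / s) := by
        rw [hdt]
        refine (abs_add_le _ _).trans ?_
        rw [abs_of_nonneg (by positivity : 0 ≤ ‖k‖ ^ 2 / s ^ 2), hk2]
        nlinarith
      have htay := abs_bump_taylor t t'
      have hsq : (t' - t) ^ 2 ≤ 25 * (‖k‖ ^ 2 / s ^ 2) := by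
        rw [← sq_abs, hk2]
        nlinarith [abs_nonneg (t' - t)]
      have hm1 : max (1 - t) 0 ≤ 1 := max_le (by linarith) zero_le_one
      have hm0 := le_max_right (1 - t) 0
      have e2 : bump t' - bump t + 2 * max (1 - t) 0 * (-2 * ip (u - x) k / s ^ 2) =
          (bump t' - bump t - (-2 * max (1 - t) 0) * (t' - t)) -
            2 * max (1 - t) 0 * (‖k‖ ^ 2 / s ^ 2) := by rw [hdt]; ring
      rw [e2]
      refine (abs_sub _ _).trans ?_
      rw [abs_of_nonneg (by positivity : 0 ≤ 2 * max (1 - t) 0 * (‖k‖ ^ 2 / s ^ 2))]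
      have : 2 * max (1 - t) 0 * (‖k‖ ^ 2 / s ^ 2) ≤ 2 * (‖k‖ ^ 2 / s ^ 2) :=
        mul_le_mul_of_nonneg_right (by linarith) (by positivity)
      linarith
    · have := le_smoothConst h.pos h.le_one (c := 27) (by norm_num)
      calc _ = 27 * (128 / b ^ 8) * (M * (‖k‖ ^ 2 / s ^ 2)) := by ring
        _ ≤ smoothConst b * (M * (‖k‖ ^ 2 / s ^ 2)) := by gcongr
        _ = _ := by ring

end Regular

/-! ### Normalized averages: dependence on scale and center. -/

/-- The normalized average of `H` at scale `s` around `x`. -/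
noncomputable def average (Γ : IsoradialGraph δ) (s : ℝ) (H : ℂ → ℝ) (x : ℂ) : ℝ :=
  Γ.smooth s H x / Γ.smooth s (fun _ => 1) x

theorem smooth_sub_const (s : ℝ) (H : ℂ → ℝ) (c : ℝ) (x : ℂ) :
    Γ.smooth s (fun z => H z - c) x = Γ.smooth s H x - c * Γ.smooth s (fun _ => 1) x := by
  rw [smooth, smooth, smooth, Finset.mul_sum, ← Finset.sum_sub_distrib]
  exact Finset.sum_congr rfl fun u _ => by ring

theorem smooth_neg (s : ℝ) (H : ℂ → ℝ) (x : ℂ) :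
    Γ.smooth s (fun z => -H z) x = -Γ.smooth s H x := by
  rw [smooth, smooth, ← Finset.sum_neg_distrib]
  exact Finset.sum_congr rfl fun u _ => by ring

theorem average_neg (s : ℝ) (H : ℂ → ℝ) (x : ℂ) :
    Γ.average s (fun z => -H z) x = -Γ.average s H x := by
  rw [average, average, smooth_neg, neg_div]

namespace Regular

variable (h : Γ.Regular b)
include h

theorem smooth_one_pos {s : ℝ} (hs : 8 * δ ≤ s) (x : ℂ) : 0 < Γ.smooth s (fun _ => 1) x :=
  (massConst_pos h.pos).trans_le (h.smooth_one_ge hs x)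

theorem le_average {s m : ℝ} (hs : 8 * δ ≤ s) {x : ℂ} {H : ℂ → ℝ}
    (hm : ∀ u ∈ Γ.vball x s, m ≤ H u) : m ≤ Γ.average s H x := by
  rw [average, le_div_iff₀ (h.smooth_one_pos hs x), smooth, smooth, Finset.mul_sum]
  refine Finset.sum_le_sum fun u hu => ?_
  have hw := h.weight_nonneg u
  have hb := bump_nonneg (dist u x ^ 2 / s ^ 2)
  calc _ = Γ.weight u / s ^ 2 * bump (dist u x ^ 2 / s ^ 2) * m := by ring
    _ ≤ _ := mul_le_mul_of_nonneg_left (hm u hu) (by positivity)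

theorem abs_average_le {s M : ℝ} (hs : 8 * δ ≤ s) {x : ℂ} {H : ℂ → ℝ}
    (hM : ∀ u ∈ Γ.vball x s, |H u| ≤ M) : |Γ.average s H x| ≤ M := by
  have h1 := h.le_average hs (m := -M) (H := H) fun u hu => (abs_le.1 (hM u hu)).1
  have h2 := h.le_average hs (m := -M) (H := fun z => -H z) fun u hu => by
    linarith [(abs_le.1 (hM u hu)).2]
  rw [average_neg] at h2
  exact abs_le.2 ⟨h1, by linarith⟩

/-- Quotient rule `P'/Z' - P/Z = ((P' - P) - (P/Z)(Z' - Z)) / Z'`. The total mass `Z` is the average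
of the harmonic function `1`, so it obeys the same estimates as `P`. -/
theorem abs_div_sub_div_le {P P' Z Z' M ε : ℝ} (hZ : 0 < Z) (hZ' : massConst b ≤ Z')
    (hA : |P / Z| ≤ M) (h1 : |P' - P| ≤ smoothConst b * M * ε)
    (h2 : |Z' - Z| ≤ smoothConst b * 1 * ε) : |P' / Z' - P / Z| ≤ lipConst b * M * ε := by
  have hm := massConst_pos h.pos
  have hZ'0 : 0 < Z' := hm.trans_le hZ'
  have hM : 0 ≤ M := (abs_nonneg _).trans hA
  have e : P' / Z' - P / Z = ((P' - P) - P / Z * (Z' - Z)) / Z' := by field_simp; ring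
  rw [e, abs_div, abs_of_pos hZ'0, div_le_iff₀ hZ'0]
  have h3 : |P' - P - P / Z * (Z' - Z)| ≤ 2 * smoothConst b * M * ε := by
    refine (abs_sub _ _).trans ?_
    rw [abs_mul]
    have := mul_le_mul hA h2 (abs_nonneg _) hM
    linarith
  have h4 : 2 * smoothConst b * M * ε = lipConst b * M * ε * massConst b := by
    rw [lipConst]; field_simp
  rw [h4] at h3
  refine h3.trans (mul_le_mul_of_nonneg_left hZ' ?_)
  have h5 : 0 ≤ lipConst b * M * ε * massConst b := (abs_nonneg _).trans h3
  exact nonneg_of_mul_nonneg_left h5 hm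

theorem average_two_mul {s M : ℝ} (hs : 8 * δ ≤ s) {x : ℂ} {H : ℂ → ℝ}
    (hH : ∀ u ∈ Γ.vball x (2 * s), Γ.lap H u = 0) (hM : ∀ u ∈ Γ.vball x (4 * s), |H u| ≤ M)
    (hM0 : 0 ≤ M) :
    |Γ.average (2 * s) H x - Γ.average s H x| ≤ lipConst b * M * (δ / s) := by
  have hδ := h.mesh_pos
  refine h.abs_div_sub_div_le (h.smooth_one_pos hs x) (h.smooth_one_ge (by linarith) x)
    (h.abs_average_le hs fun u hu => hM u ?_)
    (h.smooth_two_mul (by linarith) hH hM hM0)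
    (h.smooth_two_mul (by linarith) (fun u _ => ?_) (fun u _ => by simp) zero_le_one)
  · exact vball_subset (by rw [dist_self]; linarith) hu
  · simp [lap]

/-- The doubling errors are `δ / (2^j s)` for `j < n`; their geometric sum is governed by the
smallest scale, whatever `n` is. -/
theorem average_two_pow {s M : ℝ} (hs : 8 * δ ≤ s) (hM0 : 0 ≤ M) {x : ℂ} {H : ℂ → ℝ} (n : ℕ)
    (hH : ∀ u ∈ Γ.vball x (2 ^ n * s), Γ.lap H u = 0)
    (hM : ∀ u ∈ Γ.vball x (2 * (2 ^ n * s)), |H u| ≤ M) :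
    |Γ.average (2 ^ n * s) H x - Γ.average s H x| ≤
      lipConst b * M * (δ / s) * (2 - 2 / 2 ^ n) := by
  have hδ := h.mesh_pos
  have hs0 : 0 < s := by linarith
  induction n with
  | zero => simp
  | succ n ih =>
    have hp : (1 : ℝ) ≤ 2 ^ n := one_le_pow₀ (by norm_num)
    have hle : 2 ^ n * s ≤ 2 ^ (n + 1) * s := by rw [pow_succ]; nlinarith
    have e : (2 : ℝ) ^ (n + 1) * s = 2 * (2 ^ n * s) := by rw [pow_succ]; ring
    have i := ih (fun u hu => hH u (vball_subset (by rw [dist_self]; linarith) hu))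
      (fun u hu => hM u (vball_subset (by rw [dist_self]; linarith) hu))
    rw [e] at hH hM ⊢
    have j := h.average_two_mul (s := 2 ^ n * s) (x := x) (H := H) (M := M) (by nlinarith) hH
      (by rwa [show 2 * (2 * (2 ^ n * s)) = 4 * (2 ^ n * s) by ring] at hM) hM0
    calc _ ≤ _ := abs_sub_le _ (Γ.average (2 ^ n * s) H x) _
      _ ≤ _ := add_le_add j i
      _ = _ := by
        rw [pow_succ]; field_simp; ring

theorem average_translate {s M : ℝ} (hs : 8 * δ ≤ s) {x k : ℂ} {H : ℂ → ℝ}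
    (hM : ∀ u ∈ Γ.vball x (2 * s), |H u| ≤ M) (hM0 : 0 ≤ M) (hk : ‖k‖ ≤ s) :
    |Γ.average s H (x + k) - Γ.average s H x| ≤ lipConst b * M * (‖k‖ / s) := by
  have hδ := h.mesh_pos
  refine h.abs_div_sub_div_le (h.smooth_one_pos hs x) (h.smooth_one_ge hs _)
    (h.abs_average_le hs fun u hu => hM u ?_)
    (h.smooth_translate (by linarith) hM hM0 hk)
    (h.smooth_translate (by linarith) (fun u _ => by simp) zero_le_one hk)
  exact vball_subset (by rw [dist_self]; linarith) hu

/-- Averages are approximated by affine functions to the second order. -/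
theorem average_taylor {s M : ℝ} (hs : 8 * δ ≤ s) {x : ℂ} {H : ℂ → ℝ}
    (hM : ∀ u ∈ Γ.vball x (2 * s), |H u| ≤ M) (hM0 : 0 ≤ M) :
    ∃ a : ℂ, ‖a‖ ≤ lipConst b * M / s ∧ ∀ k : ℂ, ‖k‖ ≤ s →
      |Γ.average s H (x + k) - Γ.average s H x - ip a k| ≤
        quadConst b * M * (‖k‖ ^ 2 / s ^ 2) := by
  have hδ := h.mesh_pos
  have hs0 : 0 < s := by linarith
  have hm := massConst_pos h.pos
  have hc := smoothConst_pos h.pos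
  -- After subtracting `A` the numerator vanishes at `x`, so the variation of the denominator enters
  -- only in second order.
  set A := Γ.average s H x with hA
  have hAM : |A| ≤ M := h.abs_average_le hs fun u hu =>
    hM u (vball_subset (by rw [dist_self]; linarith) hu)
  have hM' : ∀ u ∈ Γ.vball x (2 * s), |H u - A| ≤ 2 * M := fun u hu =>
    (abs_sub _ _).trans (by linarith [hM u hu])
  obtain ⟨a, ha, hak⟩ := h.smooth_taylor (by linarith) hM' (by linarith)
  have hZ : ∀ y, massConst b ≤ Γ.smooth s (fun _ => 1) y := h.smooth_one_ge hs
  set Z := Γ.smooth s (fun _ => 1) x with hZd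
  have hZ0 : 0 < Z := h.smooth_one_pos hs x
  have hP0 : Γ.smooth s (fun z => H z - A) x = 0 := by
    rw [smooth_sub_const, hA, average, div_mul_cancel₀ _ hZ0.ne', sub_self]
  refine ⟨((1 / Z : ℝ) : ℂ) * a, ?_, fun k hk => ?_⟩
  · rw [norm_mul, Complex.norm_real, Real.norm_eq_abs, abs_of_pos (by positivity)]
    calc _ ≤ 1 / massConst b * (smoothConst b * (2 * M) / s) := by
          gcongr
          exact hZ x
      _ = _ := by rw [lipConst]; field_simp
  · have hips : ip (((1 / Z : ℝ) : ℂ) * a) k = 1 / Z * ip a k := by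
      simp [ip]; ring
    set Z' := Γ.smooth s (fun _ => 1) (x + k) with hZ'd
    set P' := Γ.smooth s (fun z => H z - A) (x + k) with hP'd
    have hZ'0 : 0 < Z' := h.smooth_one_pos hs _
    have e1 : Γ.average s H (x + k) - A = P' / Z' := by
      rw [hP'd, smooth_sub_const, average, ← hZ'd]; field_simp
    have h1 := hak k hk
    rw [hP0, sub_zero] at h1
    have h2 := h.smooth_translate (by linarith) hM' (by linarith) hk
    rw [hP0, sub_zero] at h2
    have h3 := h.smooth_translate (s := s) (x := x) (k := k) (H := fun _ => (1 : ℝ)) (M := 1)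
      (by linarith) (fun u _ => by simp) zero_le_one hk
    rw [e1, hips]
    have e2 : P' / Z' - 1 / Z * ip a k = (P' - ip a k) / Z - P' * (Z' - Z) / (Z' * Z) := by
      field_simp; ring
    rw [e2]
    refine (abs_sub _ _).trans ?_
    have h4 : |(P' - ip a k) / Z| ≤ smoothConst b * (2 * M) * (‖k‖ ^ 2 / s ^ 2) / massConst b := by
      rw [abs_div, abs_of_pos hZ0]
      exact div_le_div₀ (by positivity) h1 hm (hZ x)
    have h5 : |P' * (Z' - Z) / (Z' * Z)| ≤ (smoothConst b * (2 * M) * (‖k‖ / s)) *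
        (smoothConst b * 1 * (‖k‖ / s)) / (massConst b * massConst b) := by
      rw [abs_div, abs_mul, abs_of_pos (mul_pos hZ'0 hZ0)]
      exact div_le_div₀ (by positivity) (mul_le_mul h2 h3 (abs_nonneg _) (by positivity))
        (by positivity) (mul_le_mul (hZ _) (hZ _) hm.le hZ'0.le)
    refine (add_le_add h4 h5).trans (le_of_eq ?_)
    rw [quadConst]
    field_simp
    ring

end Regular

end IsoradialGraph

namespace IsoradialGraph

variable {δ : ℝ} {Γ : IsoradialGraph δ} {u v z : ℂ} {b : ℝ}

/-! ### Harnack's inequality along paths -/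

/-- The constant in Harnack's inequality for adjacent vertices. -/
noncomputable def stepConst (b : ℝ) : ℝ := 8 / b ^ 7

theorem one_le_stepConst (hb : 0 < b) (hb1 : b ≤ 1) : 1 ≤ stepConst b := by
  rw [stepConst, one_le_div (by positivity)]
  linarith [pow_le_one₀ (n := 7) hb.le hb1]

namespace Regular

variable (h : Γ.Regular b)
include h

/-- By the mean value property `tan θ * P v ≤ (∑ tan θ) * P u`, where `tan θ ≥ b` and the sum is at
most `8 / b ^ 6`. -/
theorem harnack_step {P : ℂ → ℝ} (huv : Γ.graph.Adj u v) (hP : Γ.lap P u = 0) (hPu : 0 ≤ P u)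
    (hpos : ∀ z, Γ.graph.Adj u z → 0 ≤ P z) : P v ≤ stepConst b * P u := by
  have hb := h.pos
  have hδ := h.mesh_pos
  have e : ∑ z ∈ Γ.nbrs u, Real.tan (Γ.halfAngle u z) * P z =
      (∑ z ∈ Γ.nbrs u, Real.tan (Γ.halfAngle u z)) * P u := by
    rw [Finset.sum_mul, ← sub_eq_zero, ← Finset.sum_sub_distrib, ← hP, lap]
    exact Finset.sum_congr rfl fun z _ => by ring
  have h1 : Real.tan (Γ.halfAngle u v) * P v ≤
      ∑ z ∈ Γ.nbrs u, Real.tan (Γ.halfAngle u z) * P z :=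
    Finset.single_le_sum (f := fun z => Real.tan (Γ.halfAngle u z) * P z)
      (fun z hz => mul_nonneg (h.tan_pos (mem_nbrs.1 hz)).le (hpos z (mem_nbrs.1 hz)))
      (mem_nbrs.2 huv)
  have h2 : b * P v ≤ Real.tan (Γ.halfAngle u v) * P v :=
    mul_le_mul_of_nonneg_right (h.fat u v huv).2 (hpos v huv)
  have h3 : (∑ z ∈ Γ.nbrs u, Real.tan (Γ.halfAngle u z)) ≤ 8 / b ^ 6 := by
    rw [le_div_iff₀ (by positivity)]
    have h4 := h.sum_tan_le u
    have h5 := h.weight_le u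
    have h6 := mul_le_mul_of_nonneg_right h4 (show 0 ≤ b ^ 4 by positivity)
    have h7 : ((∑ z ∈ Γ.nbrs u, Real.tan (Γ.halfAngle u z)) * b ^ 6) * δ ^ 2 ≤ 8 * δ ^ 2 := by
      calc _ = (∑ z ∈ Γ.nbrs u, Real.tan (Γ.halfAngle u z)) * (δ ^ 2 * b ^ 2) * b ^ 4 := by ring
        _ ≤ _ := h6.trans h5
    exact le_of_mul_le_mul_right h7 (by positivity)
  have h4 : b * P v ≤ 8 / b ^ 6 * P u := by
    rw [e] at h1
    exact (h2.trans h1).trans (mul_le_mul_of_nonneg_right h3 hPu)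
  have h5 : 8 / b ^ 6 * P u = b * (stepConst b * P u) := by
    rw [stepConst]; field_simp
  rw [h5] at h4
  exact le_of_mul_le_mul_left h4 hb

theorem harnack_walk {P : ℂ → ℝ} {x : ℂ} {s : ℝ} (hP : ∀ u ∈ Γ.vball x s, Γ.lap P u = 0)
    (hpos : ∀ u ∈ Γ.vball x (s + 2 * δ), 0 ≤ P u)
    {y z : ↥(Γ.vertices ∩ Metric.ball x s)} (p : (Γ.inside (Metric.ball x s)).Walk y z) :
    P z ≤ stepConst b ^ p.length * P y := by
  have hδ := h.mesh_pos
  have hnn : 0 ≤ stepConst b := zero_le_one.trans (one_le_stepConst h.pos h.le_one)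
  induction p with
  | nil => simp
  | @cons a c d hac q ih =>
    have hd : dist (a : ℂ) x < s := a.2.2
    have h1 : P c ≤ stepConst b * P a := by
      refine h.harnack_step hac.1 (hP a (mem_vball.2 ⟨a.2.1, hd⟩))
        (hpos a (mem_vball.2 ⟨a.2.1, by linarith⟩)) fun w hw => hpos w (mem_vball.2
          ⟨Adj.mem_vertices hw, ?_⟩)
      have := Adj.dist_le hw
      linarith [dist_triangle_left w x (a : ℂ)]
    rw [SimpleGraph.Walk.length_cons, pow_succ, mul_assoc]
    exact ih.trans (mul_le_mul_of_nonneg_left h1 (by positivity))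

/-- Harnack's inequality in a disc whose radius is a bounded multiple of the mesh. -/
theorem harnack {P : ℂ → ℝ} {x y : ℂ} {L : ℝ} (hL : 0 < L) {N : ℕ}
    (hN : ((L + 3) / b ^ 2) ^ 2 ≤ N)
    (hP : ∀ u ∈ Γ.vball x ((L + 4) * δ), Γ.lap P u = 0)
    (hpos : ∀ u ∈ Γ.vball x ((L + 4) * δ), 0 ≤ P u) (hx : x ∈ Γ.vertices)
    (hy : y ∈ Γ.vball x (L * δ)) : P y ≤ stepConst b ^ N * P x := by
  have hδ := h.mesh_pos
  have hb := h.pos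
  set s := (L + 2) * δ with hs
  have hy' := mem_vball.1 hy
  have hLδ : 0 < L * δ := by positivity
  have hxm : x ∈ Γ.vertices ∩ Metric.ball x s := ⟨hx, by simp [hs]; positivity⟩
  have hym : y ∈ Γ.vertices ∩ Metric.ball x s :=
    ⟨hy'.1, by rw [Metric.mem_ball]; linarith [hy'.2, show s = L * δ + 2 * δ by rw [hs]; ring]⟩
  have hreach := inside_reachable_ball (Γ := Γ) hδ (c := x) (s := L * δ) (s' := s)
    (by rw [hs]; linarith) (by simpa using hLδ) hy'.2 hxm hym
  -- A path visits each vertex at most once, so its length is bounded by the number of vertices in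
  -- the disc.
  obtain ⟨p, hp⟩ := hreach.exists_isPath
  have : Fintype ↥(Γ.vertices ∩ Metric.ball x s) := (Γ.finite_vertices_ball x s).fintype
  have hlen := hp.length_lt
  have hcard : Fintype.card ↥(Γ.vertices ∩ Metric.ball x s) = (Γ.vball x s).card := by
    rw [vball, Set.Finite.card_toFinset]
  have hcl := h.card_vball_le (x := x) (s := s) (by positivity)
  have hb2 : b ^ 2 ≤ 1 := pow_le_one₀ hb.le h.le_one
  have h1 : ((Γ.vball x s).card : ℝ) ≤ N := by
    refine le_trans ?_ hN
    rw [div_pow, le_div_iff₀ (by positivity)]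
    have h2 : (s + δ * b ^ 2) ^ 2 ≤ ((L + 3) * δ) ^ 2 :=
      pow_le_pow_left₀ (by positivity) (by rw [hs]; nlinarith) 2
    have h3 : ((Γ.vball x s).card * (b ^ 2) ^ 2) * δ ^ 2 ≤ (L + 3) ^ 2 * δ ^ 2 := by
      calc _ = (Γ.vball x s).card * (δ * b ^ 2) ^ 2 := by ring
        _ ≤ _ := hcl.trans h2
        _ = _ := by ring
    exact le_of_mul_le_mul_right h3 (by positivity)
  have h2 : p.length ≤ N := by
    rw [hcard] at hlen
    have : (Γ.vball x s).card ≤ N := by exact_mod_cast h1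
    omega
  have h3 := h.harnack_walk (P := P) (x := x) (s := s)
    (fun u hu => hP u (vball_subset (by rw [dist_self, hs]; nlinarith) hu))
    (fun u hu => hpos u (vball_subset (by rw [dist_self, hs]; nlinarith) hu)) p
  refine h3.trans (mul_le_mul_of_nonneg_right ?_
    (hpos x (mem_vball.2 ⟨hx, by rw [dist_self]; positivity⟩)))
  exact pow_le_pow_right₀ (one_le_stepConst hb h.le_one) h2

end Regular

/-! ### Discrete harmonic functions are close to their averages -/

/-- `H` is discrete harmonic and bounded by `M` in a disc. -/
def HarmonicBdd (Γ : IsoradialGraph δ) (H : ℂ → ℝ) (x : ℂ) (ρ M : ℝ) : Prop :=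
  ∀ u ∈ Γ.vball x ρ, Γ.lap H u = 0 ∧ |H u| ≤ M

theorem HarmonicBdd.neg {H : ℂ → ℝ} {x : ℂ} {ρ M : ℝ} (hH : Γ.HarmonicBdd H x ρ M) :
    Γ.HarmonicBdd (fun z => -H z) x ρ M := fun u hu =>
  ⟨by rw [lap_neg, (hH u hu).1, neg_zero], by rw [abs_neg]; exact (hH u hu).2⟩

theorem lap_const_sub (c : ℝ) (H : ℂ → ℝ) (u : ℂ) :
    Γ.lap (fun z => c - H z) u = -Γ.lap H u := by
  rw [lap, lap, ← Finset.sum_neg_distrib]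
  exact Finset.sum_congr rfl fun v _ => by ring

/-- If `H` almost attains an upper bound for its deviation from its average at the scale `s`, then
this bound is small. -/
theorem Regular.bound_of_near_max (h : Γ.Regular b) {ε L ε₁ M s B : ℝ} {N n : ℕ} {x : ℂ}
    {H : ℂ → ℝ} (hM : 0 ≤ M) (hL : 8 ≤ L) (hLε : 8 * lipConst b ≤ ε * L)
    (hN : ((L + 3) / b ^ 2) ^ 2 ≤ N) (hε₁ : ε₁ * (8 * stepConst b ^ N) = ε)
    (hs : s = 2 ^ n * (L * δ)) (hsd : (L + 4) * δ ≤ s)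
    (hlip : lipConst b * ((L + 4) * δ) ≤ ε₁ * s)
    (hH : Γ.HarmonicBdd H x (2 * s) M) (hx : x ∈ Γ.vertices)
    (hB : ∀ y ∈ Γ.vball x ((L + 4) * δ), H y - Γ.average s H y ≤ B)
    (hnear : B - ε₁ * M ≤ H x - Γ.average s H x) : B + ε₁ * M ≤ ε / 2 * M := by
  have hδ := h.mesh_pos
  have hd0 : 0 < (L + 4) * δ := by positivity
  have hs0 : 0 < s := by linarith
  have hLδ : 8 * δ ≤ L * δ := mul_le_mul_of_nonneg_right hL hδ.le
  have h8 : 8 * δ ≤ s := by linarith [show (L + 4) * δ = L * δ + 4 * δ by ring]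
  set A := Γ.average s H x with hA
  have hlipA : ∀ y ∈ Γ.vball x ((L + 4) * δ), Γ.average s H y ≤ A + ε₁ * M := by
    intro y hy
    have hy' := mem_vball.1 hy
    have hn : ‖y - x‖ ≤ (L + 4) * δ := by rw [← dist_eq_norm]; exact hy'.2.le
    have h1 := h.average_translate (s := s) (x := x) (k := y - x) (H := H) (M := M) h8
      (fun u hu => (hH u hu).2) hM (hn.trans hsd)
    rw [add_sub_cancel] at h1
    have h2 : lipConst b * M * (‖y - x‖ / s) ≤ ε₁ * M := by
      have hc := lipConst_pos h.pos
      calc _ ≤ lipConst b * M * ((L + 4) * δ / s) := by gcongr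
        _ = lipConst b * ((L + 4) * δ) / s * M := by ring
        _ ≤ ε₁ * M := by
          refine mul_le_mul_of_nonneg_right ?_ hM
          rwa [div_le_iff₀ hs0]
    linarith [(abs_le.1 h1).2]
  -- Nonnegative and harmonic near `x`, with `P x ≤ 2 ε₁ M`. Harnack makes `H ≥ A + ε₁ M + B - ε M /
  -- 4` on the disc of radius `L δ`; the average at scale `L δ` inherits this, and passing to scale
  -- `s` costs another `ε M / 4`.
  set P : ℂ → ℝ := fun y => (A + ε₁ * M + B) - H y with hP
  have hPx : P x ≤ 2 * (ε₁ * M) := by simp only [hP]; linarith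
  have hharn : ∀ y ∈ Γ.vball x (L * δ), P y ≤ ε / 4 * M := by
    intro y hy
    have h1 := h.harnack (P := P) (x := x) (y := y) (L := L) (by linarith) hN
      (fun u hu => by
        rw [hP, lap_const_sub, (hH u (vball_subset (by rw [dist_self]; linarith) hu)).1, neg_zero])
      (fun u hu => by simp only [hP]; linarith [hB u hu, hlipA u hu]) hx hy
    have h2 : 0 ≤ stepConst b ^ N :=
      pow_nonneg (zero_le_one.trans (one_le_stepConst h.pos h.le_one)) _
    have h3 := mul_le_mul_of_nonneg_left hPx h2
    have h4 : stepConst b ^ N * (2 * (ε₁ * M)) = ε / 4 * M := by rw [← hε₁]; ring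
    linarith
  have hlow : A + ε₁ * M + B - ε / 4 * M ≤ Γ.average (L * δ) H x :=
    h.le_average hLδ fun y hy => by
      have := hharn y hy
      simp only [hP] at this
      linarith
  have hscale := h.average_two_pow (s := L * δ) (x := x) (H := H) hLδ hM n
    (fun u hu => (hH u (vball_subset (by rw [dist_self, ← hs]; linarith) hu)).1)
    (fun u hu => (hH u (by rwa [← hs] at hu)).2)
  rw [← hs] at hscale
  have hsc : lipConst b * M * (δ / (L * δ)) * (2 - 2 / 2 ^ n) ≤ ε / 4 * M := by
    have hc := lipConst_pos h.pos
    have e : lipConst b * M * (δ / (L * δ)) = lipConst b / L * M := by field_simp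
    have h1 : lipConst b / L ≤ ε / 8 := by
      rw [div_le_iff₀ (by linarith)]; linarith
    have h2 : (0 : ℝ) ≤ 2 / 2 ^ n := by positivity
    rw [e]
    have h3 : lipConst b / L * M ≤ ε / 8 * M := mul_le_mul_of_nonneg_right h1 hM
    have h4 : 0 ≤ lipConst b / L * M := by positivity
    nlinarith [mul_nonneg h4 h2]
  linarith [(abs_le.1 hscale).1]

/-- At a scale which is a large multiple of the mesh, a discrete harmonic function is close to its
averages. -/
theorem exists_sub_average_le (hb : 0 < b) (hb1 : b ≤ 1) {ε : ℝ} (hε : 0 < ε) :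
    ∃ L K : ℝ, 8 ≤ L ∧ L ≤ K ∧ ∀ {δ : ℝ} {Γ : IsoradialGraph δ} (_ : Γ.Regular b) {H : ℂ → ℝ}
      {x₀ : ℂ} {ρ M s : ℝ} {n : ℕ} (_ : 0 ≤ M) (_ : s = 2 ^ n * (L * δ)) (_ : K * δ ≤ s)
      (_ : 8 * s ≤ ρ) (_ : Γ.HarmonicBdd H x₀ ρ M),
      ∀ x ∈ Γ.vball x₀ (ρ / 4), |H x - Γ.average s H x| ≤ ε * M := by
  have hc := lipConst_pos hb
  have hΛ := one_le_stepConst hb hb1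
  -- `L` makes the change of scale cost at most `ε / 4`, `N` bounds Harnack chains at that scale,
  -- `ε₁` is what `N` Harnack steps can amplify to `ε / 4`, and `m ε₁ ≥ 2` counts the improvements
  -- needed to exhaust the crude bound `2M`. `K` leaves room for `m` shrinkings and makes the
  -- average nearly constant on discs of radius `(L + 4) δ`.
  set L := max 8 (8 * lipConst b / ε) with hLdef
  have hL : 8 ≤ L := le_max_left _ _
  have hLε : 8 * lipConst b ≤ ε * L := by
    have : 8 * lipConst b / ε ≤ L := le_max_right _ _
    rw [div_le_iff₀ hε] at this
    linarith
  obtain ⟨N, hN⟩ := exists_nat_ge (((L + 3) / b ^ 2) ^ 2)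
  set ε₁ := ε / (8 * stepConst b ^ N) with hε₁def
  have hΛN : 0 < stepConst b ^ N := by positivity
  have hε₁0 : 0 < ε₁ := by positivity
  have hε₁ : ε₁ * (8 * stepConst b ^ N) = ε := by rw [hε₁def]; field_simp
  obtain ⟨m, hm⟩ := exists_nat_ge (2 / ε₁)
  rw [div_le_iff₀ hε₁0] at hm
  set K := max (max (L + 4) (m * (L + 4))) (lipConst b * (L + 4) / ε₁) with hKdef
  have hK1 : L + 4 ≤ K := (le_max_left _ _).trans (le_max_left _ _)
  have hK2 : m * (L + 4) ≤ K := (le_max_right _ _).trans (le_max_left _ _)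
  have hK3 : lipConst b * (L + 4) ≤ ε₁ * K := by
    have : lipConst b * (L + 4) / ε₁ ≤ K := le_max_right _ _
    rw [div_le_iff₀ hε₁0] at this
    linarith
  refine ⟨L, K, hL, by linarith, ?_⟩
  intro δ Γ h H x₀ ρ M s n hM hs hKs hsρ hH
  have hδ := h.mesh_pos
  set d := (L + 4) * δ with hd
  have hd0 : 0 < d := by positivity
  have hsd : d ≤ s := (mul_le_mul_of_nonneg_right hK1 hδ.le).trans hKs
  have hmd : m * d ≤ s := by
    have := mul_le_mul_of_nonneg_right hK2 hδ.le
    rw [hd]; linarith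
  have hlip : lipConst b * d ≤ ε₁ * s := by
    have h1 := mul_le_mul_of_nonneg_right hK3 hδ.le
    have h2 := mul_le_mul_of_nonneg_left hKs hε₁0.le
    rw [hd]; linarith
  have h8 : 8 * δ ≤ s := by nlinarith
  suffices key : ∀ H : ℂ → ℝ, Γ.HarmonicBdd H x₀ ρ M →
      ∀ x ∈ Γ.vball x₀ (ρ / 4), H x - Γ.average s H x ≤ ε * M by
    intro x hx
    have h1 := key H hH x hx
    have h2 := key _ hH.neg x hx
    rw [average_neg] at h2
    exact abs_le.2 ⟨by linarith, h1⟩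
  intro H hH
  have hsub : ∀ x, dist x x₀ < ρ / 4 + s → Γ.HarmonicBdd H x (2 * s) M := fun x hx u hu =>
    hH u (vball_subset (by linarith) hu)
  -- Each shrinking of the disc by `d` improves the bound by `ε₁ M`. A point violating the
  -- improvement is nearly maximal for the previous bound `B`, so `bound_of_near_max` gives `B + ε₁
  -- M ≤ ε M / 2`, against `B ≥ ε M`.
  have hind : ∀ j : ℕ, j ≤ m → ∀ x ∈ Γ.vball x₀ (ρ / 4 + ((m : ℝ) - j) * d),
      H x - Γ.average s H x ≤ max ε (2 - j * ε₁) * M := by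
    have hrad : ∀ j : ℕ, j ≤ m → ((m : ℝ) - j) * d ≤ s := by
      intro j hj
      have : 0 ≤ (j : ℝ) * d := by positivity
      linarith
    have hcrude : ∀ x ∈ Γ.vball x₀ (ρ / 4 + s), H x - Γ.average s H x ≤ 2 * M := by
      intro x hx
      have hx' := mem_vball.1 hx
      have hb' := hsub x hx'.2
      have h1 := (hb' x (mem_vball.2 ⟨hx'.1, by rw [dist_self]; linarith⟩)).2
      have h2 := h.abs_average_le (s := s) (x := x) (H := H) (M := M) h8 fun u hu =>
        (hb' u (vball_subset (by rw [dist_self]; linarith) hu)).2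
      linarith [(abs_le.1 h1).2, (abs_le.1 h2).1]
    intro j
    induction j with
    | zero =>
      intro hj x hx
      have h1 := hcrude x (vball_subset (by rw [dist_self]; linarith [hrad 0 hj]) hx)
      refine h1.trans (mul_le_mul_of_nonneg_right ?_ hM)
      simp
    | succ j ih =>
      intro hj x hx
      have ih := ih (by omega)
      by_contra hcon
      push Not at hcon
      set B := max ε (2 - j * ε₁) * M with hB
      have hx' := mem_vball.1 hx
      have hr := hrad (j + 1) hj
      have hmax : max ε (2 - j * ε₁) ≤ max ε (2 - ((j + 1 : ℕ) : ℝ) * ε₁) + ε₁ := by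
        push_cast
        refine max_le ?_ ?_
        · linarith [le_max_left ε (2 - ((j : ℝ) + 1) * ε₁)]
        · linarith [le_max_right ε (2 - ((j : ℝ) + 1) * ε₁)]
      have hmaxM := mul_le_mul_of_nonneg_right hmax hM
      have hBε : ε * M ≤ B := mul_le_mul_of_nonneg_right (le_max_left _ _) hM
      have hres := h.bound_of_near_max (B := B) hM hL hLε hN hε₁ hs hsd hlip
        (hsub x (by linarith [hx'.2])) hx'.1 (fun y hy => ih y (vball_subset (by
          push_cast at hx'
          linarith [hx'.2]) hy)) (by linarith)
      have hM0 : M = 0 := by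
        by_contra hne
        have : 0 < M := lt_of_le_of_ne hM (Ne.symm hne)
        nlinarith [mul_pos hε this, mul_pos hε₁0 this]
      have h1 := hcrude x (vball_subset (by rw [dist_self]; linarith) hx)
      rw [hM0] at h1 hcon
      linarith
  intro x hx
  have := hind m le_rfl x (by rwa [sub_self, zero_mul, add_zero])
  rwa [max_eq_left (by linarith)] at this

end IsoradialGraph

namespace IsoradialGraph

variable {δ : ℝ} {Γ : IsoradialGraph δ} {u v z : ℂ} {b : ℝ}

/-! ### Lipschitz regularity of discrete harmonic functions -/

/-- `H` is close to its average at a scale between `ρ / 16` and `ρ / 8`, and that average is affine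
up to a quadratic error. Shrinking the disc by `κ` thus shrinks the error by `κ / 2`, a gain of a
factor `2` over linear scaling, which makes the iteration converge. -/
theorem exists_affine_approx (hb : 0 < b) (hb1 : b ≤ 1) :
    ∃ κ K C : ℝ, 0 < κ ∧ κ ≤ 1 / 16 ∧ 0 < K ∧ 0 < C ∧
      ∀ {δ : ℝ} {Γ : IsoradialGraph δ} (_ : Γ.Regular b) {H : ℂ → ℝ} {x₀ : ℂ} {ρ M : ℝ}
        (_ : 0 ≤ M) (_ : K * δ ≤ ρ) (_ : Γ.HarmonicBdd H x₀ ρ M),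
        ∃ (c : ℝ) (a : ℂ), ‖a‖ ≤ C * M / ρ ∧
          ∀ u ∈ Γ.vball x₀ (κ * ρ), |H u - (c + ip a (u - x₀))| ≤ κ / 2 * M := by
  have hQ := quadConst_pos hb
  have hl := lipConst_pos hb
  -- Makes the quadratic error `256 κ² quadConst b` at most `κ / 4`; the distance to the average
  -- takes the other `κ / 4`.
  set κ := min (1 / 16) (1 / (1024 * quadConst b)) with hκ
  have hκ0 : 0 < κ := by positivity
  have hκ1 : κ ≤ 1 / 16 := min_le_left _ _
  have hκ2 : κ * (1024 * quadConst b) ≤ 1 := by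
    have : κ ≤ 1 / (1024 * quadConst b) := min_le_right _ _
    rwa [le_div_iff₀ (by positivity)] at this
  obtain ⟨L, K, hL, hLK, hosc⟩ := exists_sub_average_le hb hb1 (ε := κ / 4) (by positivity)
  refine ⟨κ, 16 * K, 16 * lipConst b, hκ0, hκ1, by linarith, by positivity, ?_⟩
  intro δ Γ h H x₀ ρ M hM hKρ hH
  have hδ := h.mesh_pos
  have hK0 : 8 ≤ K := hL.trans hLK
  have hLδ : 0 < L * δ := by positivity
  have hLKδ : L * δ ≤ K * δ := mul_le_mul_of_nonneg_right hLK hδ.le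
  have hKδ : 0 < K * δ := by positivity
  obtain ⟨n, hn1, hn2⟩ := exists_nat_pow_near (x := ρ / (8 * (L * δ))) (y := (2 : ℝ))
    (by rw [one_le_div (by positivity)]; linarith) one_lt_two
  rw [le_div_iff₀ (by positivity)] at hn1
  rw [div_lt_iff₀ (by positivity), pow_succ] at hn2
  set s := 2 ^ n * (L * δ) with hs
  have hs1 : 8 * s ≤ ρ := by linarith
  have hs2 : ρ ≤ 16 * s := by linarith
  have hs0 : 0 < s := by positivity
  have hρ0 : 0 < ρ := by linarith
  have hKs : K * δ ≤ s := by linarith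
  have h8 : 8 * δ ≤ s := by nlinarith
  obtain ⟨a, ha, hak⟩ := h.average_taylor (s := s) (x := x₀) (H := H) (M := M) h8
    (fun u hu => (hH u (vball_subset (by rw [dist_self]; linarith) hu)).2) hM
  refine ⟨Γ.average s H x₀, a, ?_, fun u hu => ?_⟩
  · refine ha.trans ?_
    rw [div_le_div_iff₀ hs0 hρ0]
    have : 0 ≤ lipConst b * M := by positivity
    nlinarith
  · have hu' := mem_vball.1 hu
    have h1 := hosc h hM hs hKs hs1 hH u (vball_subset (by rw [dist_self]; nlinarith) hu)
    have hnorm : ‖u - x₀‖ ≤ κ * ρ := by rw [← dist_eq_norm]; exact hu'.2.le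
    have h2 := hak (u - x₀) (by nlinarith)
    rw [add_sub_cancel] at h2
    have h3 : quadConst b * M * (‖u - x₀‖ ^ 2 / s ^ 2) ≤ κ / 4 * M := by
      have h4 : ‖u - x₀‖ ^ 2 / s ^ 2 ≤ 256 * κ ^ 2 := by
        rw [div_le_iff₀ (by positivity)]
        calc ‖u - x₀‖ ^ 2 ≤ (κ * (16 * s)) ^ 2 := by
              refine pow_le_pow_left₀ (norm_nonneg _) (hnorm.trans ?_) 2
              gcongr
          _ = _ := by ring
      have h5 : 0 ≤ quadConst b * M := by positivity
      have h6 := mul_le_mul_of_nonneg_left h4 h5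
      have h7 := mul_le_mul_of_nonneg_right hκ2 (show 0 ≤ κ / 4 * M by positivity)
      linarith
    have e : H u - (Γ.average s H x₀ + ip a (u - x₀)) = (H u - Γ.average s H u) +
        (Γ.average s H u - Γ.average s H x₀ - ip a (u - x₀)) := by ring
    rw [e]
    exact (abs_add_le _ _).trans (by linarith)

theorem HarmonicBdd.sub_affine {H : ℂ → ℝ} {x : ℂ} {ρ κ M M' c : ℝ} {a : ℂ} (hδ : 0 < δ)
    (hρ : 0 ≤ ρ) (hκ : κ ≤ 1) (hH : Γ.HarmonicBdd H x ρ M)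
    (hb : ∀ u ∈ Γ.vball x (κ * ρ), |H u - (c + ip a (u - x))| ≤ M') :
    Γ.HarmonicBdd (fun z => H z - (c + ip a (z - x))) x (κ * ρ) M' := fun u hu =>
  ⟨by rw [lap_sub, (hH u (vball_subset (by rw [dist_self]; nlinarith) hu)).1, lap_affine hδ,
      sub_zero], hb u hu⟩

/-- Discrete harmonic functions are Lipschitz on scales larger than the mesh. -/
theorem exists_lipschitz (hb : 0 < b) (hb1 : b ≤ 1) :
    ∃ C : ℝ, 0 < C ∧ ∀ {δ : ℝ} {Γ : IsoradialGraph δ} (_ : Γ.Regular b) {H : ℂ → ℝ} {x₀ : ℂ}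
      {ρ M : ℝ} (_ : 0 ≤ M) (_ : 0 < ρ) (_ : x₀ ∈ Γ.vertices) (_ : Γ.HarmonicBdd H x₀ ρ M),
      ∀ u ∈ Γ.vball x₀ ρ, |H u - H x₀| ≤ C * M * (max (dist u x₀) δ / ρ) := by
  obtain ⟨κ, K, C₁, hκ0, hκ1, hK, hC₁, happ⟩ := exists_affine_approx hb hb1
  set C := max (2 * C₁) (max (2 * K) (2 / κ)) with hC
  have hCC₁ : 2 * C₁ ≤ C := le_max_left _ _
  have hCK : 2 * K ≤ C := (le_max_left _ _).trans (le_max_right _ _)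
  have hCκ : 2 / κ ≤ C := (le_max_right _ _).trans (le_max_right _ _)
  have hC0 : 0 < C := by linarith
  refine ⟨C, hC0, ?_⟩
  intro δ Γ h H x₀ ρ M hM hρ hx₀ hH
  have hδ := h.mesh_pos
  -- Number of scales down to the mesh; the induction on it keeps `C` independent of `n`.
  obtain ⟨n, hn⟩ : ∃ n : ℕ, κ ^ n * ρ < K * δ := by
    obtain ⟨n, hn⟩ := exists_pow_lt_of_lt_one (show 0 < K * δ / ρ by positivity)
      (show κ < 1 by linarith)
    exact ⟨n, by rwa [lt_div_iff₀ hρ] at hn⟩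
  have htriv : ∀ {H : ℂ → ℝ} {ρ M : ℝ}, 0 < ρ → Γ.HarmonicBdd H x₀ ρ M →
      ∀ u ∈ Γ.vball x₀ ρ, |H u - H x₀| ≤ 2 * M := by
    intro H ρ M hρ hH u hu
    have h1 := (hH u hu).2
    have h2 := (hH x₀ (mem_vball.2 ⟨hx₀, by rwa [dist_self]⟩)).2
    exact (abs_sub _ _).trans (by linarith)
  have hsmall : ∀ {H : ℂ → ℝ} {ρ M : ℝ}, 0 ≤ M → 0 < ρ → ρ < K * δ → Γ.HarmonicBdd H x₀ ρ M →
      ∀ u ∈ Γ.vball x₀ ρ, |H u - H x₀| ≤ C * M * (max (dist u x₀) δ / ρ) := by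
    intro H ρ M hM hρ hlt hH u hu
    refine (htriv hρ hH u hu).trans ?_
    have h1 : 2 ≤ C * (max (dist u x₀) δ / ρ) := by
      rw [mul_div_assoc', le_div_iff₀ hρ]
      calc 2 * ρ ≤ 2 * (K * δ) := by linarith
        _ = 2 * K * δ := by ring
        _ ≤ C * max (dist u x₀) δ := mul_le_mul hCK (le_max_right _ _) hδ.le hC0.le
    calc 2 * M ≤ C * (max (dist u x₀) δ / ρ) * M := mul_le_mul_of_nonneg_right h1 hM
      _ = _ := by ring
  induction n generalizing H ρ M with
  | zero =>
    rw [pow_zero, one_mul] at hn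
    exact hsmall hM hρ hn hH
  | succ n ih =>
    intro u hu
    rcases lt_or_ge ρ (K * δ) with hlt | hge
    · exact hsmall hM hρ hlt hH u hu
    have hu' := mem_vball.1 hu
    have hmax0 : 0 ≤ max (dist u x₀) δ := hδ.le.trans (le_max_right _ _)
    rcases lt_or_ge (dist u x₀) (κ * ρ) with hd | hd
    · obtain ⟨c, a, ha, hca⟩ := happ h hM hge hH
      have hsub := hH.sub_affine hδ hρ.le (by linarith) hca
      have h1 := ih (ρ := κ * ρ) (M := κ / 2 * M) (by positivity) (by positivity) hsub
        (by rw [← mul_assoc, ← pow_succ]; exact hn) u (mem_vball.2 ⟨hu'.1, hd⟩)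
      have h2 : |ip a (u - x₀)| ≤ C₁ * M * (max (dist u x₀) δ / ρ) := by
        refine (abs_ip_le _ _).trans ?_
        rw [← dist_eq_norm]
        calc ‖a‖ * dist u x₀ ≤ C₁ * M / ρ * max (dist u x₀) δ :=
              mul_le_mul ha (le_max_left _ _) dist_nonneg (by positivity)
          _ = _ := by ring
      have e : H u - H x₀ = (H u - (c + ip a (u - x₀)) - (H x₀ - (c + ip a (x₀ - x₀)))) +
          ip a (u - x₀) := by simp [ip]; ring
      -- The ratio `M / ρ` halves for the remainder, so its estimate takes `C / 2` and leaves `C / 2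
      -- ≥ C₁` for the linear part.
      have h3 : C * (κ / 2 * M) * (max (dist u x₀) δ / (κ * ρ)) =
          C / 2 * (M * (max (dist u x₀) δ / ρ)) := by field_simp
      have h4 : C₁ * (M * (max (dist u x₀) δ / ρ)) ≤ C / 2 * (M * (max (dist u x₀) δ / ρ)) :=
        mul_le_mul_of_nonneg_right (by linarith) (by positivity)
      rw [h3] at h1
      rw [e]
      refine (abs_add_le _ _).trans ?_
      linarith
    · refine (htriv hρ hH u hu).trans ?_
      have h1 : 2 ≤ C * (max (dist u x₀) δ / ρ) := by
        rw [mul_div_assoc', le_div_iff₀ hρ]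
        calc 2 * ρ = 2 / κ * (κ * ρ) := by field_simp
          _ ≤ C * max (dist u x₀) δ :=
            mul_le_mul hCκ (hd.trans (le_max_left _ _)) (by positivity) hC0.le
      calc 2 * M ≤ C * (max (dist u x₀) δ / ρ) * M := mul_le_mul_of_nonneg_right h1 hM
        _ = _ := by ring

/-! ### Discretizations of discs -/

variable {V : Set ℂ} {c : ℂ} {R r : ℝ}

theorem IsDiscretization.subset {Ω : Set ℂ} (hV : Γ.IsDiscretization Ω V) :
    V ⊆ Γ.vertices ∩ Ω := by
  obtain ⟨K, rfl, -⟩ := hV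
  rintro _ ⟨x, -, rfl⟩
  exact x.2

theorem IsDiscretization.nonempty {Ω : Set ℂ} (hV : Γ.IsDiscretization Ω V) : V.Nonempty := by
  obtain ⟨K, rfl, -⟩ := hV
  exact K.nonempty_supp.image _

theorem IsDiscretization.mem_of_reachable {Ω : Set ℂ} (hV : Γ.IsDiscretization Ω V)
    {x y : ↥(Γ.vertices ∩ Ω)} (hx : (x : ℂ) ∈ V) (hxy : (Γ.inside Ω).Reachable x y) :
    (y : ℂ) ∈ V := by
  obtain ⟨K, rfl, -⟩ := hV
  obtain ⟨x', hx', he⟩ := hx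
  rw [Subtype.val_injective he] at hx'
  refine ⟨y, ?_, rfl⟩
  rw [SimpleGraph.ConnectedComponent.mem_supp_iff] at hx' ⊢
  rw [← hx']
  exact SimpleGraph.ConnectedComponent.sound hxy.symm

theorem IsDiscretization.reachable {Ω : Set ℂ} (hV : Γ.IsDiscretization Ω V)
    {x y : ↥(Γ.vertices ∩ Ω)} (hx : (x : ℂ) ∈ V) (hy : (y : ℂ) ∈ V) :
    (Γ.inside Ω).Reachable x y := by
  obtain ⟨K, rfl, -⟩ := hV
  obtain ⟨x', hx', hex⟩ := hx
  obtain ⟨y', hy', hey⟩ := hy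
  rw [Subtype.val_injective hex, SimpleGraph.ConnectedComponent.mem_supp_iff] at hx'
  rw [Subtype.val_injective hey, SimpleGraph.ConnectedComponent.mem_supp_iff] at hy'
  exact SimpleGraph.ConnectedComponent.exact (hx'.trans hy'.symm)

theorem IsDiscretization.finite (hV : Γ.IsDiscretization (Metric.ball c R) V) : V.Finite :=
  (Γ.finite_vertices_ball c R).subset hV.subset

theorem finite_boundary (hV : V.Finite) : (Γ.boundary V).Finite := by
  refine (hV.biUnion fun u _ => ((Γ.finite_neighborSet u).image fun a => (a, u))).subset ?_
  rintro ⟨a, u⟩ ⟨hu, -, ha⟩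
  exact Set.mem_biUnion (x := u) hu ⟨a, ha, rfl⟩

/-- A nonempty set of vertices which contains all neighbors of its elements is infinite. -/
theorem exists_boundary (hδ : 0 < δ) (hV : V ⊆ Γ.vertices ∩ Metric.ball c R) (hne : V.Nonempty) :
    ∃ u ∈ V, ∃ v ∉ V, Γ.graph.Adj u v := by
  by_contra hcon
  push Not at hcon
  have hclosed : ∀ u ∈ V, ∀ v, Γ.graph.Adj u v → v ∈ V := fun u hu v huv => by
    by_contra hv
    exact hcon u hu v hv huv
  obtain ⟨x, hx⟩ := hne
  have hR : dist x c < R := (hV hx).2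
  -- A vertex outside the disc; the whole graph is connected, so a set closed under adjacency would
  -- contain it.
  obtain ⟨y, hy, hyd⟩ := Γ.exists_vertex_near (c + (R + 2 * δ : ℝ))
  have hfar : R ≤ dist y c := by
    have h1 : dist (c + (R + 2 * δ : ℝ)) c = R + 2 * δ := by
      rw [dist_eq_norm, add_sub_cancel_left, Complex.norm_real, Real.norm_eq_abs,
        abs_of_nonneg (by linarith [dist_nonneg (x := x) (y := c)])]
    have := dist_triangle_left (c + (R + 2 * δ : ℝ)) c y
    linarith
  have hreach := inside_reachable (Γ := Γ) hδ (Ω := Set.univ) convex_univ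
    ⟨x, (hV hx).1, trivial⟩ ⟨y, hy, trivial⟩ (fun _ _ _ _ => trivial)
  have hmem : ∀ {a d : ↥(Γ.vertices ∩ Set.univ)} (_ : (Γ.inside Set.univ).Walk a d),
      (a : ℂ) ∈ V → (d : ℂ) ∈ V := by
    intro a d p
    induction p with
    | nil => exact id
    | cons hac _ ih => exact fun ha => ih (hclosed _ ha _ hac.1)
  obtain ⟨p⟩ := hreach
  have hyV : y ∈ V := hmem p hx
  have hlt : dist y c < R := (hV hyV).2
  linarith

/-- Otherwise both ends of a boundary edge of `W` would be joined inside the disc of radius `R`,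
hence inside that of radius `r`, and the outer end would belong to `W`. -/
theorem radius_lt_of_locations_subset (hδ : 0 < δ) {V W : Set ℂ}
    (hV : Γ.IsDiscretization (Metric.ball c R) V) (hW : Γ.IsDiscretization (Metric.ball c r) W)
    (hsub : Γ.locations W ⊆ V) : r < R := by
  by_contra hcon
  push Not at hcon
  obtain ⟨u, hu, v, hv, huv⟩ := exists_boundary hδ hW.subset hW.nonempty
  have huV : u ∈ V := hsub (Or.inl hu)
  have hvV : v ∈ V := hsub (Or.inr ⟨(v, u), ⟨hu, hv, huv⟩, rfl⟩)
  have hball : Metric.ball c R ⊆ Metric.ball c r := Metric.ball_subset_ball hcon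
  have hreach := hV.reachable (x := ⟨u, hV.subset huV⟩) (y := ⟨v, hV.subset hvV⟩) huV hvV
  let f : Γ.inside (Metric.ball c R) →g Γ.inside (Metric.ball c r) :=
    { toFun := fun x => ⟨x, x.2.1, hball x.2.2⟩
      map_rel' := fun hxy => ⟨hxy.1, hxy.2.trans hball⟩ }
  exact hv (hW.mem_of_reachable (x := f ⟨u, hV.subset huV⟩) hu (hreach.map f))

theorem dist_lt_of_mem_locations (hδ : 0 < δ) (hV : Γ.IsDiscretization (Metric.ball c r) V)
    (hu : u ∈ Γ.locations V) : dist u c < r + 2 * δ := by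
  rcases hu with hu | ⟨⟨a, w⟩, ⟨hw, -, hadj⟩, rfl⟩
  · have : dist u c < r := (hV.subset hu).2
    linarith
  · have h1 : dist w c < r := (hV.subset hw).2
    have h2 := Adj.dist_le hadj
    have := dist_triangle_left a c w
    simp only at h1 h2 this ⊢
    linarith

open Classical in
/-- A function on a discrete domain, extended by zero from the interior vertices. -/
noncomputable def extend (V : Set ℂ) (H : Γ.Domain V → ℝ) (z : ℂ) : ℝ :=
  if hz : z ∈ V then H (Sum.inl ⟨z, hz⟩) else 0

theorem extend_eq {H : Γ.Domain V → ℝ} (hz : z ∈ V) : extend V H z = H (Sum.inl ⟨z, hz⟩) :=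
  dif_pos hz

theorem lap_extend (h : Γ.Regular b) {H : Γ.Domain V → ℝ} (hH : Γ.IsDiscreteHarmonic V H)
    (hu : u ∈ V) (huv : u ∈ Γ.vertices) (hnbr : ∀ v, Γ.graph.Adj u v → v ∈ V) :
    Γ.lap (extend V H) u = 0 := by
  have h1 := hH ⟨u, hu⟩
  rw [laplacian, mul_eq_zero] at h1
  have h2 := h1.resolve_left (one_div_ne_zero (h.weight_pos huv).ne')
  rw [lap, ← sum_neighborSet (fun v => Real.tan (Γ.halfAngle u v) *
    (extend V H v - extend V H u)), ← h2]
  refine Finset.sum_congr rfl fun v _ => ?_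
  have hv : (v : ℂ) ∈ V := hnbr v v.2
  rw [extend_eq hu, extend_eq hv, nbr, dif_pos hv]

/-- The margin `4 δ` is `2 δ` for the neighbors of the disc of radius `ρ` and `2 δ` to connect them
to `u` inside the large disc. So every value involved is at an interior vertex, and the zero
extension is never seen. -/
theorem harmonicBdd_extend (h : Γ.Regular b) (hV : Γ.IsDiscretization (Metric.ball c R) V)
    {H : Γ.Domain V → ℝ} (hH : Γ.IsDiscreteHarmonic V H) {M : ℝ} (hM : ∀ x, |H x| ≤ M)
    {ρ : ℝ} (hρ : 0 < ρ) (hu : u ∈ V) (hR : dist u c + ρ + 4 * δ ≤ R) :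
    Γ.HarmonicBdd (extend V H) u ρ M := by
  have hδ := h.mesh_pos
  have hsub : ∀ z ∈ Γ.vertices, dist z u < ρ + 2 * δ → z ∈ V := by
    intro z hz hzu
    have hzc : dist z c < R := by linarith [dist_triangle z u c]
    refine hV.mem_of_reachable (x := ⟨u, hV.subset hu⟩) (y := ⟨z, hz, hzc⟩) hu ?_
    refine inside_reachable hδ (convex_ball _ _) _ _ fun p hp w hw => ?_
    have hp' : dist p u < ρ + 2 * δ := (convex_ball u (ρ + 2 * δ)).segment_subset
      (Metric.mem_ball_self (by linarith)) hzu hp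
    rw [Metric.mem_ball]
    linarith [dist_triangle w p c, dist_triangle p u c]
  have hsub' : ∀ z ∈ Γ.vball u ρ, z ∈ V := fun z hz =>
    hsub z (mem_vball.1 hz).1 (by linarith [(mem_vball.1 hz).2])
  refine fun z hz => ⟨?_, by rw [extend_eq (hsub' z hz)]; exact hM _⟩
  refine lap_extend h hH (hsub' z hz) (mem_vball.1 hz).1 fun v hv => ?_
  refine hsub v (Adj.mem_vertices hv) ?_
  linarith [Adj.dist_le hv, dist_triangle_left v u z, (mem_vball.1 hz).2]

end IsoradialGraph

/-! ### The Lipschitz estimate in the discretized disc. -/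

open IsoradialGraph in
theorem corollary2p8 (η : ℝ) (hη : 0 < η) :
    ∃ C : ℝ, 0 < C ∧
      ∀ (δ : ℝ) (_ : 0 < δ) (Γ : IsoradialGraph δ) (_ : Γ.AnglesBounded η)
        (u₀ : ℂ) (R r : ℝ) (BR Br : Set ℂ)
        (_ : Γ.IsDiscretization (Metric.ball u₀ R) BR)
        (_ : Γ.IsDiscretization (Metric.ball u₀ r) Br)
        (hsub : Γ.locations Br ⊆ BR)
        (H : Γ.Domain BR → ℝ) (_ : Γ.IsDiscreteHarmonic BR H)
        (u₁ u₂ : ℂ) (h₁ : u₁ ∈ Γ.locations Br) (h₂ : u₂ ∈ Γ.locations Br),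
        ∃ M : ℝ, IsGreatest (Set.range fun x : Γ.Domain BR => |H x|) M ∧
          |H (Sum.inl ⟨u₂, hsub h₂⟩) - H (Sum.inl ⟨u₁, hsub h₁⟩)| ≤
            C * (M * ‖u₂ - u₁‖ / (R - r)) := by
  have hpi := Real.pi_pos
  set η' := min η (Real.pi / 2) with hη'
  have hη'0 : 0 < η' := lt_min hη (by linarith)
  have hη'1 : η' ≤ Real.pi / 2 := min_le_right _ _
  set b := Real.sin (η' / 2) with hbdef
  have hb : 0 < b := Real.sin_pos_of_pos_of_lt_pi (by linarith) (by linarith)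
  have hb1 : b ≤ 1 := Real.sin_le_one _
  obtain ⟨C₀, hC₀, hlip⟩ := exists_lipschitz hb hb1
  -- One summand per regime: `u₂` within the interior estimate around `u₁`, `u₂` at distance
  -- comparable to `R - r`, and `R - r < 12 δ`, where the separation `2 δ b²` suffices.
  refine ⟨2 * C₀ / b ^ 2 + 4 + 12 / b ^ 2, by positivity, ?_⟩
  intro δ hδ Γ hΓ u₀ R r BR Br hBR hBr hsub H hH u₁ u₂ h₁ h₂
  have h : Γ.Regular b := ⟨(hΓ.mono (min_le_left _ _)).fat hδ hη'0 hη'1, hδ, hb, hb1⟩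
  have : Finite (Γ.Domain BR) := by
    have := hBR.finite.to_subtype
    have := (finite_boundary (Γ := Γ) hBR.finite).to_subtype
    infer_instance
  have : Nonempty (Γ.Domain BR) := ⟨Sum.inl ⟨u₁, hsub h₁⟩⟩
  obtain ⟨x, hx⟩ := Finite.exists_max fun x : Γ.Domain BR => |H x|
  refine ⟨|H x|, ⟨⟨x, rfl⟩, by rintro _ ⟨y, rfl⟩; exact hx y⟩, ?_⟩
  set M := |H x| with hMdef
  have hM : 0 ≤ M := abs_nonneg _
  have hrR : 0 < R - r := sub_pos.2 (radius_lt_of_locations_subset hδ hBR hBr hsub)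
  by_cases hne : u₁ = u₂
  · subst hne
    simp
  have hv₁ : u₁ ∈ Γ.vertices := (hBR.subset (hsub h₁)).1
  have hv₂ : u₂ ∈ Γ.vertices := (hBR.subset (hsub h₂)).1
  have hsep := h.fat.separated hδ hb hb1 hv₁ hv₂ hne
  rw [dist_comm] at hsep
  rw [← dist_eq_norm]
  set d := dist u₂ u₁ with hd
  have hd0 : 0 < d := lt_of_lt_of_le (by positivity) hsep
  have htriv : |H (Sum.inl ⟨u₂, hsub h₂⟩) - H (Sum.inl ⟨u₁, hsub h₁⟩)| ≤ 2 * M :=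
    (abs_sub _ _).trans (by linarith [hx (Sum.inl ⟨u₂, hsub h₂⟩), hx (Sum.inl ⟨u₁, hsub h₁⟩)])
  have hq : 0 ≤ M * d / (R - r) := by positivity
  have hsplit : (2 * C₀ / b ^ 2 + 4 + 12 / b ^ 2) * (M * d / (R - r)) =
      2 * C₀ / b ^ 2 * (M * d / (R - r)) + 4 * (M * d / (R - r)) +
        12 / b ^ 2 * (M * d / (R - r)) := by ring
  have p1 : 0 ≤ 2 * C₀ / b ^ 2 * (M * d / (R - r)) := by positivity
  have p3 : 0 ≤ 12 / b ^ 2 * (M * d / (R - r)) := by positivity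
  rw [hsplit]
  rcases lt_or_ge (R - r) (12 * δ) with hsmall | hbig
  · have h1 : 2 * M ≤ 12 / b ^ 2 * (M * d / (R - r)) := by
      rw [div_mul_div_comm, le_div_iff₀ (by positivity)]
      have h2 : 2 * (b ^ 2 * (R - r)) ≤ 12 * d := by
        have := mul_le_mul_of_nonneg_left hsmall.le (show 0 ≤ b ^ 2 by positivity)
        linarith
      have := mul_le_mul_of_nonneg_left h2 hM
      linarith
    linarith
  -- `6 δ` is `2 δ` for a location beyond radius `r` plus the margin `4 δ` of `harmonicBdd_extend`.
  · have hρ : (R - r) / 2 ≤ R - r - 6 * δ := by linarith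
    have hρ0 : 0 < R - r - 6 * δ := by linarith
    have hu₁ := dist_lt_of_mem_locations hδ hBr h₁
    have hbdd := harmonicBdd_extend h hBR hH hx hρ0 (hsub h₁) (by linarith)
    rcases lt_or_ge d (R - r - 6 * δ) with hlt | hge
    · have h1 := hlip h hM hρ0 hv₁ hbdd u₂ (mem_vball.2 ⟨hv₂, hlt⟩)
      rw [extend_eq (hsub h₁), extend_eq (hsub h₂)] at h1
      -- Separation of vertices absorbs the mesh cutoff in the Lipschitz estimate.
      have hmax : max d δ ≤ d / b ^ 2 := by
        rw [le_div_iff₀ (by positivity)]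
        have hb2 : b ^ 2 ≤ 1 := pow_le_one₀ hb.le hb1
        rcases max_cases d δ with ⟨e, -⟩ | ⟨e, -⟩ <;> rw [e]
        · nlinarith
        · nlinarith [mul_pos hδ (pow_pos hb 2)]
      have h2 : C₀ * M * (max d δ / (R - r - 6 * δ)) ≤ 2 * C₀ / b ^ 2 * (M * d / (R - r)) := by
        calc _ ≤ C₀ * M * (d / b ^ 2 / ((R - r) / 2)) := by gcongr
          _ = _ := by field_simp
      linarith
    · have h1 : 2 * M ≤ 4 * (M * d / (R - r)) := by
        rw [mul_div_assoc', le_div_iff₀ hrR]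
        have h2 : (R - r) * M ≤ 2 * d * M := mul_le_mul_of_nonneg_right (by linarith) hM
        linarith
      linarith
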